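/- Let $K$ be a field of characteristic zero (for instance $K=\mathbb{Q}(t)$ with $t$ an indeterminate), and let $t\in K$ be nonzero and not a root of unity. For a partition $\lambda$, let $|\lambda|$ be its size, $o(\lambda)$ the number of its odd parts, and $m_i(\lambda)$ the number of its parts equal to $i$. For a box $s$ of the diagram of $\lambda$, let $a(s)$ be the number of boxes strictly to the right of $s$ in its row and $l(s)$ the number of boxes strictly below $s$ in its column, and put $$c_\lambda(t)=\prod_{s\in\lambda:\ a(s)=0,\ l(s)\text{ even}}\bigl(1-t^{l(s)+1}\bigr).$$ For a partition $\lambda=(\lambda_1\ge\dots\ge\lambda_n\ge 0)$ with $n$ parts, zeros allowed, so that here $m_0(\lambda)$ counts the zero parts, the Hall–Littlewood polynomial is $$P_\lambda(x_1,\dots,x_n;t)=\Bigl(\prod_{i\ge0}\prod_{j=1}^{m_i(\lambda)}\frac{1-t^j}{1-t}\Bigr)^{-1}\sum_{w\in S_n}w\Bigl(x_1^{\lambda_1}\cdots x_n^{\lambda_n}\prod_{1\le i<j\le n}\frac{x_i-tx_j}{x_i-x_j}\Bigr),$$ and $P_\lambda(x;t)$ is the formal power series in $x_1,x_2,\dots$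 that is the coefficientwise limit of $P_\lambda(x_1,\dots,x_n;t)$ as $n\to\infty$. **Theorem (Kawanaka's identity).** In the ring of formal power series over $K$ in the variables $x_1,x_2,\dots$, with coefficientwise convergence (each coefficient is eventually constant), the infinite product below converges, the infinite sum converges, and $$\sum_{\lambda}t^{\frac{o(\lambda)-|\lambda|}{2}}\,c_\lambda(t)\,P_\lambda(x;t)=\prod_{1\le i\le j}\frac{1-x_ix_j}{1-x_ix_j/t},$$ where the sum is over all partitions $\lambda$ (of all nonnegative integers, including the empty one) in which every odd part occurs with even multiplicity. (For these $\lambda$ the exponent $(o(\lambda)-|\lambda|)/2$ is an integer.) -/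

import Mathlib

open scoped MvPowerSeries.WithPiTopology

namespace HallLittlewood

section Partitions

/-- The number of parts of `μ` equal to `i`, for `i ≥ 1`. -/
def partMult (μ : YoungDiagram) (i : ℕ) : ℕ :=
  μ.rowLens.count i

/-- The number of odd parts of `μ`. -/
def oddParts (μ : YoungDiagram) : ℕ :=
  μ.rowLens.countP (fun k => k % 2 = 1)

/-- Every odd part occurs with even multiplicity. -/
def OddPartsEvenMult (μ : YoungDiagram) : Prop :=
  ∀ i : ℕ, Odd i → Even (partMult μ i)

/-- The number of boxes of `μ` in the same row as `s` and strictly to the east of `s`. -/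
def arm (μ : YoungDiagram) (s : ℕ × ℕ) : ℕ :=
  (μ.cells.filter fun b => b.1 = s.1 ∧ s.2 < b.2).card

/-- The number of boxes of `μ` in the same column as `s` and strictly to the south of `s`. -/
def leg (μ : YoungDiagram) (s : ℕ × ℕ) : ℕ :=
  (μ.cells.filter fun b => b.2 = s.2 ∧ s.1 < b.1).card

/-- The product of `1 - t ^ (l(s) + 1)` over the boxes `s` of `μ` with arm `0` and even leg. -/
def cCoeff {K : Type*} [CommRing K] (t : K) (μ : YoungDiagram) : K :=
  ∏ s ∈ μ.cells with arm μ s = 0 ∧ leg μ s % 2 = 0, (1 - t ^ (leg μ s + 1))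

end Partitions

noncomputable section

variable {K : Type*} [Field K]

/-- `m_i` of `μ` regarded as a partition with exactly `n` parts, zeros allowed. -/
def paddedMult (n : ℕ) (μ : YoungDiagram) (i : ℕ) : ℕ :=
  (Finset.univ.filter fun k : Fin n => μ.rowLen k = i).card

/-- `v_μ(t) = ∏_{i ≥ 0} ∏_{j=1}^{m_i} (1 - t^j) / (1 - t)`; for `i` larger than the largest part
the inner product is empty. -/
def vFactor (t : K) (n : ℕ) (μ : YoungDiagram) : K :=
  ∏ i ∈ Finset.range (μ.rowLen 0 + 1), ∏ j ∈ Finset.Icc 1 (paddedMult n μ i),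
    (1 - t ^ j) / (1 - t)

/-- The variable `x_i` in the field of rational functions `K(x_1, …, x_n)`. -/
def xvar (K : Type*) [Field K] {n : ℕ} (i : Fin n) : FractionRing (MvPolynomial (Fin n) K) :=
  algebraMap (MvPolynomial (Fin n) K) _ (MvPolynomial.X i)

/-- A scalar of `K` as an element of `K(x_1, …, x_n)`. -/
def scalar {n : ℕ} (a : K) : FractionRing (MvPolynomial (Fin n) K) :=
  algebraMap (MvPolynomial (Fin n) K) _ (MvPolynomial.C a)

/-- The defining expression of `P_μ(x_1, …, x_n; t)`, as a rational function. -/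
def hlRational (t : K) (μ : YoungDiagram) (n : ℕ) : FractionRing (MvPolynomial (Fin n) K) :=
  (scalar (vFactor t n μ))⁻¹ *
    ∑ w : Equiv.Perm (Fin n),
      ((∏ i, xvar K (w i) ^ μ.rowLen i) *
        ∏ i, ∏ j ∈ Finset.Ioi i,
          (xvar K (w i) - scalar t * xvar K (w j)) / (xvar K (w i) - xvar K (w j)))

/-- Auxiliary: the product of `v i - s * v j` over `i < j`. -/
def pairProd {A : Type*} [CommRing A] (s : A) {n : ℕ} (v : Fin n → A) : A :=
  ∏ i, ∏ j ∈ Finset.Ioi i, (v i - s * v j)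

/-- Auxiliary: the numerator of the symmetrized sum over the common denominator
`∏_{i<j} (x_i - x_j)`. -/
def hlNum (t : K) (f : ℕ → ℕ) (n : ℕ) : MvPolynomial (Fin n) K :=
  ∑ w : Equiv.Perm (Fin n), ((Equiv.Perm.sign w : ℤ) : MvPolynomial (Fin n) K) *
    ((∏ i, MvPolynomial.X (w i) ^ f i) *
      pairProd (MvPolynomial.C t) (fun i => MvPolynomial.X (w i)))

theorem pairProd_one_perm {A : Type*} [CommRing A] {n : ℕ} (v : Fin n → A)
    (w : Equiv.Perm (Fin n)) :
    pairProd 1 (fun i => v (w i)) = ((Equiv.Perm.sign w : ℤ) : A) * pairProd 1 v := by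
  have h : ∀ u : Fin n → A, pairProd 1 u = (Matrix.vandermonde (fun i => - u i)).det := by
    intro u
    rw [Matrix.det_vandermonde]
    refine Finset.prod_congr rfl fun i _ => Finset.prod_congr rfl fun j _ => ?_
    ring
  rw [h, h, ← Matrix.det_permute]
  rfl

theorem X_sub_X_dvd {n : ℕ} (i j : Fin n) (p : MvPolynomial (Fin n) K)
    (hp : MvPolynomial.aeval (fun k => if k = j then MvPolynomial.X i else
      (MvPolynomial.X k : MvPolynomial (Fin n) K)) p = 0) :
    (MvPolynomial.X i - MvPolynomial.X j : MvPolynomial (Fin n) K) ∣ p := by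
  rw [← Ideal.mem_span_singleton, ← Ideal.Quotient.eq_zero_iff_mem]
  set I := Ideal.span {(MvPolynomial.X i - MvPolynomial.X j : MvPolynomial (Fin n) K)} with hI
  have key : (Ideal.Quotient.mkₐ K I).comp (MvPolynomial.aeval (fun k => if k = j then
      MvPolynomial.X i else (MvPolynomial.X k : MvPolynomial (Fin n) K))) =
      Ideal.Quotient.mkₐ K I := by
    apply MvPolynomial.algHom_ext
    intro k
    by_cases hk : k = j
    · subst hk
      simp only [AlgHom.comp_apply, MvPolynomial.aeval_X, if_true, Ideal.Quotient.mkₐ_eq_mk]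
      rw [Ideal.Quotient.eq]
      exact Ideal.mem_span_singleton_self _
    · simp [hk]
  have := congrArg (fun φ => φ p) key
  simp only [AlgHom.comp_apply, hp, map_zero, Ideal.Quotient.mkₐ_eq_mk] at this
  exact this.symm

theorem irreducible_X_sub_X {n : ℕ} {i j : Fin n} (hij : i ≠ j) :
    Irreducible (MvPolynomial.X i - MvPolynomial.X j : MvPolynomial (Fin n) K) := by
  have hc : MvPolynomial.coeff (Finsupp.single i 1)
      (MvPolynomial.X i - MvPolynomial.X j : MvPolynomial (Fin n) K) = 1 := by
    have : ¬ (Finsupp.single j 1 = (Finsupp.single i 1 : Fin n →₀ ℕ)) := by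
      rw [Finsupp.single_left_inj one_ne_zero]; exact hij.symm
    simp [MvPolynomial.coeff_X, this]
  apply MvPolynomial.irreducible_of_totalDegree_eq_one
  · apply le_antisymm
    · refine (MvPolynomial.totalDegree_sub _ _).trans ?_
      simp
    · have := MvPolynomial.le_totalDegree (s := Finsupp.single i 1)
        (p := (MvPolynomial.X i - MvPolynomial.X j : MvPolynomial (Fin n) K))
        (by rw [MvPolynomial.mem_support_iff, hc]; exact one_ne_zero)
      simpa using this
  · intro x hx
    have := hx (Finsupp.single i 1)
    rw [hc] at this
    exact isUnit_of_dvd_one this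

theorem isRelPrime_X_sub_X {n : ℕ} {i j k l : Fin n} (hij : i < j) (hkl : k < l)
    (h : ¬ (i = k ∧ j = l)) :
    IsRelPrime (MvPolynomial.X i - MvPolynomial.X j : MvPolynomial (Fin n) K)
      (MvPolynomial.X k - MvPolynomial.X l) := by
  rw [(irreducible_X_sub_X hij.ne).isRelPrime_iff_not_dvd]
  rintro ⟨q, hq⟩
  have := congrArg (MvPolynomial.eval (fun m => if m = i ∨ m = j then (1 : K) else 0)) hq
  simp only [map_sub, map_mul, MvPolynomial.eval_X] at this
  have h1 := congrArg (MvPolynomial.eval (fun m => if m = k then (1 : K) else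
    if m = l then 0 else if m = i then (if j = k then 1 else 0) else
      if m = j then (if i = k then 1 else 0) else 0)) hq
  simp only [map_sub, map_mul, MvPolynomial.eval_X] at h1
  have e1 := hij.ne
  have e2 := hkl.ne
  grind

theorem pairProd_dvd_hlNum (t : K) (f : ℕ → ℕ) (n : ℕ) :
    pairProd 1 (fun i => MvPolynomial.X i) ∣ hlNum t f n := by
  unfold pairProd
  rw [Finset.prod_sigma']
  apply Finset.prod_dvd_of_isRelPrime
  · rintro ⟨i, j⟩ hij ⟨k, l⟩ hkl hne
    simp only [Finset.coe_sigma, Set.mem_sigma_iff, Finset.coe_univ, Set.mem_univ, true_and,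
      Finset.coe_Ioi, Set.mem_Ioi] at hij hkl
    simp only [Function.onFun, one_mul]
    apply isRelPrime_X_sub_X hij hkl
    rintro ⟨rfl, rfl⟩
    exact hne rfl
  · rintro ⟨i, j⟩ hij
    simp only [Finset.mem_sigma, Finset.mem_univ, true_and, Finset.mem_Ioi] at hij
    rw [one_mul]
    apply X_sub_X_dvd
    unfold hlNum pairProd
    rw [map_sum]
    refine Finset.sum_involution (fun w _ => Equiv.swap i j * w) ?_ ?_ ?_ ?_
    · intro w _
      have hX : ∀ k : Fin n, (if Equiv.swap i j k = j then MvPolynomial.X i else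
          (MvPolynomial.X (Equiv.swap i j k) : MvPolynomial (Fin n) K)) =
          if k = j then MvPolynomial.X i else MvPolynomial.X k := by
        intro k
        rw [Equiv.swap_apply_def]
        grind
      simp only [map_mul, map_prod, map_sub, map_pow, MvPolynomial.aeval_X, map_intCast,
        MvPolynomial.aeval_C, Equiv.Perm.mul_apply, hX, Equiv.Perm.sign_swap hij.ne,
        Units.val_mul, Units.val_neg, Units.val_one, Int.cast_neg, Int.cast_mul, Int.cast_one,
        map_neg, map_one]
      ring
    · intro w _ _ h
      have := congrArg Equiv.Perm.sign h
      rw [Equiv.Perm.sign_mul, Equiv.Perm.sign_swap hij.ne] at this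
      rcases Int.units_eq_one_or (Equiv.Perm.sign w) with h' | h' <;> rw [h'] at this <;>
        exact absurd this (by decide)
    · intro w _
      exact Finset.mem_univ _
    · intro w _
      simp [← mul_assoc]

theorem algebraMap_injective (n : ℕ) : Function.Injective
    (algebraMap (MvPolynomial (Fin n) K) (FractionRing (MvPolynomial (Fin n) K))) :=
  IsFractionRing.injective _ _

theorem pairProd_one_ne_zero (n : ℕ) :
    pairProd 1 (fun i => MvPolynomial.X i : Fin n → MvPolynomial (Fin n) K) ≠ 0 := by
  unfold pairProd
  refine Finset.prod_ne_zero_iff.mpr fun i _ => Finset.prod_ne_zero_iff.mpr fun j hj => ?_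
  rw [one_mul]
  exact (irreducible_X_sub_X (Finset.mem_Ioi.mp hj).ne).ne_zero

theorem map_pairProd {A B : Type*} [CommRing A] [CommRing B] (φ : A →+* B) (s : A) {n : ℕ}
    (v : Fin n → A) : φ (pairProd s v) = pairProd (φ s) (fun i => φ (v i)) := by
  simp [pairProd]

/-- The defining expression times its denominators is the numerator polynomial. -/
theorem hlRational_eq (t : K) (μ : YoungDiagram) (n : ℕ) :
    hlRational t μ n = (scalar (vFactor t n μ))⁻¹ *
      (algebraMap _ _ (hlNum t μ.rowLen n) /
        algebraMap _ _ (pairProd 1 (fun i => MvPolynomial.X i : Fin n → MvPolynomial _ K))) := by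
  unfold hlRational
  congr 1
  rw [hlNum, map_sum, Finset.sum_div]
  refine Finset.sum_congr rfl fun w _ => ?_
  have h1 : ∏ i, ∏ j ∈ Finset.Ioi i,
      (xvar K (w i) - scalar t * xvar K (w j)) / (xvar K (w i) - xvar K (w j)) =
      algebraMap _ (FractionRing (MvPolynomial (Fin n) K))
        (pairProd (MvPolynomial.C t) (fun i => MvPolynomial.X (w i))) /
      algebraMap _ (FractionRing (MvPolynomial (Fin n) K))
        (pairProd 1 (fun i => MvPolynomial.X (w i) : Fin n → MvPolynomial (Fin n) K)) := by
    simp only [Finset.prod_div_distrib, map_pairProd]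
    simp [pairProd, xvar, scalar]
  have h0 : algebraMap _ (FractionRing (MvPolynomial (Fin n) K))
      (pairProd 1 (fun i => MvPolynomial.X i : Fin n → MvPolynomial (Fin n) K)) ≠ 0 := by
    rw [Ne, map_eq_zero_iff _ (algebraMap_injective n)]
    exact pairProd_one_ne_zero n
  rw [h1, pairProd_one_perm (fun i => (MvPolynomial.X i : MvPolynomial (Fin n) K)) w]
  simp only [map_mul, map_prod, map_pow, map_intCast, xvar]
  rcases Int.units_eq_one_or (Equiv.Perm.sign w) with h' | h' <;> rw [h'] <;> field_simp <;> simp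

/-- The defining expression is a polynomial. -/
theorem exists_hlPoly (t : K) (μ : YoungDiagram) (n : ℕ) :
    ∃ p : MvPolynomial (Fin n) K, algebraMap _ _ p = hlRational t μ n := by
  obtain ⟨q, hq⟩ := pairProd_dvd_hlNum t μ.rowLen n
  refine ⟨MvPolynomial.C (vFactor t n μ)⁻¹ * q, ?_⟩
  have h0 : algebraMap _ (FractionRing (MvPolynomial (Fin n) K))
      (pairProd 1 (fun i => MvPolynomial.X i : Fin n → MvPolynomial (Fin n) K)) ≠ 0 := by
    rw [Ne, map_eq_zero_iff _ (algebraMap_injective n)]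
    exact pairProd_one_ne_zero n
  rw [hlRational_eq, hq, map_mul, map_mul, mul_div_cancel_left₀ _ h0]
  congr 1
  simp only [scalar]
  exact map_inv₀ ((algebraMap _ (FractionRing (MvPolynomial (Fin n) K))).comp MvPolynomial.C) _

/-- The Hall-Littlewood polynomial `P_μ(x_1, …, x_n; t)`, for `μ` with at most `n` nonzero parts. -/
def hlPoly (t : K) (μ : YoungDiagram) (n : ℕ) : MvPolynomial (Fin n) K :=
  Classical.choose (exists_hlPoly t μ n)

theorem algebraMap_hlPoly (t : K) (μ : YoungDiagram) (n : ℕ) :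
    algebraMap _ _ (hlPoly t μ n) = hlRational t μ n :=
  Classical.choose_spec (exists_hlPoly t μ n)

/-- `P_μ(x_1, …, x_n; t)` as a power series in the infinitely many variables `x_1, x_2, …`
(indexed from `0`). -/
def hlPolySeries (t : K) (μ : YoungDiagram) (n : ℕ) : MvPowerSeries ℕ K :=
  (MvPolynomial.rename (Fin.val : Fin n → ℕ) (hlPoly t μ n) : MvPolynomial ℕ K)

/-- The Hall-Littlewood function `P_μ(x_1, x_2, …; t)` in infinitely many variables: the
coefficient of a monomial `m` is its coefficient in `P_μ(x_1, …, x_n; t)` for an `n` that is at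
least the number of parts of `μ` and such that `m` involves `x_1, …, x_n` only. -/
def hl (t : K) (μ : YoungDiagram) : MvPowerSeries ℕ K := fun m =>
  MvPowerSeries.coeff m (hlPolySeries t μ (max (μ.colLen 0) (m.support.sup id + 1)))

theorem pairProd_split {A : Type*} [CommRing A] (s : A) {n : ℕ} (v : Fin (n + 1) → A)
    (k : Fin (n + 1)) (hk : v k = 0) :
    pairProd s v = (-s) ^ (n - k : ℕ) * (∏ i, v (k.succAbove i)) *
      pairProd s (fun i => v (k.succAbove i)) := by
  have h : ∀ {m : ℕ} (u : Fin m → A),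
      pairProd s u = ∏ i, ∏ j, if i < j then u i - s * u j else 1 := by
    intro m u
    refine Finset.prod_congr rfl fun i _ => ?_
    rw [← Finset.prod_filter]
    congr 1
    ext j; simp
  have hcard : (-s) ^ (n - k : ℕ) = ∏ i : Fin n, if k < k.succAbove i then -s else 1 := by
    rw [← Finset.prod_filter, Finset.prod_const]
    congr 1
    have h2 : (Finset.univ.filter fun i : Fin n => k < k.succAbove i) =
        Finset.univ.filter fun i : Fin n => ¬ ((i : ℕ) < k) := by
      ext i
      simp [Fin.lt_succAbove_iff_le_castSucc, Fin.le_def]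
    have h3 := Finset.card_filter_add_card_filter_not (s := (Finset.univ : Finset (Fin n)))
      (fun i : Fin n => (i : ℕ) < k)
    rw [Fin.card_filter_val_lt] at h3
    have := k.is_lt
    simp only [Finset.card_univ, Fintype.card_fin] at h3
    rw [h2]
    omega
  rw [h, h, hcard, Fin.prod_univ_succAbove _ k, Fin.prod_univ_succAbove _ k]
  simp only [lt_irrefl, if_false, one_mul, Fin.prod_univ_succAbove _ k,
    Fin.succAbove_lt_succAbove_iff, hk, Finset.prod_mul_distrib, mul_zero, sub_zero, zero_sub]
  rw [← mul_assoc]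
  congr 1
  rw [← Finset.prod_mul_distrib, ← Finset.prod_mul_distrib]
  refine Finset.prod_congr rfl fun i _ => ?_
  rcases lt_or_gt_of_ne (Fin.succAbove_ne k i) with h1 | h1
  · simp [h1, h1.not_gt]
  · simp [h1, h1.not_gt]

/-- Auxiliary: the permutation of `Fin (n + 1)` sending `k` to the last element and inducing `w`
on the remaining elements. -/
def insertLast {n : ℕ} (p : Fin (n + 1) × Equiv.Perm (Fin n)) : Equiv.Perm (Fin (n + 1)) :=
  ((finSuccEquiv' p.1).trans (Equiv.optionCongr p.2)).trans (finSuccEquiv' (Fin.last n)).symm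

theorem insertLast_self {n : ℕ} (p : Fin (n + 1) × Equiv.Perm (Fin n)) :
    insertLast p p.1 = Fin.last n := by
  simp [insertLast]

theorem insertLast_succAbove {n : ℕ} (p : Fin (n + 1) × Equiv.Perm (Fin n)) (i : Fin n) :
    insertLast p (p.1.succAbove i) = (p.2 i).castSucc := by
  simp [insertLast]

theorem insertLast_bijective (n : ℕ) : Function.Bijective (insertLast (n := n)) := by
  rw [Fintype.bijective_iff_injective_and_card]
  refine ⟨?_, ?_⟩
  · rintro ⟨k, w⟩ ⟨k', w'⟩ h
    have h1 := insertLast_self (k, w)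
    have h2 := insertLast_self (k', w')
    rw [h, ← h2] at h1
    have h3 : k = k' := (insertLast (k', w')).injective h1
    subst h3
    congr 1
    ext i
    have h4 := insertLast_succAbove (k, w) i
    rw [h, insertLast_succAbove (k, w') i] at h4
    simpa [Fin.ext_iff] using h4.symm
  · simp [Fintype.card_perm, Nat.factorial_succ]

/-- Auxiliary: setting the last variable equal to zero. -/
def killLast (K : Type*) [Field K] (n : ℕ) :
    MvPolynomial (Fin (n + 1)) K →ₐ[K] MvPolynomial (Fin n) K :=
  MvPolynomial.aeval (Fin.lastCases 0 MvPolynomial.X)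

theorem killLast_pairProd (n : ℕ) :
    killLast K n (pairProd 1 MvPolynomial.X) =
      (∏ i, MvPolynomial.X i) * pairProd 1 MvPolynomial.X := by
  have h := map_pairProd (killLast K n).toRingHom 1 MvPolynomial.X
  simp only [AlgHom.toRingHom_eq_coe, RingHom.coe_coe] at h
  rw [h, pairProd_split _ _ (Fin.last n) (by simp [killLast])]
  simp [killLast]

theorem killLast_hlNum (t : K) (f : ℕ → ℕ) (l n : ℕ) (hf : ∀ i, f i = 0 ↔ l ≤ i) :
    killLast K n (hlNum t f (n + 1)) =
      MvPolynomial.C (∑ k : Fin (n + 1), if l ≤ k then t ^ (n - k : ℕ) else 0) *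
        (∏ i, MvPolynomial.X i) * hlNum t f n := by
  rw [hlNum, map_sum, ← (insertLast_bijective n).sum_comp, Fintype.sum_prod_type, map_sum,
    Finset.sum_mul, Finset.sum_mul]
  refine Finset.sum_congr rfl fun k _ => ?_
  rw [hlNum, Finset.mul_sum]
  refine Finset.sum_congr rfl fun w _ => ?_
  have hP : ∀ s : K, killLast K n (pairProd (MvPolynomial.C s)
      (fun i => MvPolynomial.X (insertLast (k, w) i))) =
      (-MvPolynomial.C s) ^ (n - k : ℕ) * (∏ i, MvPolynomial.X i) *
        pairProd (MvPolynomial.C s) (fun i => MvPolynomial.X (w i)) := by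
    intro s
    have h := map_pairProd (killLast K n).toRingHom
      (MvPolynomial.C s) (fun i => MvPolynomial.X (insertLast (k, w) i))
    simp only [AlgHom.toRingHom_eq_coe, RingHom.coe_coe] at h
    rw [h, pairProd_split _ _ k (by simp [killLast, insertLast_self (k, w)])]
    have h1 : ∀ i, killLast K n (MvPolynomial.X (insertLast (k, w) (k.succAbove i))) =
        MvPolynomial.X (w i) := by
      intro i
      rw [insertLast_succAbove (k, w) i]
      simp [killLast]
    have h2 : killLast K n (MvPolynomial.C s) = MvPolynomial.C s := by
      simp [killLast, MvPolynomial.algebraMap_eq]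
    simp only [h1, h2]
    rw [Equiv.prod_comp w (fun i => (MvPolynomial.X i : MvPolynomial (Fin n) K))]
  have hsign : ((Equiv.Perm.sign (insertLast (k, w)) : ℤ) : MvPolynomial (Fin n) K) =
      (-1) ^ (n - k : ℕ) * ((Equiv.Perm.sign w : ℤ) : MvPolynomial (Fin n) K) := by
    have h := hP 1
    rw [MvPolynomial.C_1, pairProd_one_perm (fun i => MvPolynomial.X i), MvPolynomial.C_1,
      pairProd_one_perm (fun i => MvPolynomial.X i), map_mul, map_intCast,
      killLast_pairProd] at h
    have h0 : (∏ i, MvPolynomial.X i) * pairProd 1 MvPolynomial.X ≠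
        (0 : MvPolynomial (Fin n) K) :=
      mul_ne_zero (Finset.prod_ne_zero_iff.mpr fun i _ => MvPolynomial.X_ne_zero i)
        (pairProd_one_ne_zero n)
    refine mul_right_cancel₀ h0 (h.trans ?_)
    ring
  have hmon : killLast K n (∏ i, MvPolynomial.X (insertLast (k, w) i) ^ f i) =
      if l ≤ k then ∏ i, MvPolynomial.X (w i) ^ f i else 0 := by
    rw [Fin.prod_univ_succAbove _ k, insertLast_self (k, w)]
    simp only [insertLast_succAbove (k, w), map_mul, map_prod, map_pow]
    simp only [killLast, MvPolynomial.aeval_X, Fin.lastCases_last, Fin.lastCases_castSucc]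
    split_ifs with hl
    · rw [(hf k).mpr hl, pow_zero, one_mul]
      refine Finset.prod_congr rfl fun i _ => ?_
      congr 1
      rcases lt_or_ge i.castSucc k with h | h
      · rw [Fin.succAbove_of_castSucc_lt _ _ h]
        rfl
      · rw [Fin.succAbove_of_le_castSucc _ _ h]
        have h3 : (k : ℕ) ≤ i := h
        rw [(hf i).mpr (hl.trans h3), (hf _).mpr]
        simp only [Fin.val_succ]
        omega
    · rw [zero_pow (fun h => hl ((hf k).mp h)), zero_mul]
  rw [map_mul, map_mul, hmon, hP, map_intCast, hsign]
  split_ifs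
  · rw [MvPolynomial.C_pow, neg_pow (MvPolynomial.C t)]
    have : ((-1 : MvPolynomial (Fin n) K) ^ (n - k : ℕ)) * (-1) ^ (n - k : ℕ) = 1 := by
      rw [← mul_pow]; simp
    linear_combination (((Equiv.Perm.sign w : ℤ) : MvPolynomial (Fin n) K) *
      (∏ i, MvPolynomial.X (w i) ^ f i) * MvPolynomial.C t ^ (n - k : ℕ) *
      (∏ i, MvPolynomial.X i) *
      pairProd (MvPolynomial.C t) (fun i => MvPolynomial.X (w i))) * this
  · simp

theorem rowLen_eq_zero_iff (μ : YoungDiagram) (i : ℕ) : μ.rowLen i = 0 ↔ μ.colLen 0 ≤ i := by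
  have h1 := μ.mem_iff_lt_rowLen (i := i) (j := 0)
  have h2 := μ.mem_iff_lt_colLen (i := i) (j := 0)
  rw [h1] at h2
  omega

theorem geom_sum_aux (t : K) (l n : ℕ) (hl : l ≤ n) :
    (∑ k : Fin (n + 1), if l ≤ k then t ^ (n - k : ℕ) else 0) * (1 - t) =
      1 - t ^ (n - l + 1) := by
  rw [Fin.sum_univ_eq_sum_range (fun k => if l ≤ k then t ^ (n - k) else 0) (n + 1),
    ← Finset.sum_range_reflect, ← geom_sum_mul_neg]
  congr 1
  have h : Finset.range (n - l + 1) ⊆ Finset.range (n + 1) := by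
    apply Finset.range_mono; omega
  rw [← Finset.sum_subset h]
  · refine Finset.sum_congr rfl fun k hk => ?_
    rw [Finset.mem_range] at hk
    rw [if_pos (by omega)]
    congr 1
    omega
  · intro k hk hk'
    rw [Finset.mem_range] at hk hk'
    rw [if_neg (by omega)]

theorem paddedMult_zero (n : ℕ) (μ : YoungDiagram) : paddedMult n μ 0 = n - μ.colLen 0 := by
  unfold paddedMult
  have h2 : (Finset.univ.filter fun k : Fin n => μ.rowLen k = 0) =
      Finset.univ.filter fun k : Fin n => ¬ ((k : ℕ) < μ.colLen 0) := by
    ext i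
    simp [rowLen_eq_zero_iff]
  have h3 := Finset.card_filter_add_card_filter_not (s := (Finset.univ : Finset (Fin n)))
    (fun i : Fin n => (i : ℕ) < μ.colLen 0)
  rw [Fin.card_filter_val_lt] at h3
  simp only [Finset.card_univ, Fintype.card_fin] at h3
  rw [h2]
  omega

theorem paddedMult_succ (n : ℕ) (μ : YoungDiagram) (hn : μ.colLen 0 ≤ n) (i : ℕ) (hi : i ≠ 0) :
    paddedMult (n + 1) μ i = paddedMult n μ i := by
  unfold paddedMult
  rw [Finset.card_filter, Finset.card_filter, Fin.sum_univ_castSucc]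
  simp [(rowLen_eq_zero_iff μ n).mpr hn, hi.symm]

theorem vFactor_succ (t : K) (ht1 : t ≠ 1) (n : ℕ) (μ : YoungDiagram) (hn : μ.colLen 0 ≤ n) :
    vFactor t (n + 1) μ = vFactor t n μ *
      ∑ k : Fin (n + 1), if μ.colLen 0 ≤ k then t ^ (n - k : ℕ) else 0 := by
  have h1 : 1 - t ≠ 0 := sub_ne_zero.mpr ht1.symm
  have h := geom_sum_aux t _ n hn
  rw [← eq_div_iff h1] at h
  rw [h]
  unfold vFactor
  rw [Finset.prod_range_succ', Finset.prod_range_succ', paddedMult_zero, paddedMult_zero,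
    Nat.succ_sub hn, Nat.succ_eq_add_one, Finset.prod_Icc_succ_top (by omega)]
  rw [mul_assoc]
  congr 1
  refine Finset.prod_congr rfl fun i _ => ?_
  rw [paddedMult_succ n μ hn _ (by omega)]

theorem vFactor_ne_zero (t : K) (ht : ∀ k : ℕ, 0 < k → t ^ k ≠ 1) (n : ℕ) (μ : YoungDiagram) :
    vFactor t n μ ≠ 0 := by
  refine Finset.prod_ne_zero_iff.mpr fun i _ => Finset.prod_ne_zero_iff.mpr fun j hj => ?_
  rw [Finset.mem_Icc] at hj
  have h1 := ht 1 one_pos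
  rw [pow_one] at h1
  exact div_ne_zero (sub_ne_zero.mpr (ht j (by omega)).symm) (sub_ne_zero.mpr h1.symm)

theorem hlPoly_mul (t : K) (ht : ∀ k : ℕ, 0 < k → t ^ k ≠ 1) (μ : YoungDiagram) (n : ℕ) :
    hlPoly t μ n * (MvPolynomial.C (vFactor t n μ) * pairProd 1 MvPolynomial.X) =
      hlNum t μ.rowLen n := by
  apply algebraMap_injective n
  rw [map_mul, algebraMap_hlPoly, hlRational_eq, map_mul]
  have h0 : algebraMap _ (FractionRing (MvPolynomial (Fin n) K))
      (pairProd 1 (fun i => MvPolynomial.X i : Fin n → MvPolynomial (Fin n) K)) ≠ 0 := by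
    rw [Ne, map_eq_zero_iff _ (algebraMap_injective n)]
    exact pairProd_one_ne_zero n
  have h1 : (scalar (vFactor t n μ) : FractionRing (MvPolynomial (Fin n) K)) ≠ 0 := by
    rw [scalar, Ne, map_eq_zero_iff _ (algebraMap_injective n), MvPolynomial.C_eq_zero]
    exact vFactor_ne_zero t ht n μ
  change _ * (scalar (vFactor t n μ) * _) = _
  field_simp

/-- Stability: for `n` at least the number of parts of `μ`, setting `x_{n+1} = 0` in
`P_μ(x_1, …, x_{n+1}; t)` gives `P_μ(x_1, …, x_n; t)`. -/
theorem killLast_hlPoly (t : K) (ht : ∀ k : ℕ, 0 < k → t ^ k ≠ 1) (μ : YoungDiagram) (n : ℕ)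
    (hn : μ.colLen 0 ≤ n) : killLast K n (hlPoly t μ (n + 1)) = hlPoly t μ n := by
  have ht1 : t ≠ 1 := by simpa using ht 1 one_pos
  have h := congrArg (killLast K n) (hlPoly_mul t ht μ (n + 1))
  rw [killLast_hlNum t _ (μ.colLen 0) n (rowLen_eq_zero_iff μ), ← hlPoly_mul t ht μ n, map_mul,
    map_mul, killLast_pairProd] at h
  have h2 : killLast K n (MvPolynomial.C (vFactor t (n + 1) μ)) =
      MvPolynomial.C (vFactor t (n + 1) μ) := by
    simp [killLast, MvPolynomial.algebraMap_eq]
  have h0 : MvPolynomial.C (vFactor t (n + 1) μ) *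
      ((∏ i, MvPolynomial.X i) * pairProd 1 MvPolynomial.X) ≠
        (0 : MvPolynomial (Fin n) K) :=
    mul_ne_zero (by rw [Ne, MvPolynomial.C_eq_zero]; exact vFactor_ne_zero t ht _ μ)
      (mul_ne_zero (Finset.prod_ne_zero_iff.mpr fun i _ => MvPolynomial.X_ne_zero i)
        (pairProd_one_ne_zero n))
  rw [h2] at h
  refine mul_right_cancel₀ h0 (h.trans ?_)
  rw [vFactor_succ t ht1 n μ hn, MvPolynomial.C_mul]
  ring

/-- Auxiliary: setting all variables with index at least `n` equal to zero. -/
def killFrom (K : Type*) [Field K] (n : ℕ) : MvPolynomial ℕ K →ₐ[K] MvPolynomial ℕ K :=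
  MvPolynomial.aeval (fun i => if i < n then MvPolynomial.X i else 0)

theorem coeff_killFrom (n : ℕ) (p : MvPolynomial ℕ K) (m : ℕ →₀ ℕ) (hm : ∀ i ∈ m.support, i < n) :
    (killFrom K n p).coeff m = p.coeff m := by
  induction p using MvPolynomial.induction_on' with
  | add p q hp hq => simp [hp, hq]
  | monomial d a =>
    by_cases hd : ∀ i ∈ d.support, i < n
    · have : killFrom K n (MvPolynomial.monomial d a) = MvPolynomial.monomial d a := by
        rw [killFrom, MvPolynomial.aeval_monomial, MvPolynomial.monomial_eq,
          MvPolynomial.algebraMap_eq]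
        congr 1
        refine Finset.prod_congr rfl fun i hi => ?_
        simp [hd i hi]
      rw [this]
    · push Not at hd
      obtain ⟨i, hi, hin⟩ := hd
      have h1 : killFrom K n (MvPolynomial.monomial d a) = 0 := by
        rw [killFrom, MvPolynomial.aeval_monomial, Finsupp.prod, Finset.prod_eq_zero hi, mul_zero]
        rw [if_neg (by omega), zero_pow (Finsupp.mem_support_iff.mp hi)]
      have h2 : d ≠ m := by
        rintro rfl
        have := hm i hi
        omega
      rw [h1, MvPolynomial.coeff_monomial, if_neg h2, MvPolynomial.coeff_zero]

theorem killFrom_rename (n : ℕ) (p : MvPolynomial (Fin (n + 1)) K) :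
    killFrom K n (MvPolynomial.rename Fin.val p) =
      MvPolynomial.rename Fin.val (killLast K n p) := by
  have : (killFrom K n).comp (MvPolynomial.rename (Fin.val : Fin (n + 1) → ℕ)) =
      (MvPolynomial.rename (Fin.val : Fin n → ℕ)).comp (killLast K n) := by
    apply MvPolynomial.algHom_ext
    intro i
    refine Fin.lastCases ?_ (fun i => ?_) i
    · simp [killFrom, killLast]
    · simp [killFrom, killLast]
  exact congrArg (fun φ => φ p) this

/-- The coefficients of `P_μ(x_1, …, x_n; t)` are eventually those of `hl t μ`. -/
theorem coeff_hl (t : K) (ht : ∀ k : ℕ, 0 < k → t ^ k ≠ 1) (μ : YoungDiagram) (m : ℕ →₀ ℕ) (n : ℕ)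
    (hn : max (μ.colLen 0) (m.support.sup id + 1) ≤ n) :
    MvPowerSeries.coeff m (hl t μ) = MvPowerSeries.coeff m (hlPolySeries t μ n) := by
  induction n, hn using Nat.le_induction with
  | base => rfl
  | succ n hn ih =>
    rw [ih, hlPolySeries, hlPolySeries, MvPolynomial.coeff_coe, MvPolynomial.coeff_coe,
      ← killLast_hlPoly t ht μ n ((le_max_left _ _).trans hn), ← killFrom_rename, coeff_killFrom]
    intro i hi
    have h1 : id i ≤ m.support.sup id := Finset.le_sup hi
    have h2 := (le_max_right _ _).trans hn
    simp only [id] at h1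
    omega

/-- `P_μ(x_1, x_2, …; t)` is the coefficientwise limit of `P_μ(x_1, …, x_n; t)` as `n → ∞`. -/
theorem tendsto_hlPolySeries [TopologicalSpace K] [DiscreteTopology K] (t : K)
    (ht : ∀ k : ℕ, 0 < k → t ^ k ≠ 1) (μ : YoungDiagram) :
    Filter.Tendsto (fun n => hlPolySeries t μ n) Filter.atTop (nhds (hl t μ)) := by
  rw [MvPowerSeries.WithPiTopology.tendsto_iff_coeff_tendsto]
  intro m
  refine tendsto_const_nhds.congr' ?_
  filter_upwards [Filter.eventually_ge_atTop (max (μ.colLen 0) (m.support.sup id + 1))] with n hn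
  exact coeff_hl t ht μ m n hn

end

end HallLittlewood

/-! The proof goes by induction on the number n of variables. Let w(λ) be the coefficient of P_λ in
the identity, set to zero when an odd part of λ has odd multiplicity, let K_n be the sum of w(λ)
P_λ(x_1, …, x_n), and let y = x_{n+1}. Passing from n to n + 1 has to multiply K_n by (1 - y²)/(1 -
y²/t) times the product of (1 - x_i y)/(1 - x_i y/t). Three facts yield this.

Branching (`hlCol_eq_branchSum`): P_λ(x, y) = Σ_μ ψ_{λ/μ} y^{|λ/μ|} P_μ(x) over horizontal strips
λ/μ. Pieri (`prod_mul_pieriSum`): Σ_μ φ_{μ/ν} b^{|μ/ν|} P_μ = P_ν ∏ (1 - t b x_i)/(1 - b x_i), used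
at b = y/t. Exchange (`sum_outer_inner`): Σ_λ w(λ) ψ_{λ/μ} y^{|λ/μ|} = (1 - y²)/(1 - y²/t) Σ_ν w(ν)
φ_{μ/ν} (y/t)^{|μ/ν|}. Branching expands K_{n+1} over pairs μ ⊆ λ, exchange turns the sum over λ
into one over ν ⊆ μ, and Pieri sums over μ. This is the inductive step of `kawanakaSum_mul_sub_mem`.

The first two facts both come from the expansion of E(a) P_μ over vertical strips with t-binomial
coefficients, where E(a) = ∏ (1 + a x_i) (`prod_one_add_mul_hlCol`). That expansion is read off from
the sum over the symmetric group by straightening exponents. The horizontal Pieri formula follows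
because its coefficients invert those of vertical strips (`sum_pieriWeight`). Branching follows by
expanding E(a) P_μ(x, y) in two ways (`sum_upWeight`, `sum_pieri_branch`) and isolating one diagram
by induction on its last column.

Diagrams are encoded by their column lengths, and every combinatorial sum has a weight that is a
product over consecutive columns. Such a sum is a transfer-matrix product (`chain`). A horizontal
strip leaves only two possible lengths for each column, so each identity becomes a relation between
vectors with two entries; strengthened to two scalar relations, it passes through one column by a 2
× 2 computation.

To keep the sums finite, only diagrams with at most k columns are admitted. The errors lie in the
k-th power of the ideal generated by the variables, so a coefficient of degree less than k is exact.
Each coefficient of the infinite identity is then obtained from large n and k. -/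

namespace HallLittlewood

/-! ### Sums over sequences of column lengths as transfer-matrix products -/

section Columns

/-- Extension by zero of a finite sequence of column lengths. -/
def ext {k N : ℕ} (c : Fin k → Fin N) : ℕ → ℕ := fun i => if h : i < k then (c ⟨i, h⟩ : ℕ) else 0

theorem ext_of_le {k N : ℕ} (c : Fin k → Fin N) {i : ℕ} (h : k ≤ i) : ext c i = 0 :=
  dif_neg h.not_gt

theorem ext_of_lt {k N : ℕ} (c : Fin k → Fin N) {i : ℕ} (h : i < k) : ext c i = c ⟨i, h⟩ :=
  dif_pos h

theorem ext_lt {k N : ℕ} (c : Fin k → Fin N) (hN : 0 < N) (i : ℕ) : ext c i < N := by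
  unfold ext
  split_ifs
  · exact (c _).is_lt
  · exact hN

theorem ext_cons_zero {k N : ℕ} (v : Fin N) (c : Fin k → Fin N) :
    ext (Fin.cons v c : Fin (k + 1) → Fin N) 0 = v := by
  simp [ext]

theorem ext_cons_succ {k N : ℕ} (v : Fin N) (c : Fin k → Fin N) (i : ℕ) :
    ext (Fin.cons v c : Fin (k + 1) → Fin N) (i + 1) = ext c i := by
  unfold ext
  by_cases h : i < k
  · rw [dif_pos h, dif_pos (by omega)]
    exact congrArg Fin.val (Fin.cons_succ (α := fun _ => Fin N) v c ⟨i, h⟩)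
  · rw [dif_neg h, dif_neg (by omega)]

theorem sum_cons {B : Type*} [AddCommMonoid B] {k N : ℕ} (F : (Fin (k + 1) → Fin N) → B) :
    ∑ c, F c = ∑ v : Fin N, ∑ c : Fin k → Fin N, F (Fin.cons v c) := by
  rw [← (Fin.consEquiv (fun _ : Fin (k + 1) => Fin N)).sum_comp, Fintype.sum_prod_type]
  rfl

/-- Sum over all paths of length `k` with steps weighted by `W`, from `u` to `0`, the intermediate
states being less than `N`. -/
def chain {B : Type*} [CommRing B] (N : ℕ) : ℕ → (ℕ → ℕ → ℕ → B) → ℕ → B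
  | 0, _, u => if u = 0 then 1 else 0
  | k + 1, W, u => ∑ v ∈ Finset.range N, W 0 u v * chain N k (fun i => W (i + 1)) v

/-- Summing out the first column leaves a sum of the same shape in which that column enters only
through the step to the next one; the test function `f` carries this dependence through the
induction. The end state is 0 because `ext c` vanishes at k. -/
theorem sum_mul_prod_eq_chain {B : Type*} [CommRing B] {N : ℕ} (hN : 0 < N) (k : ℕ)
    (W : ℕ → ℕ → ℕ → B) (f : ℕ → B) :
    ∑ c : Fin k → Fin N, f (ext c 0) * ∏ i ∈ Finset.range k, W i (ext c i) (ext c (i + 1)) =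
      ∑ u ∈ Finset.range N, f u * chain N k W u := by
  induction k generalizing W f with
  | zero =>
    simp only [Finset.univ_unique, Finset.sum_singleton, Finset.range_zero, Finset.prod_empty,
      mul_one, chain, mul_ite, mul_zero]
    rw [Finset.sum_ite_eq' _ 0 f, if_pos (Finset.mem_range.mpr hN), ext_of_le _ le_rfl]
  | succ k ih =>
    rw [sum_cons, ← Fin.sum_univ_eq_sum_range (fun u => f u * chain N (k + 1) W u)]
    refine Finset.sum_congr rfl fun v _ => ?_
    rw [chain, ← ih, Finset.mul_sum]
    refine Finset.sum_congr rfl fun c _ => ?_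
    rw [Finset.prod_range_succ']
    simp only [ext_cons_succ, ext_cons_zero]
    ring

theorem sum_prod_eq_chain {B : Type*} [CommRing B] {N : ℕ} (hN : 0 < N) (k : ℕ)
    (W : ℕ → ℕ → ℕ → B) :
    ∑ c : Fin k → Fin N, ∏ i ∈ Finset.range k, W i (ext c i) (ext c (i + 1)) =
      ∑ u ∈ Finset.range N, chain N k W u := by
  simpa using sum_mul_prod_eq_chain hN k W (fun _ => 1)

theorem sum_range_eq_add_succ {B : Type*} [AddCommMonoid B] {N m : ℕ} (hm : m + 1 < N) (f : ℕ → B)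
    (hf : ∀ u, u ≠ m → u ≠ m + 1 → f u = 0) : ∑ u ∈ Finset.range N, f u = f m + f (m + 1) := by
  rw [← Finset.sum_subset (s₁ := {m, m + 1})]
  · rw [Finset.sum_pair (by omega)]
  · intro u hu
    simp only [Finset.mem_insert, Finset.mem_singleton] at hu
    rw [Finset.mem_range]
    omega
  · intro u _ hu
    simp only [Finset.mem_insert, Finset.mem_singleton, not_or] at hu
    exact hf u hu.1 hu.2

theorem sum_range_eq_add_pred {B : Type*} [AddCommMonoid B] {N m : ℕ} (hm : m < N) (f : ℕ → B)
    (hf : ∀ u, u ≠ m → u + 1 ≠ m → f u = 0) :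
    ∑ u ∈ Finset.range N, f u = f m + if 0 < m then f (m - 1) else 0 := by
  rcases m with _ | m
  · rw [Finset.sum_eq_single_of_mem 0 (Finset.mem_range.mpr hm)]
    · simp
    · intro u _ hu
      exact hf u hu (by omega)
  · rw [sum_range_eq_add_succ hm f (fun u h1 h2 => hf u h2 (by omega)), add_comm]
    simp

end Columns

/-! ### Reciprocal t-factorials and t-binomial coefficients -/

section TBinomial

variable {K : Type*} [Field K]

/-- `(1 - t) (1 - t ^ 2) ⋯ (1 - t ^ m)`. -/
def tfact (t : K) (m : ℕ) : K := ∏ j ∈ Finset.Icc 1 m, (1 - t ^ j)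

/-- The reciprocal of `tfact`, extended by zero to negative arguments. -/
def itfact (t : K) (z : ℤ) : K := if z < 0 then 0 else (tfact t z.toNat)⁻¹

theorem tfact_zero (t : K) : tfact t 0 = 1 := by simp [tfact]

theorem tfact_succ (t : K) (m : ℕ) : tfact t (m + 1) = tfact t m * (1 - t ^ (m + 1)) := by
  rw [tfact, tfact, Finset.prod_Icc_succ_top (by omega)]

theorem tfact_ne_zero {t : K} (ht : ∀ k : ℕ, 0 < k → t ^ k ≠ 1) (m : ℕ) : tfact t m ≠ 0 :=
  Finset.prod_ne_zero_iff.mpr fun j hj =>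
    sub_ne_zero.mpr (ht j (Finset.mem_Icc.mp hj).1).symm

theorem itfact_natCast (t : K) (m : ℕ) : itfact t m = (tfact t m)⁻¹ := by
  simp [itfact]

theorem itfact_of_neg (t : K) {z : ℤ} (h : z < 0) : itfact t z = 0 := if_pos h

/-- The extension by zero makes the recurrence hold at every integer: at z = 0 the factor 1 - t^0
vanishes. This spares the transfer computations most case distinctions at the boundary. -/
theorem itfact_sub_one {t : K} (ht : ∀ k : ℕ, 0 < k → t ^ k ≠ 1) (z : ℤ) :
    itfact t (z - 1) = (1 - t ^ z) * itfact t z := by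
  rcases lt_trichotomy z 0 with h | rfl | h
  · rw [itfact_of_neg t h, itfact_of_neg t (by omega), mul_zero]
  · simp [itfact]
  · obtain ⟨m, rfl⟩ : ∃ m : ℕ, z = (m : ℤ) + 1 := ⟨(z - 1).toNat, by omega⟩
    have h1 : 1 - t ^ (m + 1) ≠ 0 := sub_ne_zero.mpr (ht _ (Nat.succ_pos m)).symm
    have h2 : ((m : ℤ) + 1) = ((m + 1 : ℕ) : ℤ) := by push_cast; rfl
    rw [add_sub_cancel_right, h2, itfact_natCast, itfact_natCast, tfact_succ, zpow_natCast,
      mul_inv, mul_comm (tfact t m)⁻¹, mul_inv_cancel_left₀ h1]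

/-- The `t`-binomial coefficient `p - r` over `q - r`, zero unless `r ≤ q ≤ p`. -/
def tbinom (t : K) (p q r : ℕ) : K :=
  tfact t (p - r) * itfact t ((p : ℤ) - q) * itfact t ((q : ℤ) - r)

theorem tbinom_eq_zero (t : K) {p q r : ℕ} (h : ¬ (r ≤ q ∧ q ≤ p)) : tbinom t p q r = 0 := by
  unfold tbinom
  rcases not_and_or.mp h with h | h
  · rw [itfact_of_neg t (z := (q : ℤ) - r) (by omega), mul_zero]
  · rw [itfact_of_neg t (z := (p : ℤ) - q) (by omega), mul_zero, zero_mul]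

theorem tbinom_of_le (t : K) {p q r : ℕ} (h1 : r ≤ q) (h2 : q ≤ p) :
    tbinom t p q r = tfact t (p - r) * (tfact t (p - q))⁻¹ * (tfact t (q - r))⁻¹ := by
  rw [tbinom, ← itfact_natCast, ← itfact_natCast, Nat.cast_sub h1, Nat.cast_sub h2]

theorem tbinom_self {t : K} (ht : ∀ k : ℕ, 0 < k → t ^ k ≠ 1) {p r : ℕ} (h : r ≤ p) :
    tbinom t p p r = 1 := by
  rw [tbinom_of_le t h le_rfl, Nat.sub_self, tfact_zero, inv_one, mul_one,
    mul_inv_cancel₀ (tfact_ne_zero ht _)]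

theorem tbinom_right {t : K} (ht : ∀ k : ℕ, 0 < k → t ^ k ≠ 1) {p r : ℕ} (h : r ≤ p) :
    tbinom t p r r = 1 := by
  rw [tbinom_of_le t le_rfl h, Nat.sub_self, tfact_zero, inv_one, mul_one,
    mul_inv_cancel₀ (tfact_ne_zero ht _)]

/-- The t-Pascal rule, by which a block of equal rows is enlarged one row at a time. For s = m the
first term on the right is zero. -/
theorem tbinom_succ {t : K} (ht : ∀ k : ℕ, 0 < k → t ^ k ≠ 1) (l m s : ℕ) (hs : s ≤ m) :
    tbinom t (l + m + 1) (l + s + 1) l =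
      tbinom t (l + m) (l + s + 1) l + t ^ (m - s) * tbinom t (l + m) (l + s) l := by
  have e1 := itfact_sub_one ht ((m : ℤ) - s)
  have e2 := itfact_sub_one ht ((s : ℤ) + 1)
  have e3 : ((m : ℤ) - s) = ((m - s : ℕ) : ℤ) := by omega
  have e4 : ((s : ℤ) + 1) = ((s + 1 : ℕ) : ℤ) := by omega
  have e5 : (s : ℤ) + 1 - 1 = s := by ring
  have e6 : t ^ (m + 1) = t ^ (m - s) * t ^ (s + 1) := by
    rw [← pow_add]; congr 1; omega
  rw [e5, e4, zpow_natCast] at e2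
  unfold tbinom
  have a1 : l + m + 1 - l = m + 1 := by omega
  have a2 : l + m - l = m := by omega
  have a3 : ((l + m + 1 : ℕ) : ℤ) - (l + s + 1 : ℕ) = (m : ℤ) - s := by push_cast; ring
  have a4 : ((l + m : ℕ) : ℤ) - (l + s + 1 : ℕ) = (m : ℤ) - s - 1 := by push_cast; ring
  have a5 : ((l + m : ℕ) : ℤ) - (l + s : ℕ) = (m : ℤ) - s := by push_cast; ring
  have a6 : ((l + s + 1 : ℕ) : ℤ) - l = (s + 1 : ℕ) := by push_cast; ring
  have a7 : ((l + s : ℕ) : ℤ) - l = s := by push_cast; ring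
  rw [a1, a2, a3, a4, a5, a6, a7, tfact_succ, e1, e2, e6, e3, zpow_natCast]
  ring

end TBinomial

/-! ### Straightening of exponents in the symmetrized sum -/

section Straightening

variable {K : Type*} [Field K]

/-- An adjacent transposition permutes the ordered pairs among themselves, except that it reverses
the pair (i, j). The two differing factors are placed on opposite sides to avoid division. -/
theorem pairProd_swap {A : Type*} [CommRing A] (s : A) {n : ℕ} (v : Fin n → A) (i j : Fin n)
    (hij : (i : ℕ) + 1 = j) :
    pairProd s (fun k => v (Equiv.swap i j k)) * (v i - s * v j) =
      pairProd s v * (v j - s * v i) := by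
  have h : ∀ u : Fin n → A,
      pairProd s u = ∏ p : Fin n × Fin n, if p.1 < p.2 then u p.1 - s * u p.2 else 1 := by
    intro u
    rw [Fintype.prod_prod_type]
    refine Finset.prod_congr rfl fun i _ => ?_
    rw [← Finset.prod_filter]
    congr 1
    ext j; simp
  have hne : i ≠ j := by rintro rfl; omega
  have h1 : pairProd s (fun k => v (Equiv.swap i j k)) = ∏ p : Fin n × Fin n,
      if Equiv.swap i j p.1 < Equiv.swap i j p.2 then v p.1 - s * v p.2 else 1 := by
    rw [h, ← ((Equiv.swap i j).prodCongr (Equiv.swap i j)).prod_comp]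
    simp
  have h2 : v i - s * v j = ∏ p : Fin n × Fin n, if p = (i, j) then v p.1 - s * v p.2 else 1 := by
    rw [Finset.prod_ite_eq' Finset.univ (i, j) (fun p => v p.1 - s * v p.2)]
    simp
  have h3 : v j - s * v i = ∏ p : Fin n × Fin n, if p = (j, i) then v p.1 - s * v p.2 else 1 := by
    rw [Finset.prod_ite_eq' Finset.univ (j, i) (fun p => v p.1 - s * v p.2)]
    simp
  rw [h1, h, h2, h3, ← Finset.prod_mul_distrib, ← Finset.prod_mul_distrib]
  refine Finset.prod_congr rfl ?_
  rintro ⟨a, b⟩ _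
  simp only [Prod.mk.injEq, Equiv.swap_apply_def]
  by_cases h1 : a = i ∧ b = j
  · obtain ⟨rfl, rfl⟩ := h1
    have : a < b := by rw [Fin.lt_def]; omega
    simp [this, this.not_gt, hne, hne.symm]
  by_cases h2 : a = j ∧ b = i
  · obtain ⟨rfl, rfl⟩ := h2
    have : b < a := by rw [Fin.lt_def]; omega
    simp [this, this.not_gt, hne, hne.symm]
  rw [if_neg h1, if_neg h2]
  congr 1
  simp only [Fin.ext_iff, Fin.lt_def] at *
  refine if_congr ?_ rfl rfl
  split_ifs <;> omega

/-- The sequence `f` increased by one at the positions in `T`. -/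
def bump (f : ℕ → ℕ) (T : Finset ℕ) : ℕ → ℕ := fun i => f i + if i ∈ T then 1 else 0

theorem bump_bump (f : ℕ → ℕ) {S T : Finset ℕ} (h : Disjoint S T) :
    bump (bump f S) T = bump f (S ∪ T) := by
  funext i
  have : i ∈ S → i ∉ T := fun h1 => Finset.disjoint_left.mp h h1
  simp only [bump, Finset.mem_union]
  by_cases h1 : i ∈ S <;> by_cases h2 : i ∈ T <;> simp_all

theorem prod_X_pow_bump_singleton {n : ℕ} (f : ℕ → ℕ) (w : Equiv.Perm (Fin n)) (j : Fin n) :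
    (∏ i, MvPolynomial.X (w i) ^ bump f {(j : ℕ)} i : MvPolynomial (Fin n) K) =
      (∏ i, MvPolynomial.X (w i) ^ f i) * MvPolynomial.X (w j) := by
  simp only [bump, pow_add, Finset.prod_mul_distrib]
  congr 1
  rw [Finset.prod_eq_single j]
  · simp
  · intro b _ hb
    have : (b : ℕ) ≠ j := fun h => hb (Fin.ext h)
    simp [this]
  · simp

/-- The terms of w and of w composed with the transposition of i and i + 1 cancel in the difference
of the two sides: the monomial of `f` is unchanged, the sign is reversed, and by `pairProd_swap` the
factor x_{w(i+1)} - t x_{w(i)} times the product over pairs is invariant. -/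
theorem hlNum_bump_succ (t : K) {n : ℕ} (f : ℕ → ℕ) (i : ℕ) (hi : i + 1 < n)
    (hf : f i = f (i + 1)) :
    hlNum t (bump f {i + 1}) n = MvPolynomial.C t * hlNum t (bump f {i}) n := by
  rw [← sub_eq_zero, hlNum, hlNum, Finset.mul_sum, ← Finset.sum_sub_distrib]
  set I : Fin n := ⟨i, by omega⟩
  set J : Fin n := ⟨i + 1, hi⟩
  have hIJ : I ≠ J := by simp [I, J]
  have e1 := fun w => prod_X_pow_bump_singleton (K := K) f w I
  have e2 := fun w => prod_X_pow_bump_singleton (K := K) f w J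
  simp only [I, J] at e1 e2
  simp only [e1, e2]
  refine Finset.sum_involution (fun w _ => w * Equiv.swap I J) ?_ ?_ ?_ ?_
  · intro w _
    have h1 := pairProd_swap (MvPolynomial.C t)
      (fun k => (MvPolynomial.X (w k) : MvPolynomial (Fin n) K)) I J rfl
    have h2 : (∏ k, MvPolynomial.X (w (Equiv.swap I J k)) ^ f k : MvPolynomial (Fin n) K) =
        ∏ k, MvPolynomial.X (w k) ^ f k := by
      rw [← Equiv.prod_comp (Equiv.swap I J)]
      refine Finset.prod_congr rfl fun k _ => ?_
      rw [Equiv.swap_apply_self]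
      congr 1
      rw [Equiv.swap_apply_def]
      split_ifs with h h
      · rw [h]; exact hf.symm
      · rw [h]; exact hf
      · rfl
    simp only [Equiv.Perm.mul_apply, Equiv.Perm.sign_mul, Equiv.Perm.sign_swap hIJ,
      Units.val_mul, Units.val_neg, Units.val_one, Int.cast_neg, Int.cast_mul, Int.cast_one,
      h2]
    have e3 : Equiv.swap I J ⟨i + 1, hi⟩ = I := Equiv.swap_apply_right I J
    have e4 : Equiv.swap I J ⟨i, by omega⟩ = J := Equiv.swap_apply_left I J
    rw [e3, e4]
    simp only [I, J] at h1 ⊢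
    linear_combination (-((Equiv.Perm.sign w : ℤ) : MvPolynomial (Fin n) K) *
      (∏ k, MvPolynomial.X (w k) ^ f k)) * h1
  · intro w _ _ h
    have := congrArg Equiv.Perm.sign h
    rw [Equiv.Perm.sign_mul, Equiv.Perm.sign_swap hIJ] at this
    rcases Int.units_eq_one_or (Equiv.Perm.sign w) with h' | h' <;> rw [h'] at this <;>
      exact absurd this (by decide)
  · intro w _
    exact Finset.mem_univ _
  · intro w _
    simp [mul_assoc]

theorem hlNum_bump_add (t : K) {n : ℕ} (f : ℕ → ℕ) (l m : ℕ) (hl : l + m < n)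
    (hf : ∀ i, l ≤ i → i ≤ l + m → f i = f l) :
    hlNum t (bump f {l + m}) n = MvPolynomial.C (t ^ m) * hlNum t (bump f {l}) n := by
  induction m with
  | zero => simp
  | succ m ih =>
    rw [← add_assoc, hlNum_bump_succ t f (l + m) (by omega), ih (by omega)
      (fun i h1 h2 => hf i h1 (by omega)), pow_succ, MvPolynomial.C_mul]
    · ring
    · rw [hf (l + m) (by omega) (by omega), hf (l + m + 1) (by omega) (by omega)]

theorem sum_powerset_union {B : Type*} [AddCommMonoid B] {S T : Finset ℕ} (h : Disjoint S T)
    (F : Finset ℕ → B) :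
    ∑ U ∈ (S ∪ T).powerset, F U = ∑ U ∈ S.powerset, ∑ V ∈ T.powerset, F (U ∪ V) := by
  rw [← Finset.sum_product']
  refine Finset.sum_nbij' (fun U => (U ∩ S, U ∩ T)) (fun p => p.1 ∪ p.2) ?_ ?_ ?_ ?_ ?_
  · intro U _
    simp [Finset.inter_subset_right]
  · rintro ⟨U, V⟩ hU
    simp only [Finset.mem_product, Finset.mem_powerset] at hU ⊢
    exact Finset.union_subset_union hU.1 hU.2
  · intro U hU
    simp only [Finset.mem_powerset] at hU
    rw [← Finset.inter_union_distrib_left, Finset.inter_eq_left.mpr hU]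
  · rintro ⟨U, V⟩ hU
    simp only [Finset.mem_product, Finset.mem_powerset] at hU ⊢
    have h1 := Finset.disjoint_left.mp h
    ext x <;> simp only [Finset.mem_inter, Finset.mem_union]
    · constructor
      · rintro ⟨h2 | h2, h3⟩
        · exact h2
        · exact absurd (hU.2 h2) (h1 h3)
      · exact fun h2 => ⟨Or.inl h2, hU.1 h2⟩
    · constructor
      · rintro ⟨h2 | h2, h3⟩
        · exact absurd h3 (h1 (hU.1 h2))
        · exact h2
      · exact fun h2 => ⟨Or.inr h2, hU.2 h2⟩
  · intro U hU
    simp only [Finset.mem_powerset] at hU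
    rw [← Finset.inter_union_distrib_left, Finset.inter_eq_left.mpr hU]

variable {B : Type*} [CommRing B]

/-- The product is symmetric, so in the term of w its factors can be reindexed by w before it is
expanded over subsets of the rows. -/
theorem prod_one_add_mul_hlNum (t : K) {n : ℕ} (φ : MvPolynomial (Fin n) K →+* B) (a : B)
    (f : ℕ → ℕ) :
    (∏ i, (1 + a * φ (MvPolynomial.X i))) * φ (hlNum t f n) =
      ∑ T ∈ (Finset.range n).powerset, a ^ T.card * φ (hlNum t (bump f T) n) := by
  simp only [hlNum, map_sum, Finset.mul_sum]
  rw [Finset.sum_comm]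
  refine Finset.sum_congr rfl fun w _ => ?_
  set y : ℕ → B := fun i => if h : i < n then φ (MvPolynomial.X (w ⟨i, h⟩)) else 0 with hy
  have hyi : ∀ i : Fin n, φ (MvPolynomial.X (w i)) = y i := fun i => by simp [hy]
  have h1 : ∏ i, (1 + a * φ (MvPolynomial.X i)) =
      ∑ T ∈ (Finset.range n).powerset, a ^ T.card * ∏ i ∈ T, y i := by
    rw [← Equiv.prod_comp w]
    simp only [hyi]
    rw [Fin.prod_univ_eq_prod_range (fun i => 1 + a * y i) n, Finset.prod_one_add]
    simp [Finset.prod_mul_distrib]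
  rw [h1, Finset.sum_mul]
  refine Finset.sum_congr rfl fun T hT => ?_
  have h2 : φ (∏ i, MvPolynomial.X (w i) ^ bump f T i) =
      φ (∏ i, MvPolynomial.X (w i) ^ f i) * ∏ i ∈ T, y i := by
    simp only [bump, pow_add, Finset.prod_mul_distrib, map_mul]
    congr 1
    simp only [map_prod, map_pow, hyi]
    rw [Fin.prod_univ_eq_prod_range (fun i => y i ^ (if i ∈ T then 1 else 0)) n]
    rw [← Finset.prod_subset (Finset.mem_powerset.mp hT)]
    · exact Finset.prod_congr rfl fun i hi => by simp [hi]
    · intro i _ hi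
      simp [hi]
  rw [map_mul, map_mul, map_mul, map_mul, h2]
  ring

/-- All subsets of size s of a block of equal rows straighten to the set of its first s rows, up to
powers of t; these powers add up to a t-binomial coefficient. The induction removes the last row of
the block and applies the t-Pascal rule. -/
theorem sum_powerset_hlNum_block {t : K} (ht : ∀ k : ℕ, 0 < k → t ^ k ≠ 1) {n : ℕ}
    (φ : MvPolynomial (Fin n) K →+* B) (a : B) (l m : ℕ) (hn : l + m ≤ n) (f : ℕ → ℕ)
    (hf : ∀ i, l ≤ i → i < l + m → f i = f l) :
    ∑ T ∈ (Finset.Ico l (l + m)).powerset, a ^ T.card * φ (hlNum t (bump f T) n) =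
      ∑ s ∈ Finset.range (m + 1), a ^ s * φ (MvPolynomial.C (tbinom t (l + m) (l + s) l)) *
        φ (hlNum t (bump f (Finset.Ico l (l + s))) n) := by
  induction m generalizing f with
  | zero => simp [tbinom_self ht le_rfl]
  | succ m ih =>
    have h1 : Finset.Ico l (l + (m + 1)) = Finset.Ico l (l + m) ∪ {l + m} := by
      ext x; simp only [Finset.mem_Ico, Finset.mem_union, Finset.mem_singleton]; omega
    have h2 : Disjoint (Finset.Ico l (l + m)) {l + m} := by simp
    rw [h1, sum_powerset_union h2]
    have h3 : ∀ U ∈ (Finset.Ico l (l + m)).powerset,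
        ∑ V ∈ ({l + m} : Finset ℕ).powerset, a ^ (U ∪ V).card * φ (hlNum t (bump f (U ∪ V)) n) =
        a ^ U.card * φ (hlNum t (bump f U) n) +
          a * (a ^ U.card * φ (hlNum t (bump (bump f {l + m}) U) n)) := by
      intro U hU
      have h4 : Disjoint U {l + m} := h2.mono_left (Finset.mem_powerset.mp hU)
      rw [show ({l + m} : Finset ℕ).powerset = {∅, {l + m}} from rfl, Finset.sum_pair (Finset.singleton_ne_empty _).symm,
        Finset.union_empty, bump_bump _ h4.symm, Finset.card_union_of_disjoint h4,
        Finset.union_comm {l + m}, Finset.card_singleton]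
      ring
    rw [Finset.sum_congr rfl h3, Finset.sum_add_distrib, ← Finset.mul_sum,
      ih (by omega) f (fun i h4 h5 => hf i h4 (by omega)),
      ih (by omega) (bump f {l + m}) (fun i h4 h5 => by
        have e1 : i ≠ l + m := by omega
        have e2 : l ≠ l + m := by omega
        simp only [bump, Finset.mem_singleton, e1, e2, if_false]
        exact hf i h4 (by omega))]
    -- With the first s rows of the block raised, the raised last row moves up from position l + m
    -- to l + s through equal rows, gaining a factor t at each of the m - s steps.
    have h5 : ∀ s ∈ Finset.range (m + 1),
        φ (hlNum t (bump (bump f {l + m}) (Finset.Ico l (l + s))) n) =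
        φ (MvPolynomial.C (t ^ (m - s))) *
          φ (hlNum t (bump f (Finset.Ico l (l + (s + 1)))) n) := by
      intro s hs
      rw [Finset.mem_range] at hs
      have e1 : Disjoint {l + m} (Finset.Ico l (l + s)) := by
        simp; omega
      have e2 : Disjoint (Finset.Ico l (l + s)) {l + s} := by simp
      have e3 : Finset.Ico l (l + (s + 1)) = Finset.Ico l (l + s) ∪ {l + s} := by
        ext x; simp only [Finset.mem_Ico, Finset.mem_union, Finset.mem_singleton]; omega
      rw [bump_bump f e1, Finset.union_comm, ← bump_bump f e1.symm, e3, ← bump_bump f e2,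
        ← map_mul]
      have e4 := hlNum_bump_add t (n := n) (bump f (Finset.Ico l (l + s))) (l + s) (m - s)
        (by omega) (fun i h6 h7 => by
          simp only [bump, Finset.mem_Ico]
          rw [hf i (by omega) (by omega), hf (l + s) (by omega) (by omega),
            if_neg (by omega), if_neg (by omega)])
      rw [show l + s + (m - s) = l + m by omega] at e4
      rw [e4]
    have e0 : tbinom t (l + (m + 1)) (l + 0) l = tbinom t (l + m) (l + 0) l := by
      rw [add_zero, tbinom_right ht (by omega), tbinom_right ht (by omega)]
    have e1 : tbinom t (l + m) (l + (m + 1)) l = 0 := tbinom_eq_zero t (by omega)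
    have h6 : ∑ s ∈ Finset.range (m + 1), a ^ s *
          φ (MvPolynomial.C (tbinom t (l + m) (l + s) l)) *
          φ (hlNum t (bump f (Finset.Ico l (l + s))) n) =
        ∑ s ∈ Finset.range (m + 1 + 1), a ^ s *
          φ (MvPolynomial.C (tbinom t (l + m) (l + s) l)) *
          φ (hlNum t (bump f (Finset.Ico l (l + s))) n) := by
      rw [Finset.sum_range_succ _ (m + 1), e1]
      simp
    rw [h6, Finset.sum_range_succ', Finset.sum_range_succ' _ (m + 1), e0, add_right_comm,
      Finset.mul_sum, ← Finset.sum_add_distrib]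
    congr 1
    refine Finset.sum_congr rfl fun s hs => ?_
    rw [h5 s hs]
    have e2 := tbinom_succ ht l m s (by rw [Finset.mem_range] at hs; omega)
    rw [← add_assoc, ← add_assoc, e2]
    simp only [map_add, map_mul]
    ring

theorem sum_powerset_hlNum_block_range {t : K} (ht : ∀ k : ℕ, 0 < k → t ^ k ≠ 1) {n : ℕ}
    (φ : MvPolynomial (Fin n) K →+* B) (a : B) {l p N : ℕ} (hl : l ≤ p) (hp : p < N) (hn : p ≤ n)
    (f : ℕ → ℕ) (hf : ∀ i, l ≤ i → i < p → f i = f l) :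
    ∑ T ∈ (Finset.Ico l p).powerset, a ^ T.card * φ (hlNum t (bump f T) n) =
      ∑ v : Fin N, a ^ (v - l : ℕ) * φ (MvPolynomial.C (tbinom t p v l)) *
        φ (hlNum t (bump f (Finset.Ico l v)) n) := by
  obtain ⟨m, rfl⟩ := Nat.exists_eq_add_of_le hl
  rw [sum_powerset_hlNum_block ht φ a l m hn f hf,
    Fin.sum_univ_eq_sum_range (fun v => a ^ (v - l : ℕ) *
      φ (MvPolynomial.C (tbinom t (l + m) v l)) * φ (hlNum t (bump f (Finset.Ico l v)) n)) N]
  have h := Finset.sum_Ico_eq_sum_range (fun v => a ^ (v - l : ℕ) *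
      φ (MvPolynomial.C (tbinom t (l + m) v l)) * φ (hlNum t (bump f (Finset.Ico l v)) n))
      l (l + m + 1)
  rw [show l + m + 1 - l = m + 1 by omega] at h
  simp only [Nat.add_sub_cancel_left] at h
  rw [← h]
  refine Finset.sum_subset (fun x hx => ?_) (fun x _ hx => ?_)
  · simp only [Finset.mem_Ico, Finset.mem_range] at hx ⊢
    omega
  · simp only [Finset.mem_Ico] at hx
    rw [tbinom_eq_zero t (by omega)]
    simp

/-- Sum over all subsets of the rows, sorted within the blocks `[p (j + 1), p j)` on which the
exponents are constant. -/
theorem sum_powerset_hlNum {t : K} (ht : ∀ k : ℕ, 0 < k → t ^ k ≠ 1) {n : ℕ}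
    (φ : MvPolynomial (Fin n) K →+* B) (a : B) {N : ℕ} (b : ℕ) (p : ℕ → ℕ) (hp : Antitone p)
    (hp0 : p 0 ≤ n) (hN : p 0 < N) (hb : p b = 0) (f : ℕ → ℕ)
    (hf : ∀ j i, p (j + 1) ≤ i → i < p j → f i = f (p (j + 1))) :
    ∑ T ∈ (Finset.range (p 0)).powerset, a ^ T.card * φ (hlNum t (bump f T) n) =
      ∑ c : Fin b → Fin N, (∏ j ∈ Finset.range b, a ^ (ext c j - p (j + 1)) *
          φ (MvPolynomial.C (tbinom t (p j) (ext c j) (p (j + 1))))) *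
        φ (hlNum t (fun x => f x + ∑ j ∈ Finset.range b,
          if p (j + 1) ≤ x ∧ x < ext c j then 1 else 0) n) := by
  induction b generalizing p f with
  | zero =>
    have : bump f ∅ = f := by funext i; simp [bump]
    simp [hb, this]
  | succ b ih =>
    have h1 : p 1 ≤ p 0 := hp (Nat.zero_le 1)
    have h2 : Finset.range (p 0) = Finset.range (p 1) ∪ Finset.Ico (p 1) (p 0) := by
      ext x; simp only [Finset.mem_range, Finset.mem_union, Finset.mem_Ico]; omega
    have h3 : Disjoint (Finset.range (p 1)) (Finset.Ico (p 1) (p 0)) := by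
      rw [Finset.disjoint_left]; intro x; simp only [Finset.mem_range, Finset.mem_Ico]; omega
    rw [h2, sum_powerset_union h3, sum_cons]
    -- The lowest block is straightened first. Raising rows above it leaves its exponents constant,
    -- and conversely, so the blocks can be treated independently.
    have h4 : ∀ U ∈ (Finset.range (p 1)).powerset, ∑ V ∈ (Finset.Ico (p 1) (p 0)).powerset,
        a ^ (U ∪ V).card * φ (hlNum t (bump f (U ∪ V)) n) = ∑ v : Fin N,
          a ^ (v - p 1 : ℕ) * φ (MvPolynomial.C (tbinom t (p 0) v (p 1))) *
        (a ^ U.card * φ (hlNum t (bump (bump f (Finset.Ico (p 1) v)) U) n)) := by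
      intro U hU
      rw [Finset.mem_powerset] at hU
      have h5 : ∀ V ∈ (Finset.Ico (p 1) (p 0)).powerset,
          a ^ (U ∪ V).card * φ (hlNum t (bump f (U ∪ V)) n) =
          a ^ U.card * (a ^ V.card * φ (hlNum t (bump (bump f U) V) n)) := by
        intro V hV
        have h6 := (h3.mono_left hU).mono_right (Finset.mem_powerset.mp hV)
        rw [bump_bump f h6, Finset.card_union_of_disjoint h6, pow_add, mul_assoc]
      rw [Finset.sum_congr rfl h5, ← Finset.mul_sum,
        sum_powerset_hlNum_block_range ht φ a h1 hN hp0 (bump f U), Finset.mul_sum]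
      · refine Finset.sum_congr rfl fun v _ => ?_
        have h7 : Disjoint U (Finset.Ico (p 1) v) := by
          rw [Finset.disjoint_left]
          intro x hx
          have := Finset.mem_range.mp (hU hx)
          simp only [Finset.mem_Ico]; omega
        rw [bump_bump f h7, bump_bump f h7.symm, Finset.union_comm]
        ring
      · intro i h6 h7
        have h8 : ∀ x, p 1 ≤ x → x ∉ U := fun x hx hx' => by
          have := Finset.mem_range.mp (hU hx'); omega
        simp only [bump, if_neg (h8 i h6), if_neg (h8 _ le_rfl), hf 0 i h6 h7]
    rw [Finset.sum_congr rfl h4, Finset.sum_comm]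
    refine Finset.sum_congr rfl fun v _ => ?_
    rw [← Finset.mul_sum, ih (fun j => p (j + 1)) (fun i j h => hp (by omega)) (h1.trans hp0)
      (h1.trans_lt hN) hb (bump f (Finset.Ico (p 1) v)) (fun j i h5 h6 => by
        have e0 : p (j + 1) ≤ p 1 := hp (by omega)
        have e1 : i ∉ Finset.Ico (p 1) v := by simp only [Finset.mem_Ico]; omega
        have e2 : p (j + 1 + 1) ∉ Finset.Ico (p 1) v := by simp only [Finset.mem_Ico]; omega
        simp only [bump, if_neg e1, if_neg e2, hf (j + 1) i h5 h6]), Finset.mul_sum]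
    refine Finset.sum_congr rfl fun c _ => ?_
    rw [Finset.prod_range_succ' _ b]
    simp only [ext_cons_succ, ext_cons_zero]
    have h7 : (fun x => f x + ∑ j ∈ Finset.range (b + 1),
        if p (j + 1) ≤ x ∧ x < ext (Fin.cons v c : Fin (b + 1) → Fin N) j then 1 else 0) =
        fun x => bump f (Finset.Ico (p 1) v) x + ∑ j ∈ Finset.range b,
          if p (j + 1 + 1) ≤ x ∧ x < ext c j then 1 else 0 := by
      funext x
      rw [Finset.sum_range_succ']
      simp only [ext_cons_succ, ext_cons_zero, bump, Finset.mem_Ico]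
      ring_nf
    rw [h7]
    ring

end Straightening

/-! ### Homogeneity of a cofactor -/

section Homogeneous

/-- The component of p q in degree d + j is p times the component of q in degree j. Over a domain,
all components of q but the one in degree e must therefore vanish. -/
theorem isHomogeneous_of_mul {σ R : Type*} [CommRing R] [IsDomain R] {p q : MvPolynomial σ R}
    {d e : ℕ} (hp0 : p ≠ 0) (hp : p.IsHomogeneous d) (h : (p * q).IsHomogeneous (d + e)) :
    q.IsHomogeneous e := by
  classical
  have key : ∀ j, MvPolynomial.homogeneousComponent (d + j) (p * q) =
      p * MvPolynomial.homogeneousComponent j q := by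
    intro j
    let _ := MvPolynomial.gradedAlgebra (σ := σ) (R := R)
    have := DirectSum.coe_decompose_mul_add_of_left_mem
      (MvPolynomial.homogeneousSubmodule σ R) (i := d) (j := j) (a := p) (b := q) hp
    rw [← MvPolynomial.decomposition.decompose'_apply,
      ← MvPolynomial.decomposition.decompose'_apply]
    exact this
  have h0 : ∀ j, j ≠ e → MvPolynomial.homogeneousComponent j q = 0 := by
    intro j hj
    have h1 := key j
    rw [MvPolynomial.homogeneousComponent_of_mem h, if_neg (by omega)] at h1
    exact (mul_eq_zero.mp h1.symm).resolve_left hp0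
  rw [← MvPolynomial.sum_homogeneousComponent q]
  refine MvPolynomial.IsHomogeneous.sum _ _ _ fun j _ => ?_
  by_cases hj : j = e
  · subst hj
    exact MvPolynomial.homogeneousComponent_isHomogeneous _ _
  · rw [h0 j hj]
    exact MvPolynomial.isHomogeneous_zero _ _ _

end Homogeneous

/-! ### Hall-Littlewood polynomials indexed by columns and the vertical-strip Pieri formula -/

noncomputable section

variable {K : Type*} [Field K]

/-- The quotient of `hlNum` by the product of the differences of the variables. -/
def hlSym (t : K) (f : ℕ → ℕ) (n : ℕ) : MvPolynomial (Fin n) K :=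
  Classical.choose (pairProd_dvd_hlNum t f n)

theorem pairProd_mul_hlSym (t : K) (f : ℕ → ℕ) (n : ℕ) :
    pairProd 1 (fun i => MvPolynomial.X i) * hlSym t f n = hlNum t f n :=
  (Classical.choose_spec (pairProd_dvd_hlNum t f n)).symm

/-- The length of row `x` of the diagram with column lengths `c 0, …, c (k - 1)`. -/
def rowFn (k : ℕ) (c : ℕ → ℕ) (x : ℕ) : ℕ := ∑ j ∈ Finset.range k, if x < c j then 1 else 0

/-- Product of `tfact` over the multiplicities of the row lengths, including zero, of the diagram
with columns `c`, regarded as having `n` rows. -/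
def colNorm (t : K) (n k : ℕ) (c : ℕ → ℕ) : K :=
  tfact t (n - c 0) * ∏ j ∈ Finset.range k, tfact t (c j - c (j + 1))

open Classical in
/-- The Hall-Littlewood polynomial in `n` variables of the diagram with column lengths `c`; zero if
`c` is not the sequence of column lengths of a diagram with at most `n` rows. -/
def hlCol (t : K) (n k : ℕ) (c : ℕ → ℕ) : MvPolynomial (Fin n) K :=
  if Antitone c ∧ c 0 ≤ n then
    MvPolynomial.C ((1 - t) ^ n * (colNorm t n k c)⁻¹) * hlSym t (rowFn k c) n
  else 0

theorem hlCol_of_pos (t : K) {n k : ℕ} {c : ℕ → ℕ} (hc : Antitone c) (h0 : c 0 ≤ n) :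
    hlCol t n k c = MvPolynomial.C ((1 - t) ^ n * (colNorm t n k c)⁻¹) * hlSym t (rowFn k c) n :=
  if_pos ⟨hc, h0⟩

theorem hlCol_of_neg (t : K) {n k : ℕ} {c : ℕ → ℕ} (h : ¬ (Antitone c ∧ c 0 ≤ n)) :
    hlCol t n k c = 0 :=
  if_neg h

theorem isHomogeneous_pairProd (s : K) (n : ℕ) (w : Equiv.Perm (Fin n)) :
    (pairProd (MvPolynomial.C s) (fun i => MvPolynomial.X (w i)) :
      MvPolynomial (Fin n) K).IsHomogeneous (∑ i : Fin n, ∑ _j ∈ Finset.Ioi i, 1) := by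
  refine MvPolynomial.IsHomogeneous.prod _ _ _ fun i _ =>
    MvPolynomial.IsHomogeneous.prod _ _ _ fun j _ => ?_
  exact (MvPolynomial.isHomogeneous_X K _).sub (MvPolynomial.isHomogeneous_C_mul_X s _)

theorem isHomogeneous_hlSym (t : K) (f : ℕ → ℕ) (n : ℕ) :
    (hlSym t f n).IsHomogeneous (∑ i : Fin n, f i) := by
  have h1 := isHomogeneous_pairProd (1 : K) n 1
  rw [MvPolynomial.C_1] at h1
  refine isHomogeneous_of_mul (pairProd_one_ne_zero n) h1 ?_
  have h2 := pairProd_mul_hlSym t f n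
  simp only [Equiv.Perm.one_apply] at h1 h2 ⊢
  rw [h2, hlNum]
  refine MvPolynomial.IsHomogeneous.sum _ _ _ fun w _ => ?_
  have h3 : ((Equiv.Perm.sign w : ℤ) : MvPolynomial (Fin n) K) =
      MvPolynomial.C ((Equiv.Perm.sign w : ℤ) : K) := by simp
  rw [h3]
  refine MvPolynomial.IsHomogeneous.C_mul ?_ _
  rw [add_comm]
  refine MvPolynomial.IsHomogeneous.mul ?_ (isHomogeneous_pairProd t n w)
  exact MvPolynomial.IsHomogeneous.prod _ _ _ fun i _ => MvPolynomial.isHomogeneous_X_pow _ _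

theorem sum_rowFn {n k : ℕ} {c : ℕ → ℕ} (hc : ∀ j, c j ≤ n) :
    ∑ i : Fin n, rowFn k c i = ∑ j ∈ Finset.range k, c j := by
  unfold rowFn
  rw [Finset.sum_comm]
  refine Finset.sum_congr rfl fun j _ => ?_
  rw [← Finset.card_filter, Fin.card_filter_val_lt, min_eq_right (hc j)]

theorem isHomogeneous_hlCol (t : K) (n k : ℕ) (c : ℕ → ℕ) :
    (hlCol t n k c).IsHomogeneous (∑ j ∈ Finset.range k, c j) := by
  by_cases h : Antitone c ∧ c 0 ≤ n
  · rw [hlCol_of_pos t h.1 h.2, ← sum_rowFn fun j => (h.1 (Nat.zero_le j)).trans h.2]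
    exact (isHomogeneous_hlSym t _ n).C_mul _
  · rw [hlCol_of_neg t h]
    exact MvPolynomial.isHomogeneous_zero _ _ _

theorem rowFn_succ {k : ℕ} {c : ℕ → ℕ} (hk : c k = 0) : rowFn (k + 1) c = rowFn k c := by
  funext x
  rw [rowFn, rowFn, Finset.sum_range_succ, hk, if_neg (Nat.not_lt_zero x), add_zero]

theorem rowFn_eq_of_block {k : ℕ} {c : ℕ → ℕ} (hc : Antitone c) {j i : ℕ} (h1 : c j ≤ i)
    (h2 : ∀ j', j' < j → i < c j') : rowFn k c i = rowFn k c (c j) := by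
  refine Finset.sum_congr rfl fun j' _ => ?_
  rcases lt_or_ge j' j with h | h
  · rw [if_pos (h2 j' h), if_pos (h1.trans_lt (h2 j' h))]
  · have := hc h
    rw [if_neg (by omega), if_neg (by omega)]

theorem colNorm_ne_zero {t : K} (ht : ∀ k : ℕ, 0 < k → t ^ k ≠ 1) (n k : ℕ) (c : ℕ → ℕ) :
    colNorm t n k c ≠ 0 :=
  mul_ne_zero (tfact_ne_zero ht _) (Finset.prod_ne_zero_iff.mpr fun _ _ => tfact_ne_zero ht _)

/-- Column `j` of a diagram with `n` rows, the columns being shifted by one and preceded by a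
column of length `n`. -/
def colShift (n : ℕ) (c : ℕ → ℕ) : ℕ → ℕ
  | 0 => n
  | j + 1 => c j

theorem colNorm_eq_prod (t : K) (n k : ℕ) (c : ℕ → ℕ) :
    colNorm t n k c =
      ∏ j ∈ Finset.range (k + 1), tfact t (colShift n c j - colShift n c (j + 1)) := by
  rw [Finset.prod_range_succ', mul_comm]
  rfl

/-- Straightening produces t-binomials in the multiplicities of c, whereas the Pieri coefficient has
t-binomials in those of l. Written in t-factorials, the two sides differ exactly by the
normalizations of P_c and P_l, because the products over c_{j-1} - l_j and over c_j - l_{j+1} agree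
up to the factor for n - l_0. -/
theorem prod_tbinom_mul_inv_colNorm {t : K} (ht : ∀ k : ℕ, 0 < k → t ^ k ≠ 1) {n k : ℕ}
    {c l : ℕ → ℕ} (h1 : ∀ j, c j ≤ l j) (h2 : ∀ j, l (j + 1) ≤ c j) (h0 : l 0 ≤ n)
    (hck : c k = 0) :
    (∏ j ∈ Finset.range (k + 1), tbinom t (colShift n c j) (l j) (c j)) * (colNorm t n k c)⁻¹ =
      (∏ j ∈ Finset.range (k + 1), tbinom t (l j) (c j) (l (j + 1))) *
        (colNorm t n (k + 1) l)⁻¹ := by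
  have e1 : ∀ j, l j ≤ colShift n c j := by
    rintro (_ | j)
    · exact h0
    · exact h2 j
  have e2 : ∏ j ∈ Finset.range (k + 1), tfact t (colShift n c j - l j) =
      tfact t (n - l 0) * ∏ j ∈ Finset.range (k + 1), tfact t (c j - l (j + 1)) := by
    have h3 := h2 k
    rw [Finset.prod_range_succ', Finset.prod_range_succ _ k, hck, mul_comm]
    simp [colShift, tfact_zero]
  have e3 : ∏ j ∈ Finset.range (k + 1), tbinom t (colShift n c j) (l j) (c j) =
      colNorm t n k c * (∏ j ∈ Finset.range (k + 1), tfact t (colShift n c j - l j))⁻¹ *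
        (∏ j ∈ Finset.range (k + 1), tfact t (l j - c j))⁻¹ := by
    rw [colNorm_eq_prod, ← Finset.prod_inv_distrib, ← Finset.prod_inv_distrib,
      ← Finset.prod_mul_distrib, ← Finset.prod_mul_distrib]
    exact Finset.prod_congr rfl fun j _ => tbinom_of_le t (h1 j) (e1 j)
  have e4 : ∏ j ∈ Finset.range (k + 1), tbinom t (l j) (c j) (l (j + 1)) =
      (∏ j ∈ Finset.range (k + 1), tfact t (l j - l (j + 1))) *
        (∏ j ∈ Finset.range (k + 1), tfact t (l j - c j))⁻¹ *
        (∏ j ∈ Finset.range (k + 1), tfact t (c j - l (j + 1)))⁻¹ := by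
    rw [← Finset.prod_inv_distrib, ← Finset.prod_inv_distrib,
      ← Finset.prod_mul_distrib, ← Finset.prod_mul_distrib]
    exact Finset.prod_congr rfl fun j _ => tbinom_of_le t (h2 j) (h1 j)
  have n1 := colNorm_ne_zero ht n k c
  have n2 : ∀ f : ℕ → ℕ, ∏ j ∈ Finset.range (k + 1), tfact t (f j) ≠ 0 := fun f =>
    Finset.prod_ne_zero_iff.mpr fun _ _ => tfact_ne_zero ht _
  have n3 := n2 fun j => l j - c j
  have n4 := n2 fun j => c j - l (j + 1)
  have n5 := n2 fun j => l j - l (j + 1)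
  have n6 := tfact_ne_zero ht (n - l 0)
  have n7 : colNorm t n (k + 1) l =
      tfact t (n - l 0) * ∏ j ∈ Finset.range (k + 1), tfact t (l j - l (j + 1)) := rfl
  rw [e3, e4, e2, n7]
  field_simp

theorem prod_tbinom_eq_zero (t : K) {k : ℕ} {c : ℕ → ℕ} {l : ℕ → ℕ} {j : ℕ} (hj : j < k)
    (h : ¬ (l (j + 1) ≤ c j ∧ c j ≤ l j)) :
    ∏ j ∈ Finset.range k, tbinom t (l j) (c j) (l (j + 1)) = 0 :=
  Finset.prod_eq_zero (Finset.mem_range.mpr hj) (tbinom_eq_zero t h)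

/-- Multiplication by the generating function of the elementary symmetric polynomials. -/
theorem prod_one_add_mul_hlCol {t : K} (ht : ∀ k : ℕ, 0 < k → t ^ k ≠ 1) {n N k : ℕ} (hN : n < N)
    (c : ℕ → ℕ) (hck : ∀ j, k ≤ j → c j = 0) {B : Type*} [CommRing B]
    (φ : MvPolynomial (Fin n) K →+* B) (a : B) :
    (∏ i, (1 + a * φ (MvPolynomial.X i))) * φ (hlCol t n k c) =
      ∑ l : Fin (k + 1) → Fin N, (∏ j ∈ Finset.range (k + 1), a ^ (ext l j - c j)) *
        φ (MvPolynomial.C (∏ j ∈ Finset.range (k + 1),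
          tbinom t (ext l j) (c j) (ext l (j + 1)))) * φ (hlCol t n (k + 1) (ext l)) := by
  -- The case of an indeterminate a is enough, by specialization. It takes place in a domain, where
  -- the product of the differences can be cancelled; B need not be a domain.
  suffices key : (∏ i, (1 + Polynomial.X * Polynomial.C (MvPolynomial.X i))) *
      Polynomial.C (hlCol t n k c) = ∑ l : Fin (k + 1) → Fin N,
      (∏ j ∈ Finset.range (k + 1), Polynomial.X ^ (ext l j - c j)) *
        Polynomial.C (MvPolynomial.C (∏ j ∈ Finset.range (k + 1),
          tbinom t (ext l j) (c j) (ext l (j + 1)))) *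
        Polynomial.C (hlCol t n (k + 1) (ext l)) by
    have := congrArg (Polynomial.eval₂RingHom φ a) key
    simpa only [map_mul, map_prod, map_add, map_one, map_sum, map_pow,
      Polynomial.coe_eval₂RingHom, Polynomial.eval₂_X, Polynomial.eval₂_C] using this
  by_cases hc : Antitone c ∧ c 0 ≤ n
  swap
  -- If c is not a diagram with at most n rows, both sides vanish: a diagram l with at most n rows
  -- and a nonzero coefficient would interlace with c and force c to be one.
  · rw [hlCol_of_neg t hc, map_zero, mul_zero, Finset.sum_eq_zero]
    intro l _
    by_cases hl : Antitone (ext l) ∧ ext l 0 ≤ n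
    swap
    · rw [hlCol_of_neg t hl, map_zero, mul_zero]
    by_cases h1 : ∀ j, j < k + 1 → (ext l (j + 1) ≤ c j ∧ c j ≤ ext l j)
    · refine absurd ⟨antitone_nat_of_succ_le fun j => ?_, ?_⟩ hc
      · rcases lt_or_ge (j + 1) (k + 1) with h | h
        · exact (h1 _ h).2.trans (h1 j (by omega)).1
        · rw [hck _ (by omega)]; exact Nat.zero_le _
      · exact (h1 0 (by omega)).2.trans hl.2
    · push Not at h1
      obtain ⟨j, hj, h1⟩ := h1
      rw [prod_tbinom_eq_zero t hj (fun h => (h1 h.1).not_ge h.2)]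
      simp
  obtain ⟨hc, hc0⟩ := hc
  have h0 : (Polynomial.C (pairProd 1 (fun i => MvPolynomial.X i) : MvPolynomial (Fin n) K)) ≠ 0 :=
    by rw [Ne, Polynomial.C_eq_zero]; exact pairProd_one_ne_zero n
  refine mul_left_cancel₀ h0 ?_
  have hanti : Antitone (colShift n c) := antitone_nat_of_succ_le fun j => by
    rcases j with _ | j
    · exact hc0
    · exact hc (Nat.le_succ j)
  have hmain := sum_powerset_hlNum ht (Polynomial.C : MvPolynomial (Fin n) K →+* _) Polynomial.X
    (N := N) (k + 1) (colShift n c) hanti le_rfl hN (hck k le_rfl) (rowFn k c)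
    (fun j i h1 h2 => rowFn_eq_of_block hc h1 fun j' hj' => h2.trans_le
      (hanti (show j' + 1 ≤ j by omega)))
  have hE := prod_one_add_mul_hlNum t (Polynomial.C : MvPolynomial (Fin n) K →+* _) Polynomial.X
    (rowFn k c)
  rw [show (colShift n c 0) = n from rfl] at hmain
  rw [hmain] at hE
  rw [hlCol_of_pos t hc hc0, mul_left_comm, ← map_mul, mul_left_comm (pairProd _ _),
    pairProd_mul_hlSym, map_mul, mul_left_comm, hE, Finset.mul_sum, Finset.mul_sum]
  refine Finset.sum_congr rfl fun l _ => ?_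
  by_cases h1 : ∀ j, c j ≤ ext l j
  swap
  · push Not at h1
    obtain ⟨j, hj⟩ := h1
    have hjk : j < k + 1 := by
      by_contra h
      rw [hck j (by omega)] at hj
      omega
    have hL : ∏ j ∈ Finset.range (k + 1), tbinom t (colShift n c j) (ext l j)
        (colShift n c (j + 1)) = 0 :=
      Finset.prod_eq_zero (Finset.mem_range.mpr hjk)
        (tbinom_eq_zero t (fun h => hj.not_ge h.1))
    rw [prod_tbinom_eq_zero t hjk (fun h => hj.not_ge h.2), Finset.prod_mul_distrib,
      ← map_prod, ← map_prod, hL]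
    simp
  by_cases h2 : (∀ j, ext l (j + 1) ≤ c j) ∧ ext l 0 ≤ n
  swap
  · have hL : ∏ j ∈ Finset.range (k + 1), tbinom t (colShift n c j) (ext l j)
        (colShift n c (j + 1)) = 0 := by
      rcases not_and_or.mp h2 with h2 | h2
      · push Not at h2
        obtain ⟨j, hj⟩ := h2
        have hjk : j + 1 < k + 1 := by
          by_contra h
          rw [ext_of_le l (by omega)] at hj
          omega
        exact Finset.prod_eq_zero (Finset.mem_range.mpr hjk)
          (tbinom_eq_zero t (fun h => hj.not_ge h.2))
      · exact Finset.prod_eq_zero (Finset.mem_range.mpr (Nat.succ_pos k))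
          (tbinom_eq_zero t (fun h => h2 h.2))
    rw [Finset.prod_mul_distrib, ← map_prod, ← map_prod, hL]
    rcases not_and_or.mp h2 with h2 | h2
    · push Not at h2
      obtain ⟨j, hj⟩ := h2
      have hjk : j + 1 < k + 1 := by
        by_contra h
        rw [ext_of_le l (by omega)] at hj
        omega
      rw [prod_tbinom_eq_zero t (show j < k + 1 by omega) (fun h => hj.not_ge h.1)]
      simp
    · rw [hlCol_of_neg t (fun h => h2 h.2)]
      simp
  obtain ⟨h2, h3⟩ := h2
  have hl : Antitone (ext l) := antitone_nat_of_succ_le fun j => (h2 j).trans (h1 j)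
  -- When c and l interlace, raising the rows c_j ≤ x < l_j adds exactly the cells of l / c.
  have hrow : (fun x => rowFn k c x + ∑ j ∈ Finset.range (k + 1),
      if colShift n c (j + 1) ≤ x ∧ x < ext l j then 1 else 0) = rowFn (k + 1) (ext l) := by
    funext x
    rw [← rowFn_succ (hck k le_rfl), rowFn, rowFn, ← Finset.sum_add_distrib]
    refine Finset.sum_congr rfl fun j _ => ?_
    have := h1 j
    change _ + (if c j ≤ x ∧ x < ext l j then 1 else 0) = _
    by_cases hx : x < c j
    · have e1 : ¬ (c j ≤ x ∧ x < ext l j) := by omega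
      have e2 : x < ext l j := by omega
      rw [if_pos hx, if_neg e1, if_pos e2]
    · by_cases hx' : x < ext l j
      · have e1 : c j ≤ x ∧ x < ext l j := by omega
        rw [if_neg hx, if_pos e1, if_pos hx']
      · have e1 : ¬ (c j ≤ x ∧ x < ext l j) := by omega
        rw [if_neg hx, if_neg e1, if_neg hx']
  rw [hrow, hlCol_of_pos t hl h3, ← pairProd_mul_hlSym]
  have key := congrArg (fun z => Polynomial.C (MvPolynomial.C (σ := Fin n) z))
    (prod_tbinom_mul_inv_colNorm ht h1 h2 h3 (hck k le_rfl))
  simp only [map_mul] at key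
  simp only [Finset.prod_mul_distrib, map_mul, ← map_prod, colShift] at key ⊢
  linear_combination (Polynomial.C (MvPolynomial.C (σ := Fin n) ((1 - t) ^ n)) *
    (∏ j ∈ Finset.range (k + 1), Polynomial.X ^ (ext l j - c j)) *
    Polynomial.C (pairProd 1 (fun i => MvPolynomial.X i) : MvPolynomial (Fin n) K) *
    Polynomial.C (hlSym t (rowFn (k + 1) (ext l)) n)) * key

end

/-! ### Strip coefficients and two-state transfer recursions -/

section Transfer

variable {K : Type*} [Field K]

/-- Weight of one column in the branching coefficient of `l / m`, where `u, u'` are the lengths of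
this and the next column of `l`, and `m, m'` those of `m`. -/
def psiW (t : K) (u u' m m' : ℕ) : K :=
  if u = m ∨ u = m + 1 then (if u = m ∧ u' = m' + 1 then 1 - t ^ (m - m') else 1) else 0

/-- Weight of one column in the Pieri coefficient of `l / m`, where `u, u'` are the lengths of
this and the next column of `l`, and `m, m'` those of `m`. -/
def phiW (t : K) (u u' m m' : ℕ) : K :=
  if u = m ∨ u = m + 1 then (if u = m + 1 ∧ u' = m' then 1 - t ^ (u - u') else 1) else 0

theorem psiW_eq_zero (t : K) {u u' m m' : ℕ} (h : u ≠ m) (h' : u ≠ m + 1) :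
    psiW t u u' m m' = 0 := if_neg (by tauto)

theorem phiW_eq_zero (t : K) {u u' m m' : ℕ} (h : u ≠ m) (h' : u ≠ m + 1) :
    phiW t u u' m m' = 0 := if_neg (by tauto)

theorem psiW_same (t : K) (u m' : ℕ) : psiW t u m' u m' = 1 := by simp [psiW]

theorem psiW_same_succ (t : K) (u m' : ℕ) : psiW t u (m' + 1) u m' = 1 - t ^ (u - m') := by
  simp [psiW]

theorem psiW_succ (t : K) (u u' m' : ℕ) : psiW t (u + 1) u' u m' = 1 := by simp [psiW]

theorem phiW_same (t : K) (u u' m' : ℕ) : phiW t u u' u m' = 1 := by simp [phiW]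

theorem phiW_succ_same (t : K) (u m' : ℕ) : phiW t (u + 1) m' u m' = 1 - t ^ (u + 1 - m') := by
  simp [phiW]

theorem phiW_succ_succ (t : K) (u m' : ℕ) : phiW t (u + 1) (m' + 1) u m' = 1 := by simp [phiW]

variable {B : Type*} [CommRing B]

theorem chain_succ_eq_zero {N k : ℕ} {W : ℕ → ℕ → ℕ → B} {u : ℕ} (h : ∀ v, W 0 u v = 0) :
    chain N (k + 1) W u = 0 :=
  Finset.sum_eq_zero fun v _ => by rw [h v, zero_mul]

theorem chain_zero_eq_zero {N : ℕ} {W : ℕ → ℕ → ℕ → B} {u : ℕ} (h : u ≠ 0) :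
    chain N 0 W u = 0 := if_neg h

theorem chain_one {N : ℕ} (hN : 0 < N) (W : ℕ → ℕ → ℕ → B) (u : ℕ) :
    chain N 1 W u = W 0 u 0 := by
  simp [chain, hN]

theorem chain_succ_eq_add_succ {N k m : ℕ} {W : ℕ → ℕ → ℕ → B} (u : ℕ) (hm : m + 1 < N)
    (h : ∀ v, v ≠ m → v ≠ m + 1 → chain N k (fun i => W (i + 1)) v = 0) :
    chain N (k + 1) W u = W 0 u m * chain N k (fun i => W (i + 1)) m +
      W 0 u (m + 1) * chain N k (fun i => W (i + 1)) (m + 1) :=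
  sum_range_eq_add_succ hm (fun v => W 0 u v * chain N k (fun i => W (i + 1)) v)
    fun v h1 h2 => by rw [h v h1 h2, mul_zero]

theorem chain_succ_eq_add_pred {N k m : ℕ} {W : ℕ → ℕ → ℕ → B} (u : ℕ) (hm : m < N)
    (h : ∀ v, v ≠ m → v + 1 ≠ m → chain N k (fun i => W (i + 1)) v = 0) :
    chain N (k + 1) W u = W 0 u m * chain N k (fun i => W (i + 1)) m +
      W 0 u (m - 1) * if 0 < m then chain N k (fun i => W (i + 1)) (m - 1) else 0 := by
  rw [mul_ite, mul_zero]
  exact sum_range_eq_add_pred hm (fun v => W 0 u v * chain N k (fun i => W (i + 1)) v)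
    fun v h1 h2 => by rw [h v h1 h2, mul_zero]

variable [Algebra K B]

/-- The reciprocal of `tfact` at `z` times the power `a ^ z`, zero for negative `z`. -/
def itfactPow (t : K) (a : B) (z : ℤ) : B := algebraMap K B (itfact t z) * a ^ z.toNat

/-- Keeping the power of a together with the reciprocal t-factorial makes the recurrence uniform in
z: where the exponent is truncated, the factor in front of it is zero. -/
theorem mul_itfactPow_sub_one {t : K} (ht : ∀ k : ℕ, 0 < k → t ^ k ≠ 1) (a : B) (z : ℤ) :
    a * itfactPow t a (z - 1) = (1 - algebraMap K B (t ^ z)) * itfactPow t a z := by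
  have h1 : (1 - algebraMap K B (t ^ z)) * itfactPow t a z =
      algebraMap K B (itfact t (z - 1)) * a ^ z.toNat := by
    rw [itfact_sub_one ht, itfactPow, map_mul, map_sub, map_one]
    ring
  rw [h1, itfactPow]
  rcases lt_or_ge (z - 1) 0 with h | h
  · simp [itfact_of_neg t h]
  · have : z.toNat = (z - 1).toNat + 1 := by omega
    rw [this, pow_succ]
    ring

theorem pow_mul_tbinom (t : K) (a : B) (p q r : ℕ) :
    a ^ (p - q) * algebraMap K B (tbinom t p q r) =
      algebraMap K B (tfact t (p - r)) * itfactPow t a ((p : ℤ) - q) *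
        algebraMap K B (itfact t ((q : ℤ) - r)) := by
  rw [itfactPow, Int.toNat_sub, tbinom, map_mul, map_mul]
  ring

/-! ### Commuting branching with vertical strips -/

section Branching

/-- Column weights for a vertical strip `l / μ` and a horizontal strip `l / ν`. -/
def upWeight (t : K) (a y : B) (μ ν : ℕ → ℕ) (i u u' : ℕ) : B :=
  a ^ (u - μ i) * algebraMap K B (tbinom t u (μ i) u') *
    (algebraMap K B (psiW t u u' (ν i) (ν (i + 1))) * y ^ (u - ν i))

/-- Column weights for a horizontal strip `μ / r` and a vertical strip `ν / r`. -/
def downWeight (t : K) (a y : B) (μ ν : ℕ → ℕ) (i u u' : ℕ) : B :=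
  algebraMap K B (psiW t (μ i) (μ (i + 1)) u u') * y ^ (μ i - u) *
    (a ^ (ν i - u) * algebraMap K B (tbinom t (ν i) u (ν (i + 1))))

theorem upWeight_eq (t : K) (a y : B) (μ ν : ℕ → ℕ) (i u u' : ℕ) :
    upWeight t a y μ ν i u u' = algebraMap K B (tfact t (u - u')) *
      itfactPow t a ((u : ℤ) - μ i) * algebraMap K B (itfact t ((μ i : ℤ) - u')) *
      (algebraMap K B (psiW t u u' (ν i) (ν (i + 1))) * y ^ (u - ν i)) := by
  rw [upWeight, pow_mul_tbinom]

theorem downWeight_eq (t : K) (a y : B) (μ ν : ℕ → ℕ) (i u u' : ℕ) :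
    downWeight t a y μ ν i u u' =
      algebraMap K B (psiW t (μ i) (μ (i + 1)) u u') * y ^ (μ i - u) *
      (algebraMap K B (tfact t (ν i - ν (i + 1))) *
      itfactPow t a ((ν i : ℤ) - u) * algebraMap K B (itfact t ((u : ℤ) - ν (i + 1)))) := by
  rw [downWeight, pow_mul_tbinom]

theorem chain_upWeight_eq_zero (t : K) (a y : B) (μ ν : ℕ → ℕ) {N k : ℕ} {u : ℕ}
    (h1 : u ≠ ν 0) (h2 : u ≠ ν 0 + 1) : chain N (k + 1) (upWeight t a y μ ν) u = 0 :=
  chain_succ_eq_zero fun v => by rw [upWeight, psiW_eq_zero t h1 h2]; simp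

theorem chain_downWeight_eq_zero (t : K) (a y : B) (μ ν : ℕ → ℕ) {N k : ℕ} (hk : μ k = 0) {u : ℕ}
    (h1 : u ≠ μ 0) (h2 : u + 1 ≠ μ 0) : chain N k (downWeight t a y μ ν) u = 0 := by
  rcases k with _ | k
  · exact chain_zero_eq_zero (by omega)
  · exact chain_succ_eq_zero fun v => by rw [downWeight, psiW_eq_zero t h1.symm h2.symm]; simp

/-- L0 and L1 collect the l whose first column has length ν_0 and ν_0 + 1, R0 and R1 the r whose
first column has length μ_0 and μ_0 - 1. The first relation is the wanted one. The second, which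
singles out R1, is needed because the step weights mix the two states. The factor a^{ν_k} accounts
for the last column of ν, which r does not have. -/
theorem chain_up_down {t : K} (ht0 : t ≠ 0) (ht : ∀ k : ℕ, 0 < k → t ^ k ≠ 1) (a y : B) {N : ℕ}
    (k : ℕ) (μ ν : ℕ → ℕ) (hμ : Antitone μ) (hν : Antitone ν) (hμk : ∀ j, k ≤ j → μ j = 0)
    (hνk : ∀ j, k + 1 ≤ j → ν j = 0) (hμN : μ 0 < N) (hνN : ν 0 + 1 < N) :
    let L0 := chain N (k + 1) (upWeight t a y μ ν) (ν 0)
    let L1 := chain N (k + 1) (upWeight t a y μ ν) (ν 0 + 1)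
    let R0 := chain N k (downWeight t a y μ ν) (μ 0) * a ^ ν k
    let R1 := (if 0 < μ 0 then chain N k (downWeight t a y μ ν) (μ 0 - 1) else 0) * a ^ ν k
    L0 + L1 = (1 + a * y) * (R0 + R1) ∧
      L1 - a * y * L0 = (1 + a * y) * algebraMap K B (t ^ ((ν 0 : ℤ) - μ 0 + 1)) * R1 := by
  intro L0 L1 R0 R1
  induction k generalizing μ ν with
  | zero =>
    have h0 : μ 0 = 0 := hμk 0 le_rfl
    have h1 : ν (0 + 1) = 0 := hνk 1 le_rfl
    have e0 : L0 = a ^ ν 0 := by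
      simp only [L0]
      rw [chain_one (by omega), upWeight, h0, h1, psiW_same, tbinom_right ht (Nat.zero_le _)]
      simp
    have e1 : L1 = a ^ (ν 0 + 1) * y := by
      simp only [L1]
      rw [chain_one (by omega), upWeight, h0, h1, psiW_succ, tbinom_right ht (Nat.zero_le _)]
      simp
    have e2 : R0 = a ^ ν 0 := by
      simp only [R0]; rw [chain, if_pos h0, one_mul]
    have e3 : R1 = 0 := by
      simp only [R1]; rw [h0, if_neg (lt_irrefl 0), zero_mul]
    rw [e0, e1, e2, e3]
    constructor <;> ring
  | succ k ih =>
    obtain ⟨h1, h2⟩ := ih (fun i => μ (i + 1)) (fun i => ν (i + 1))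
      (fun i j h => hμ (by omega)) (fun i j h => hν (by omega)) (fun j h => hμk _ (by omega))
      (fun j h => hνk _ (by omega)) ((hμ (Nat.zero_le 1)).trans_lt hμN)
      ((Nat.succ_le_succ (hν (Nat.zero_le 1))).trans_lt hνN)
    have hup : ∀ i, upWeight t a y μ ν (i + 1) =
      upWeight t a y (fun i => μ (i + 1)) (fun i => ν (i + 1)) i := fun i => rfl
    have hdown : ∀ i, downWeight t a y μ ν (i + 1) =
      downWeight t a y (fun i => μ (i + 1)) (fun i => ν (i + 1)) i := fun i => rfl
    have hν1 : ν 1 ≤ ν 0 := hν (Nat.zero_le 1)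
    have hμ1 : μ 1 ≤ μ 0 := hμ (Nat.zero_le 1)
    have hL : ∀ u, chain N (k + 1 + 1) (upWeight t a y μ ν) u = _ := fun u =>
      chain_succ_eq_add_succ u (m := ν 1) (by omega)
        (fun v h1 h2 => chain_upWeight_eq_zero t a y (fun i => μ (i + 1)) (fun i => ν (i + 1)) h1 h2)
    have hR : ∀ u, chain N (k + 1) (downWeight t a y μ ν) u = _ := fun u =>
      chain_succ_eq_add_pred u (m := μ 1) (by omega)
        (fun v h1 h2 => chain_downWeight_eq_zero t a y (fun i => μ (i + 1)) (fun i => ν (i + 1))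
          (hμk (k + 1) le_rfl) h1 h2)
    simp only [hup] at hL
    simp only [hdown] at hR
    simp only [zero_add] at h1 h2
    -- Primes denote the same quantities for the diagrams without their first columns, except that
    -- S0' and S1' omit the power of a in R0 and R1. The weights below are the entries of the two 2
    -- × 2 transfer matrices.
    set L0' := chain N (k + 1) (upWeight t a y (fun i => μ (i + 1)) fun i => ν (i + 1)) (ν 1)
    set L1' := chain N (k + 1) (upWeight t a y (fun i => μ (i + 1)) fun i => ν (i + 1)) (ν 1 + 1)
    set S0' := chain N k (downWeight t a y (fun i => μ (i + 1)) fun i => ν (i + 1)) (μ 1)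
    set S1' := if 0 < μ 1 then
      chain N k (downWeight t a y (fun i => μ (i + 1)) fun i => ν (i + 1)) (μ 1 - 1) else 0
    have hS1 : μ 1 = 0 → S1' = 0 := fun h => by simp [S1', h]
    set g := itfactPow t a ((ν 0 : ℤ) - μ 0) with hg
    set α := itfactPow t a ((ν 0 : ℤ) - μ 0 + 1) with hα
    set T := algebraMap K B (t ^ ((ν 0 : ℤ) - μ 0 + 1)) with hT
    set T' := algebraMap K B (t ^ ((ν 1 : ℤ) - μ 1 + 1)) with hT'
    set U := algebraMap K B (t ^ ((μ 0 : ℤ) - ν 1)) with hU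
    set β := algebraMap K B (itfact t ((μ 0 : ℤ) - ν 1)) with hβ
    set V := algebraMap K B (tfact t (ν 0 - ν 1)) with hV
    have hag : a * g = (1 - T) * α := by
      have := mul_itfactPow_sub_one ht a ((ν 0 : ℤ) - μ 0 + 1)
      rwa [add_sub_cancel_right] at this
    have hβ1 : algebraMap K B (itfact t ((μ 0 : ℤ) - ν 1 - 1)) = (1 - U) * β := by
      rw [itfact_sub_one ht, map_mul, map_sub, map_one]
    have hTU : algebraMap K B (t ^ (ν 0 - ν 1 + 1)) = T * U := by
      rw [hT, hU, ← map_mul, ← zpow_add₀ ht0, ← zpow_natCast]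
      congr 2
      omega
    have hUT : algebraMap K B (t ^ (μ 0 - μ 1 + 1)) = U * T' := by
      rw [hT', hU, ← map_mul, ← zpow_add₀ ht0, ← zpow_natCast]
      congr 2
      omega
    have w00 : upWeight t a y μ ν 0 (ν 0) (ν 1) = V * g * β := by
      rw [upWeight_eq, psiW_same, map_one, Nat.sub_self, pow_zero, mul_one, mul_one]
    have w01 : upWeight t a y μ ν 0 (ν 0) (ν 1 + 1) = V * g * ((1 - U) * β) := by
      rw [upWeight_eq, psiW_same_succ, Nat.sub_self, pow_zero, mul_one, ← hβ1, Nat.cast_add,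
        Nat.cast_one, ← sub_sub]
      -- For ν_0 = ν_1 this entry belongs to a sequence that increases. The left side is zero by 1 -
      -- t^0, and on the right one of the two reciprocal t-factorials has a negative argument.
      rcases Nat.eq_or_lt_of_le hν1 with h | h
      · rw [hV, hg, h, Nat.sub_self, pow_zero, sub_self, map_zero, mul_zero]
        rcases lt_or_ge ((ν 0 : ℤ) - μ 0) 0 with h' | h'
        · rw [itfactPow, itfact_of_neg t h']; simp
        · rw [itfact_of_neg t (z := (μ 0 : ℤ) - ν 0 - 1) (by omega)]; simp
      · have : ν 0 - ν 1 = ν 0 - (ν 1 + 1) + 1 := by omega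
        rw [hV, this, tfact_succ, map_mul]
        ring
    have w10 : upWeight t a y μ ν 0 (ν 0 + 1) (ν 1) = V * (1 - T * U) * α * β * y := by
      rw [upWeight_eq, psiW_succ, map_one, show ν 0 + 1 - ν 1 = ν 0 - ν 1 + 1 by omega,
        tfact_succ, map_mul, map_sub, hTU, map_one, Nat.add_sub_cancel_left, pow_one,
        show ((ν 0 + 1 : ℕ) : ℤ) - μ 0 = (ν 0 : ℤ) - μ 0 + 1 by push_cast; ring]
      ring
    have w11 : upWeight t a y μ ν 0 (ν 0 + 1) (ν 1 + 1) = V * α * ((1 - U) * β) * y := by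
      rw [upWeight_eq, psiW_succ, map_one, Nat.add_sub_add_right,
        show ((ν 0 + 1 : ℕ) : ℤ) - μ 0 = (ν 0 : ℤ) - μ 0 + 1 by push_cast; ring,
        Nat.add_sub_cancel_left, pow_one, ← hβ1, Nat.cast_add, Nat.cast_one, ← sub_sub]
      ring
    have d00 : downWeight t a y μ ν 0 (μ 0) (μ 1) = V * g * β := by
      rw [downWeight_eq, psiW_same, map_one, Nat.sub_self, pow_zero, mul_one, one_mul]
    have d01 : downWeight t a y μ ν 0 (μ 0) (μ 1 - 1) * S1' =
        V * g * β * (1 - U * T') * S1' := by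
      rcases Nat.eq_zero_or_pos (μ 1) with h | h
      · rw [hS1 h, mul_zero, mul_zero]
      · obtain ⟨m, hm⟩ := Nat.exists_eq_add_of_le' h
        have e : μ (0 + 1) = m + 1 := hm
        rw [downWeight_eq, e, Nat.add_sub_cancel, psiW_same_succ, Nat.sub_self, pow_zero,
          mul_one, map_sub, map_one, ← hUT, show μ 0 - μ 1 + 1 = μ 0 - m by omega]
        ring
    have d1 : ∀ v, 0 < μ 0 → downWeight t a y μ ν 0 (μ 0 - 1) v = V * α * ((1 - U) * β) * y := by
      intro v h
      obtain ⟨m, hm⟩ := Nat.exists_eq_add_of_le' h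
      rw [downWeight_eq, ← hβ1, hα]
      simp only [hm, Nat.add_sub_cancel, psiW_succ, map_one, Nat.add_sub_cancel_left, pow_one,
        Nat.cast_add, Nat.cast_one]
      rw [show (ν 0 : ℤ) - m = (ν 0 : ℤ) - (m + 1) + 1 by ring,
        show (m : ℤ) + 1 - ν 1 - 1 = (m : ℤ) - ν 1 by ring]
      ring
    -- For μ_0 = 0 there is no r with a shorter first column, and the uniform formula for R1
    -- vanishes as well.
    have z1 : μ 0 = 0 → (1 - U) * β = 0 := fun h => by
      rw [← hβ1, itfact_of_neg t (by omega), map_zero]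
    have eL0 : L0 = V * g * β * L0' + V * g * ((1 - U) * β) * L1' := by
      simp only [L0]; rw [hL, w00, w01]
    have eL1 : L1 = V * (1 - T * U) * α * β * y * L0' + V * α * ((1 - U) * β) * y * L1' := by
      simp only [L1]; rw [hL, w10, w11]
    have eR0 : R0 = (V * g * β * S0' + V * g * β * (1 - U * T') * S1') * a ^ ν (k + 1) := by
      simp only [R0]; rw [hR, d00, d01]
    have eR1 : R1 = (V * α * ((1 - U) * β) * y * (S0' + S1')) * a ^ ν (k + 1) := by
      simp only [R1]
      rcases Nat.eq_zero_or_pos (μ 0) with h | h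
      · rw [if_neg (by omega), z1 h]; ring
      · rw [if_pos h, hR, d1 _ h, d1 _ h]; ring
    rw [eL0, eL1, eR0, eR1]
    constructor
    · linear_combination (V * g * β + y * V * α * (1 - U) * β) * h1 - V * g * β * U * h2 -
        V * U * β * y * L0' * hag
    · linear_combination (y * V * α * β * T * (1 - U)) * h1 -
        (y * V * β * (L0' + (1 - U) * L1')) * hag

/-- Compatibility of the branching coefficients with the Pieri coefficients of vertical strips. -/
theorem sum_upWeight {t : K} (ht0 : t ≠ 0) (ht : ∀ k : ℕ, 0 < k → t ^ k ≠ 1) (a y : B) {N : ℕ}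
    (k : ℕ) (μ ν : ℕ → ℕ) (hμ : Antitone μ) (hν : Antitone ν) (hμk : ∀ j, k ≤ j → μ j = 0)
    (hνk : ∀ j, k + 1 ≤ j → ν j = 0) (hμN : μ 0 < N) (hνN : ν 0 + 1 < N) :
    ∑ l : Fin (k + 1) → Fin N, ∏ i ∈ Finset.range (k + 1),
        upWeight t a y μ ν i (ext l i) (ext l (i + 1)) =
      (1 + a * y) * ((∑ r : Fin k → Fin N, ∏ i ∈ Finset.range k,
        downWeight t a y μ ν i (ext r i) (ext r (i + 1))) * a ^ ν k) := by
  have h := (chain_up_down ht0 ht a y k μ ν hμ hν hμk hνk hμN hνN).1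
  rw [sum_prod_eq_chain (by omega), sum_prod_eq_chain (by omega),
    sum_range_eq_add_succ hνN _ (fun u h1 h2 => chain_upWeight_eq_zero t a y μ ν h1 h2),
    sum_range_eq_add_pred hμN _
      (fun u h1 h2 => chain_downWeight_eq_zero t a y μ ν (hμk k le_rfl) h1 h2), h]
  ring

end Branching

/-! ### Inverting vertical-strip coefficients by horizontal-strip coefficients -/

section Pieri

/-- Column weights for a horizontal strip `l / μ` and a vertical strip `κ / l`. -/
def pieriWeight (t : K) (b a : B) (μ κ : ℕ → ℕ) (i u u' : ℕ) : B :=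
  algebraMap K B (phiW t u u' (μ i) (μ (i + 1))) * b ^ (u - μ i) *
    (a ^ (κ i - u) * algebraMap K B (tbinom t (κ i) u (κ (i + 1))))

theorem pieriWeight_eq (t : K) (b a : B) (μ κ : ℕ → ℕ) (i u u' : ℕ) :
    pieriWeight t b a μ κ i u u' =
      algebraMap K B (phiW t u u' (μ i) (μ (i + 1))) * b ^ (u - μ i) *
      (algebraMap K B (tfact t (κ i - κ (i + 1))) *
      itfactPow t a ((κ i : ℤ) - u) * algebraMap K B (itfact t ((u : ℤ) - κ (i + 1)))) := by
  rw [pieriWeight, pow_mul_tbinom]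

theorem chain_pieriWeight_eq_zero (t : K) (b a : B) (μ κ : ℕ → ℕ) {N k : ℕ} (hk : μ k = 0) {u : ℕ}
    (h1 : u ≠ μ 0) (h2 : u ≠ μ 0 + 1) : chain N k (pieriWeight t b a μ κ) u = 0 := by
  rcases k with _ | k
  · exact chain_zero_eq_zero (by omega)
  · exact chain_succ_eq_zero fun v => by rw [pieriWeight, phiW_eq_zero t h1 h2]; simp

/-- O is the vertical-strip weight of κ / μ at -t b. The first relation expresses E(-b) ∏ (1 - t b
x_i)/(1 - b x_i) = E(-t b) in coefficients. The second one, which isolates the l with the same first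
column as μ, makes the induction on columns close. -/
theorem chain_pieri {t : K} (ht0 : t ≠ 0) (ht : ∀ k : ℕ, 0 < k → t ^ k ≠ 1) (b : B) {N : ℕ}
    (k : ℕ) (μ κ : ℕ → ℕ) (hμ : Antitone μ) (hκ : Antitone κ) (hμk : ∀ j, k ≤ j → μ j = 0)
    (hκk : ∀ j, k ≤ j → κ j = 0) (hμN : μ 0 + 1 < N) :
    let V0 := chain N k (pieriWeight t b (-b) μ κ) (μ 0)
    let V1 := chain N k (pieriWeight t b (-b) μ κ) (μ 0 + 1)
    let O := ∏ i ∈ Finset.range k, ((-(algebraMap K B t * b)) ^ (κ i - μ i) *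
      algebraMap K B (tbinom t (κ i) (μ i) (κ (i + 1))))
    V0 + V1 = O ∧ algebraMap K B (t ^ ((κ 0 : ℤ) - μ 0)) * V0 = O := by
  intro V0 V1 O
  induction k generalizing μ κ with
  | zero =>
    have h0 : μ 0 = 0 := hμk 0 le_rfl
    have h1 : κ 0 = 0 := hκk 0 le_rfl
    simp [V0, V1, O, chain, h0, h1]
  | succ k ih =>
    obtain ⟨h1, h2⟩ := ih (fun i => μ (i + 1)) (fun i => κ (i + 1))
      (fun i j h => hμ (by omega)) (fun i j h => hκ (by omega)) (fun j h => hμk _ (by omega))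
      (fun j h => hκk _ (by omega)) ((Nat.succ_le_succ (hμ (Nat.zero_le 1))).trans_lt hμN)
    have hw : ∀ i, pieriWeight t b (-b) μ κ (i + 1) =
      pieriWeight t b (-b) (fun i => μ (i + 1)) (fun i => κ (i + 1)) i := fun i => rfl
    have hκ1 : κ 1 ≤ κ 0 := hκ (Nat.zero_le 1)
    have hμ1 : μ 1 ≤ μ 0 := hμ (Nat.zero_le 1)
    have hV : ∀ u, chain N (k + 1) (pieriWeight t b (-b) μ κ) u = _ := fun u =>
      chain_succ_eq_add_succ u (m := μ 1) (by omega)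
        (fun v h1 h2 => chain_pieriWeight_eq_zero t b (-b) (fun i => μ (i + 1))
          (fun i => κ (i + 1)) (hμk (k + 1) le_rfl) h1 h2)
    simp only [hw] at hV
    simp only [zero_add] at h1 h2
    set V0' := chain N k (pieriWeight t b (-b) (fun i => μ (i + 1)) fun i => κ (i + 1)) (μ 1)
    set V1' := chain N k (pieriWeight t b (-b) (fun i => μ (i + 1)) fun i => κ (i + 1)) (μ 1 + 1)
    set O' := ∏ i ∈ Finset.range k, ((-(algebraMap K B t * b)) ^ (κ (i + 1) - μ (i + 1)) *
      algebraMap K B (tbinom t (κ (i + 1)) (μ (i + 1)) (κ (i + 1 + 1)))) with hO'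
    set g := itfactPow t (-b) ((κ 0 : ℤ) - μ 0) with hg
    set γ := itfactPow t (-b) ((κ 0 : ℤ) - μ 0 - 1) with hγ
    set T := algebraMap K B (t ^ ((κ 0 : ℤ) - μ 0)) with hT
    set T' := algebraMap K B (t ^ ((κ 1 : ℤ) - μ 1)) with hT'
    set U := algebraMap K B (t ^ ((μ 0 : ℤ) - κ 1 + 1)) with hU
    set β := algebraMap K B (itfact t ((μ 0 : ℤ) - κ 1)) with hβ
    set δ := algebraMap K B (itfact t ((μ 0 : ℤ) - κ 1 + 1)) with hδ
    set V := algebraMap K B (tfact t (κ 0 - κ 1)) with hVd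
    have hag : -b * γ = (1 - T) * g := mul_itfactPow_sub_one ht (-b) ((κ 0 : ℤ) - μ 0)
    have hβ1 : β = (1 - U) * δ := by
      have := itfact_sub_one ht ((μ 0 : ℤ) - κ 1 + 1)
      rw [add_sub_cancel_right] at this
      rw [hβ, this, map_mul, map_sub, map_one]
    have hUT : algebraMap K B (t ^ (μ 0 + 1 - μ 1)) = U * T' := by
      rw [hT', hU, ← map_mul, ← zpow_add₀ ht0, ← zpow_natCast]
      congr 2
      omega
    have w0 : ∀ v, pieriWeight t b (-b) μ κ 0 (μ 0) v = V * g * β := by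
      intro v
      rw [pieriWeight_eq, phiW_same, map_one, Nat.sub_self, pow_zero, mul_one, one_mul]
    have w10 : pieriWeight t b (-b) μ κ 0 (μ 0 + 1) (μ 1) = b * V * γ * δ * (1 - U * T') := by
      rw [pieriWeight_eq, phiW_succ_same, Nat.add_sub_cancel_left, pow_one, map_sub, map_one,
        show ((κ 0 : ℤ) - (μ 0 + 1 : ℕ)) = (κ 0 : ℤ) - μ 0 - 1 by push_cast; ring,
        show (((μ 0 + 1 : ℕ) : ℤ) - κ (0 + 1)) = (μ 0 : ℤ) - κ 1 + 1 by push_cast; ring]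
      rw [show μ (0 + 1) = μ 1 from rfl, hUT]
      ring
    have w11 : pieriWeight t b (-b) μ κ 0 (μ 0 + 1) (μ 1 + 1) = b * V * γ * δ := by
      rw [pieriWeight_eq, phiW_succ_succ, Nat.add_sub_cancel_left, pow_one, map_one,
        show ((κ 0 : ℤ) - (μ 0 + 1 : ℕ)) = (κ 0 : ℤ) - μ 0 - 1 by push_cast; ring,
        show (((μ 0 + 1 : ℕ) : ℤ) - κ (0 + 1)) = (μ 0 : ℤ) - κ 1 + 1 by push_cast; ring]
      ring
    have eO : O = V * T * g * β * O' := by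
      simp only [O]
      rw [Finset.prod_range_succ', pow_mul_tbinom, mul_comm, ← hO']
      congr 1
      -- Replacing -b by -t b costs t to the power κ_0 - μ_0, which is T; for negative κ_0 - μ_0
      -- both sides are zero.
      have : itfactPow t (-(algebraMap K B t * b)) ((κ 0 : ℤ) - μ 0) = T * g := by
        rw [hg, itfactPow, itfactPow]
        rcases lt_or_ge ((κ 0 : ℤ) - μ 0) 0 with h | h
        · simp [itfact_of_neg t h]
        · rw [← mul_neg, mul_pow, hT]
          have e : t ^ ((κ 0 : ℤ) - μ 0) = t ^ ((κ 0 : ℤ) - μ 0).toNat := by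
            conv_lhs => rw [← Int.toNat_of_nonneg h, zpow_natCast]
          rw [e, map_pow]
          ring
      rw [this]
      ring
    have e0 : V0 = V * g * β * (V0' + V1') := by
      simp only [V0]; rw [hV, w0, w0]; ring
    have e1 : V1 = b * V * γ * δ * ((1 - U * T') * V0' + V1') := by
      simp only [V1]; rw [hV, w10, w11]; ring
    rw [e0, e1, eO]
    constructor
    · linear_combination (V * g * β + b * V * γ * δ) * h1 - b * V * γ * δ * U * h2 -
        V * β * O' * hag - b * V * γ * O' * hβ1
    · linear_combination (T * V * g * β) * h1

/-- The Pieri coefficients of horizontal strips are inverse to those of vertical strips. -/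
theorem sum_pieriWeight {t : K} (ht0 : t ≠ 0) (ht : ∀ k : ℕ, 0 < k → t ^ k ≠ 1) (b : B) {N : ℕ}
    (k : ℕ) (μ κ : ℕ → ℕ) (hμ : Antitone μ) (hκ : Antitone κ) (hμk : ∀ j, k ≤ j → μ j = 0)
    (hκk : ∀ j, k ≤ j → κ j = 0) (hμN : μ 0 + 1 < N) :
    ∑ l : Fin k → Fin N, ∏ i ∈ Finset.range k,
        pieriWeight t b (-b) μ κ i (ext l i) (ext l (i + 1)) =
      ∏ i ∈ Finset.range k, ((-(algebraMap K B t * b)) ^ (κ i - μ i) *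
        algebraMap K B (tbinom t (κ i) (μ i) (κ (i + 1)))) := by
  rw [sum_prod_eq_chain (by omega), sum_range_eq_add_succ hμN _
    (fun u h1 h2 => chain_pieriWeight_eq_zero t b (-b) μ κ (hμk k le_rfl) h1 h2)]
  exact (chain_pieri ht0 ht b k μ κ hμ hκ hμk hκk hμN).1

end Pieri

end Transfer

/-! ### Exchanging outer and inner horizontal strips against Kawanaka's coefficients -/

section Littlewood

variable {K : Type*} [Field K]

/-- The product of `1 - t ^ j` over odd `j ≤ m`. -/
def oddFact (t : K) (m : ℕ) : K := ∏ j ∈ Finset.Icc 1 m with j % 2 = 1, (1 - t ^ j)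

theorem oddFact_zero (t : K) : oddFact t 0 = 1 := by simp [oddFact]

theorem oddFact_succ (t : K) (m : ℕ) :
    oddFact t (m + 1) = if m % 2 = 0 then (1 - t ^ (m + 1)) * oddFact t m else oddFact t m := by
  have h : Finset.Icc 1 (m + 1) = insert (m + 1) (Finset.Icc 1 m) := by
    ext x; simp only [Finset.mem_Icc, Finset.mem_insert]; omega
  rw [oddFact, h, Finset.filter_insert]
  split_ifs with h1 h2 h2
  · rw [Finset.prod_insert (by simp)]; rfl
  · omega
  · omega
  · rfl

theorem oddFact_succ_of_even (t : K) {m : ℕ} (h : m % 2 = 0) :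
    oddFact t (m + 1) = (1 - t ^ (m + 1)) * oddFact t m := by
  rw [oddFact_succ, if_pos h]

theorem oddFact_succ_of_odd (t : K) {m : ℕ} (h : m % 2 = 1) :
    oddFact t (m + 1) = oddFact t m := by
  rw [oddFact_succ, if_neg (by omega)]

/-- Contribution of the rows of length `i + 1` to the coefficient of the Hall-Littlewood function in
Kawanaka's identity, `u` and `u'` being the lengths of the columns `i` and `i + 1`. -/
def rowWeight (t : K) (i u u' : ℕ) : K :=
  if i % 2 = 1 then t⁻¹ ^ u * oddFact t (u - u')
  else if (u - u') % 2 = 0 then oddFact t (u - u') else 0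

variable {B : Type*} [CommRing B] [Algebra K B]

/-- Column weights for the sum over diagrams `l` such that `l / μ` is a horizontal strip. -/
def outerWeight (t : K) (y : B) (s : ℕ) (μ : ℕ → ℕ) (i u u' : ℕ) : B :=
  algebraMap K B (rowWeight t (i + s) u u') *
    (algebraMap K B (psiW t u u' (μ i) (μ (i + 1))) * y ^ (u - μ i))

/-- Column weights for the sum over diagrams `r` such that `μ / r` is a horizontal strip. -/
def innerWeight (t : K) (y : B) (s : ℕ) (μ : ℕ → ℕ) (i u u' : ℕ) : B :=
  algebraMap K B (rowWeight t (i + s) u u') *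
    (algebraMap K B (phiW t (μ i) (μ (i + 1)) u u') * (algebraMap K B t⁻¹ * y) ^ (μ i - u))

theorem chain_outerWeight_eq_zero (t : K) (y : B) (s : ℕ) (μ : ℕ → ℕ) {N k : ℕ} (hk : μ k = 0)
    {u : ℕ} (h1 : u ≠ μ 0) (h2 : u ≠ μ 0 + 1) : chain N k (outerWeight t y s μ) u = 0 := by
  rcases k with _ | k
  · exact chain_zero_eq_zero (by omega)
  · exact chain_succ_eq_zero fun v => by rw [outerWeight, psiW_eq_zero t h1 h2]; simp

theorem chain_innerWeight_eq_zero (t : K) (y : B) (s : ℕ) (μ : ℕ → ℕ) {N k : ℕ} (hk : μ k = 0)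
    {u : ℕ} (h1 : u ≠ μ 0) (h2 : u + 1 ≠ μ 0) : chain N k (innerWeight t y s μ) u = 0 := by
  rcases k with _ | k
  · exact chain_zero_eq_zero (by omega)
  · exact chain_succ_eq_zero fun v => by rw [innerWeight, phiW_eq_zero t h1.symm h2.symm]; simp

theorem rowWeight_of_odd (t : K) {s : ℕ} (h : s % 2 = 1) (u u' : ℕ) :
    rowWeight t s u u' = t⁻¹ ^ u * oddFact t (u - u') := if_pos h

theorem rowWeight_of_even (t : K) {s : ℕ} (h : s % 2 = 0) {u u' : ℕ} (h' : (u - u') % 2 = 0) :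
    rowWeight t s u u' = oddFact t (u - u') := by
  rw [rowWeight, if_neg (by omega), if_pos h']

theorem rowWeight_of_even_of_odd (t : K) {s : ℕ} (h : s % 2 = 0) {u u' : ℕ}
    (h' : (u - u') % 2 = 1) : rowWeight t s u u' = 0 := by
  rw [rowWeight, if_neg (by omega), if_neg (by omega)]

/-- The deviations from the two proportionality relations, up to a power of an ideal containing
`y`. -/
theorem chain_outer_inner {t : K} (ht0 : t ≠ 0) (y : B) (J : Ideal B) (hy : y ∈ J) {N : ℕ} (k s : ℕ)
    (μ : ℕ → ℕ) (hμ : Antitone μ) (hμk : ∀ j, k ≤ j → μ j = 0) (hμN : μ 0 + 1 < N) :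
    let τ := algebraMap K B t⁻¹
    let L0 := chain N k (outerWeight t y s μ) (μ 0)
    let L1 := chain N k (outerWeight t y s μ) (μ 0 + 1)
    let R0 := chain N k (innerWeight t y s μ) (μ 0)
    let R1 := if 0 < μ 0 then chain N k (innerWeight t y s μ) (μ 0 - 1) else 0
    let p := 1 - τ * y ^ 2
    let r := 1 - algebraMap K B t
    ∃ δ0 δ1 : B, δ0 ∈ J ^ (k - ∑ j ∈ Finset.range k, μ j) ∧
      δ1 ∈ J ^ (k - ∑ j ∈ Finset.range k, μ j) ∧ (μ 0 = 0 → δ0 = 0) ∧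
      (s % 2 = 0 → p * L0 = p * R0 + r * R1 + δ0 ∧
        p * L1 = r * τ * y ^ 2 * R0 + p * algebraMap K B t * R1 + δ1) ∧
      (s % 2 = 1 → p * L0 = p * R0 + r * τ * y * R1 + δ0 ∧
        p * L1 = r * τ * y * R0 + p * R1 + δ1) := by
  intro τ L0 L1 R0 R1 p r
  have htτ : algebraMap K B t * τ = 1 := by
    rw [← map_mul, mul_inv_cancel₀ ht0, map_one]
  induction k generalizing s μ with
  | zero =>
    have h0 : μ 0 = 0 := hμk 0 le_rfl
    -- With no column left, L0 = R0 = 1 and L1 = R1 = 0, so the relation for L1 fails by its R0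
    -- term. This is the only source of error: l may not have columns beyond the last one allowed.
    refine ⟨0, if s % 2 = 0 then - (r * τ * y ^ 2) else - (r * τ * y), ?_, ?_, fun _ => rfl, ?_, ?_⟩
    · simp
    · simp
    · intro hs
      simp [L0, L1, R0, R1, chain, h0, hs]
    · intro hs
      simp [L0, L1, R0, R1, chain, h0, hs]
  | succ k ih =>
    obtain ⟨δ0, δ1, hδ0, hδ1, hδ, he, ho⟩ := ih (s + 1) (fun i => μ (i + 1))
      (fun i j h => hμ (by omega)) (fun j h => hμk _ (by omega))
      ((Nat.succ_le_succ (hμ (Nat.zero_le 1))).trans_lt hμN)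
    have hout : ∀ i, outerWeight t y s μ (i + 1) =
        outerWeight t y (s + 1) (fun i => μ (i + 1)) i := fun i => by
      funext u u'
      rw [outerWeight, outerWeight, add_right_comm, add_assoc]
    have hin : ∀ i, innerWeight t y s μ (i + 1) =
        innerWeight t y (s + 1) (fun i => μ (i + 1)) i := fun i => by
      funext u u'
      rw [innerWeight, innerWeight, add_right_comm, add_assoc]
    have hμ1 : μ 1 ≤ μ 0 := hμ (Nat.zero_le 1)
    have hL : ∀ u, chain N (k + 1) (outerWeight t y s μ) u = _ := fun u =>
      chain_succ_eq_add_succ u (m := μ 1) (by omega) (fun v h1 h2 => by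
        rw [funext hout]
        exact chain_outerWeight_eq_zero t y (s + 1) (fun i => μ (i + 1)) (hμk (k + 1) le_rfl) h1 h2)
    have hR : ∀ u, chain N (k + 1) (innerWeight t y s μ) u = _ := fun u =>
      chain_succ_eq_add_pred u (m := μ 1) (by omega) (fun v h1 h2 => by
        rw [funext hin]
        exact chain_innerWeight_eq_zero t y (s + 1) (fun i => μ (i + 1)) (hμk (k + 1) le_rfl) h1 h2)
    rw [funext hout] at hL
    rw [funext hin] at hR
    simp only [zero_add] at he ho
    set L0' := chain N k (outerWeight t y (s + 1) (fun i => μ (i + 1))) (μ 1)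
    set L1' := chain N k (outerWeight t y (s + 1) (fun i => μ (i + 1))) (μ 1 + 1)
    set R0' := chain N k (innerWeight t y (s + 1) (fun i => μ (i + 1))) (μ 1)
    set R1' := if 0 < μ 1 then
      chain N k (innerWeight t y (s + 1) (fun i => μ (i + 1))) (μ 1 - 1) else 0
    have hR1' : μ 1 = 0 → R1' = 0 := fun h => by simp [R1', h]
    obtain ⟨m, hm⟩ := Nat.exists_eq_add_of_le hμ1
    have hm' : μ 0 - μ 1 = m := by omega
    set c := algebraMap K B (oddFact t m) with hc
    set T := algebraMap K B (t ^ m) with hT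
    set h := algebraMap K B (t⁻¹ ^ μ 0) with hh
    have hwL : ∀ u u', outerWeight t y s μ 0 u u' = algebraMap K B (rowWeight t s u u') *
      (algebraMap K B (psiW t u u' (μ 0) (μ 1)) * y ^ (u - μ 0)) := fun u u' => by
        rw [outerWeight, zero_add, zero_add]
    have hwR : ∀ u u', innerWeight t y s μ 0 u u' = algebraMap K B (rowWeight t s u u') *
      (algebraMap K B (phiW t (μ 0) (μ 1) u u') * (τ * y) ^ (μ 0 - u)) := fun u u' => by
        rw [innerWeight, zero_add, zero_add]
    -- A longer first column of l carries a factor y, hence so does the new error in L1, and the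
    -- error in L0 is zero if μ_0 = 0. Thus the errors gain a factor y at each empty column of μ,
    -- and at least k - |μ| of its first k columns are empty.
    have hmain : ∃ D0 D1 : B, (D0 ∈ J ^ (k - ∑ j ∈ Finset.range k, μ (j + 1))) ∧
        (∃ D, D ∈ J ^ (k - ∑ j ∈ Finset.range k, μ (j + 1)) ∧ D1 = y * D) ∧ (μ 0 = 0 → D0 = 0) ∧
      (s % 2 = 0 → p * L0 = p * R0 + r * R1 + D0 ∧
        p * L1 = r * τ * y ^ 2 * R0 + p * algebraMap K B t * R1 + D1) ∧
      (s % 2 = 1 → p * L0 = p * R0 + r * τ * y * R1 + D0 ∧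
        p * L1 = r * τ * y * R0 + p * R1 + D1) := by
      set X := algebraMap K B ((1 - t ^ m) * oddFact t (m - 1)) with hX
      set Y := algebraMap K B (oddFact t (m + 1)) with hY
      have hT1 : algebraMap K B (1 - t ^ m) = 1 - T := by rw [map_sub, map_one]
      -- Here m is the multiplicity of the row length at hand. Going from m - 1 to m, or from m to m
      -- + 1, changes `oddFact` only if the new index is odd; the factor 1 - t^m in X comes from the
      -- strip coefficient, and also covers the truncated m - 1 at m = 0.
      have hXY : (m % 2 = 1 ∧ X = c ∧ Y = c) ∨
          (m % 2 = 0 ∧ X = (1 - T) * c ∧ Y = (1 - algebraMap K B t * T) * c) := by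
        rcases Nat.mod_two_eq_zero_or_one m with h | h
        · right
          refine ⟨h, ?_, ?_⟩
          · rcases m with _ | m
            · simp [hX, hT]
            · rw [hX, hc, Nat.add_sub_cancel, oddFact_succ_of_odd t (by omega), map_mul, hT1]
          · rw [hY, oddFact_succ_of_even t h, map_mul, map_sub, map_one, pow_succ', map_mul]
        · left
          refine ⟨h, ?_, ?_⟩
          · rcases m with _ | m
            · omega
            · rw [hX, hc, Nat.add_sub_cancel, oddFact_succ_of_even t (by omega)]
          · rw [hY, oddFact_succ_of_odd t h]
      have hX0 : μ 0 = 0 → X = 0 := fun h => by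
        have : m = 0 := by omega
        simp [hX, this]
      have o00 : outerWeight t y s μ 0 (μ 0) (μ 1) = algebraMap K B (rowWeight t s (μ 0) (μ 1)) := by
        rw [hwL, psiW_same]; simp
      have o01 : outerWeight t y s μ 0 (μ 0) (μ 1 + 1) =
          algebraMap K B ((1 - t ^ m) * rowWeight t s (μ 0) (μ 1 + 1)) := by
        rw [hwL, psiW_same_succ, hm', map_mul]; simp only [Nat.sub_self, pow_zero]; ring
      have o1 : ∀ v, outerWeight t y s μ 0 (μ 0 + 1) v =
          y * algebraMap K B (rowWeight t s (μ 0 + 1) v) := fun v => by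
        rw [hwL, psiW_succ, Nat.add_sub_cancel_left, pow_one, map_one]; ring
      have i0 : ∀ v, innerWeight t y s μ 0 (μ 0) v =
          algebraMap K B (rowWeight t s (μ 0) v) := fun v => by
        rw [hwR, phiW_same]; simp
      have i10 : 0 < μ 0 → innerWeight t y s μ 0 (μ 0 - 1) (μ 1) =
          τ * y * algebraMap K B ((1 - t ^ m) * rowWeight t s (μ 0 - 1) (μ 1)) := fun h => by
        obtain ⟨u, hu⟩ : ∃ u, μ 0 = u + 1 := ⟨μ 0 - 1, by omega⟩
        have e : u + 1 - μ 1 = m := by omega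
        rw [hwR, hu, Nat.add_sub_cancel, phiW_succ_same, e, Nat.add_sub_cancel_left, map_mul]
        ring
      have i11 : 0 < μ 1 → innerWeight t y s μ 0 (μ 0 - 1) (μ 1 - 1) =
          τ * y * algebraMap K B (rowWeight t s (μ 0 - 1) (μ 1 - 1)) := fun h => by
        obtain ⟨u, hu⟩ := Nat.exists_eq_add_of_le' (h.trans_le hμ1)
        obtain ⟨u', hu'⟩ := Nat.exists_eq_add_of_le' h
        rw [hwR, hu, hu', Nat.add_sub_cancel, Nat.add_sub_cancel, phiW_succ_succ,
          Nat.add_sub_cancel_left, map_one]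
        ring
      have eL0 : L0 = _ := hL (μ 0)
      have eL1 : L1 = _ := hL (μ 0 + 1)
      have eR0 : R0 = _ := hR (μ 0)
      rw [o00, o01] at eL0
      rw [o1, o1] at eL1
      rw [i0, i0] at eR0
      have n1 : μ 0 - (μ 1 + 1) = m - 1 := by omega
      have n2 : μ 0 + 1 - μ 1 = m + 1 := by omega
      have n3 : μ 0 + 1 - (μ 1 + 1) = m := by omega
      have n4 : 0 < μ 1 → μ 0 - (μ 1 - 1) = m + 1 := by omega
      have n5 : μ 0 - 1 - μ 1 = m - 1 := by omega
      have n6 : 0 < μ 1 → μ 0 - 1 - (μ 1 - 1) = m := by omega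
      -- Four cases. For s even the rows concerned have odd length and must have even multiplicity,
      -- so in each transition only one next state survives: m odd interchanges the two states, m
      -- even keeps them. For s odd all transitions occur, with the power of t⁻¹ that the column
      -- carries.
      rcases Nat.mod_two_eq_zero_or_one s with hs | hs
      · obtain ⟨h1, h2⟩ := ho (by omega)
        have q0 : ∀ x : ℕ, ¬ (0 < x) → x = 0 := fun x hx => by omega
        rcases hXY with ⟨hmo, hXc, hYc⟩ | ⟨hme, hXc, hYc⟩
        · have hμ0 : 0 < μ 0 := by omega
          have eR1 : R1 = τ * y * (c * R0') := by
            simp only [R1]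
            rw [if_pos hμ0, hR, i10 hμ0, rowWeight_of_even t hs (by rw [n5]; omega), n5, ← hX, hXc]
            by_cases h : 0 < μ 1
            · rw [i11 h, rowWeight_of_even_of_odd t hs (by rw [n6 h]; omega)]
              simp; ring
            · rw [hR1' (q0 _ h)]; ring
          rw [rowWeight_of_even_of_odd t hs (by omega),
            rowWeight_of_even t hs (by rw [n1]; omega), n1, ← hX, hXc] at eL0
          rw [rowWeight_of_even t hs (by rw [n2]; omega), n2, ← hY, hYc,
            rowWeight_of_even_of_odd t hs (by omega)] at eL1
          have eR0' : R0 = c * R1' := by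
            rw [eR0, rowWeight_of_even_of_odd t hs (by omega)]
            by_cases h : 0 < μ 1
            · rw [rowWeight_of_even t hs (by rw [n4 h]; omega), n4 h, ← hY, hYc]; simp
            · rw [hR1' (q0 _ h)]; simp
          rw [map_zero] at eL0 eL1
          refine ⟨c * δ1, y * (c * δ0), Ideal.mul_mem_left _ _ hδ1,
            ⟨c * δ0, Ideal.mul_mem_left _ _ hδ0, rfl⟩, fun h => absurd h hμ0.ne', fun _ => ?_,
            fun h => by omega⟩
          rw [eL0, eL1, eR0', eR1]
          constructor
          · linear_combination c * h2
          · linear_combination (y * c) * h1 - (p * c * R0' * y) * htτ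
        · have eR1 : R1 = τ * y * (c * R1') := by
            simp only [R1]
            by_cases hμ0 : 0 < μ 0
            · rw [if_pos hμ0, hR, i10 hμ0]
              have e1 : algebraMap K B ((1 - t ^ m) * rowWeight t s (μ 0 - 1) (μ 1)) = 0 := by
                rcases Nat.eq_zero_or_pos m with h | h
                · rw [h]; simp
                · rw [rowWeight_of_even_of_odd t hs (by rw [n5]; omega), mul_zero, map_zero]
              rw [e1]
              by_cases h : 0 < μ 1
              · rw [i11 h, rowWeight_of_even t hs (by rw [n6 h]; omega), n6 h]; ring
              · rw [hR1' (q0 _ h)]; ring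
            · rw [if_neg hμ0, hR1' (by omega)]; ring
          have e1 : algebraMap K B ((1 - t ^ m) * rowWeight t s (μ 0) (μ 1 + 1)) = 0 := by
            rcases Nat.eq_zero_or_pos m with h | h
            · rw [h]; simp
            · rw [rowWeight_of_even_of_odd t hs (by rw [n1]; omega), mul_zero, map_zero]
          rw [rowWeight_of_even t hs (by rw [hm']; omega), hm', e1] at eL0
          rw [rowWeight_of_even_of_odd t hs (by rw [n2]; omega),
            rowWeight_of_even t hs (by rw [n3]; omega), n3] at eL1
          have eR0' : R0 = c * R0' := by
            rw [eR0, rowWeight_of_even t hs (by rw [hm']; omega), hm']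
            by_cases h : 0 < μ 1
            · rw [rowWeight_of_even_of_odd t hs (by rw [n4 h]; omega)]; simp [hc]
            · rw [hR1' (q0 _ h)]; simp [hc]
          rw [map_zero] at eL1
          refine ⟨c * δ0, y * (c * δ1), Ideal.mul_mem_left _ _ hδ0,
            ⟨c * δ1, Ideal.mul_mem_left _ _ hδ1, rfl⟩, fun h => ?_, fun _ => ?_,
            fun h => by omega⟩
          · rw [hδ (show μ 1 = 0 by omega), mul_zero]
          rw [eL0, eL1, eR0', eR1]
          constructor
          · linear_combination c * h1
          · linear_combination (y * c) * h2 - (p * c * R1' * y) * htτ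
      · obtain ⟨h1, h2⟩ := he (by omega)
        have hodd := rowWeight_of_odd t hs
        have g0 : ∀ f : K, algebraMap K B (t⁻¹ ^ μ 0 * f) = h * algebraMap K B f := fun f => by
          rw [map_mul]
        have g1 : ∀ f : K, algebraMap K B (t⁻¹ ^ (μ 0 + 1) * f) = τ * h * algebraMap K B f :=
          fun f => by rw [map_mul, pow_succ', map_mul]
        have g2 : 0 < μ 0 → ∀ f : K, τ * algebraMap K B (t⁻¹ ^ (μ 0 - 1) * f) =
            h * algebraMap K B f := fun hμ0 f => by
          obtain ⟨u, hu⟩ := Nat.exists_eq_add_of_le' hμ0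
          rw [hh, hu, Nat.add_sub_cancel, map_mul, ← mul_assoc, ← map_mul, ← pow_succ']
        have q0 : ∀ x : ℕ, ¬ (0 < x) → x = 0 := fun x hx => by omega
        rw [hodd, hodd, hm', n1, g0, mul_left_comm, g0, ← hX] at eL0
        rw [hodd, hodd, n2, n3, g1, g1, ← hY] at eL1
        have eR0' : R0 = h * (c * R0' + Y * R1') := by
          rw [eR0, hodd, hodd, hm', g0, g0]
          by_cases h : 0 < μ 1
          · rw [n4 h]; ring
          · rw [hR1' (q0 _ h)]; ring
        have eR1 : R1 = h * y * (X * R0' + c * R1') := by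
          simp only [R1]
          by_cases hμ0 : 0 < μ 0
          · have e1 := g2 hμ0 ((1 - t ^ m) * oddFact t (m - 1))
            have e2 := g2 hμ0 (oddFact t m)
            rw [if_pos hμ0, hR, i10 hμ0, hodd, n5, mul_left_comm (1 - t ^ m)]
            by_cases h' : 0 < μ 1
            · rw [i11 h', hodd, n6 h']
              linear_combination (y * R0') * e1 + (y * R1') * e2
            · rw [hR1' (q0 _ h')]
              linear_combination (y * R0') * e1
          · rw [if_neg hμ0, hR1' (by omega), hX0 (by omega)]; ring
        have hp : p + r * τ * y ^ 2 = r + p * algebraMap K B t := by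
          simp only [p, r]
          ring
        rcases hXY with ⟨hmo, hXc, hYc⟩ | ⟨hme, hXc, hYc⟩
        · refine ⟨h * c * (δ0 + δ1), y * (h * c * τ * (δ0 + δ1)),
            Ideal.mul_mem_left _ _ (Ideal.add_mem _ hδ0 hδ1),
            ⟨_, Ideal.mul_mem_left _ _ (Ideal.add_mem _ hδ0 hδ1), rfl⟩, fun h => by omega,
            fun h => by omega, fun _ => ?_⟩
          rw [eL0, eL1, eR0', eR1, hXc, hYc]
          constructor
          · linear_combination (h * c) * (h1 + h2) - h * c * R1' * hp
          · linear_combination (y * τ * h * c) * (h1 + h2) +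
              y * h * c * ((τ * hp + p * htτ) * R0' + p * htτ * R1')
        · refine ⟨h * c * (δ0 + (1 - T) * δ1),
            y * (h * c * τ * ((1 - algebraMap K B t * T) * δ0 + δ1)),
            Ideal.mul_mem_left _ _ (Ideal.add_mem _ hδ0 (Ideal.mul_mem_left _ _ hδ1)),
            ⟨_, Ideal.mul_mem_left _ _ (Ideal.add_mem _ (Ideal.mul_mem_left _ _ hδ0) hδ1), rfl⟩,
            fun h => ?_, fun h => by omega, fun _ => ?_⟩
          · have hm0 : m = 0 := by omega
            rw [hδ (show μ 1 = 0 by omega), hT, hm0]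
            simp
          rw [eL0, eL1, eR0', eR1, hXc, hYc]
          constructor
          · linear_combination (h * c) * (h1 + (1 - T) * h2) - h * c * R1' * hp
          · linear_combination (y * τ * h * c) * ((1 - algebraMap K B t * T) * h1 + h2) +
              y * h * c * ((τ * hp + p * htτ - p * T * htτ) * R0' + p * htτ * R1')
    obtain ⟨D0, D1, hD0, ⟨D, hD, rfl⟩, hD0', h1, h2⟩ := hmain
    have hsum : ∑ j ∈ Finset.range (k + 1), μ j = ∑ j ∈ Finset.range k, μ (j + 1) + μ 0 :=
      Finset.sum_range_succ' _ _
    refine ⟨D0, y * D, ?_, ?_, hD0', h1, h2⟩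
    -- A nonempty first column lowers the required exponent enough for the old bound to suffice; an
    -- empty one has no error in L0.
    · rcases Nat.eq_zero_or_pos (μ 0) with h | h
      · rw [hD0' h]; exact Ideal.zero_mem _
      · exact Ideal.pow_le_pow_right (by omega) hD0
    · refine Ideal.pow_le_pow_right (n := k - ∑ j ∈ Finset.range k, μ (j + 1) + 1) (by omega) ?_
      rw [pow_succ']
      exact Ideal.mul_mem_mul hy hD

/-- Summing the horizontal strips on top of `μ` against the horizontal strips inside `μ`, up to a
power of an ideal containing `y`. -/
theorem sum_outer_inner {t : K} (ht0 : t ≠ 0) (y : B) (J : Ideal B) (hy : y ∈ J) {N : ℕ} (k : ℕ)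
    (μ : ℕ → ℕ) (hμ : Antitone μ) (hμk : ∀ j, k ≤ j → μ j = 0) (hμN : μ 0 + 1 < N) :
    (1 - algebraMap K B t⁻¹ * y ^ 2) * (∑ l : Fin k → Fin N, ∏ i ∈ Finset.range k,
        outerWeight t y 0 μ i (ext l i) (ext l (i + 1))) -
      (1 - y ^ 2) * (∑ l : Fin k → Fin N, ∏ i ∈ Finset.range k,
        innerWeight t y 0 μ i (ext l i) (ext l (i + 1))) ∈
      J ^ (k - ∑ j ∈ Finset.range k, μ j) := by
  obtain ⟨δ0, δ1, h0, h1, -, he, -⟩ := chain_outer_inner ht0 y J hy k 0 μ hμ hμk hμN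
  obtain ⟨e0, e1⟩ := he rfl
  have htτ : algebraMap K B t * algebraMap K B t⁻¹ = 1 := by
    rw [← map_mul, mul_inv_cancel₀ ht0, map_one]
  rw [sum_prod_eq_chain (by omega), sum_prod_eq_chain (by omega),
    sum_range_eq_add_succ hμN (chain N k (outerWeight t y 0 μ)) fun u hu hu' =>
      chain_outerWeight_eq_zero t y 0 μ (hμk k le_rfl) hu hu',
    sum_range_eq_add_pred (m := μ 0) (by omega) (chain N k (innerWeight t y 0 μ)) fun u hu hu' =>
      chain_innerWeight_eq_zero t y 0 μ (hμk k le_rfl) hu hu']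
  convert Ideal.add_mem _ h0 h1 using 1
  set R1 := if 0 < μ 0 then chain N k (innerWeight t y 0 μ) (μ 0 - 1) else 0
  -- Adding the two relations for s = 0, both R0 and R1 receive the coefficient 1 - y²: p + (1 - t)
  -- τ y² = 1 - y² = (1 - t) + p t, with p = 1 - τ y² and τ = 1/t.
  linear_combination e0 + e1 - y ^ 2 * chain N k (innerWeight t y 0 μ) (μ 0) * htτ - y ^ 2 * R1 * htτ

end Littlewood

/-! ### Comparison with the Hall-Littlewood polynomials of Young diagrams -/

section Diagrams

variable {K : Type*} [Field K]

theorem rowFn_colLen (μ : YoungDiagram) {k : ℕ} (hk : μ.rowLen 0 ≤ k) :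
    rowFn k μ.colLen = μ.rowLen := by
  funext x
  have hx : μ.rowLen x ≤ k := (μ.rowLen_anti 0 x (Nat.zero_le x)).trans hk
  rw [rowFn, ← Finset.card_filter]
  have : (Finset.range k).filter (fun j => x < μ.colLen j) = Finset.range (μ.rowLen x) := by
    ext j
    rw [Finset.mem_filter, Finset.mem_range, Finset.mem_range, ← μ.mem_iff_lt_colLen,
      ← μ.mem_iff_lt_rowLen, μ.mem_iff_lt_rowLen]
    omega
  rw [this, Finset.card_range]

theorem colLen_eq_zero {μ : YoungDiagram} {j : ℕ} (hj : μ.rowLen 0 ≤ j) : μ.colLen j = 0 := by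
  have h1 := μ.mem_iff_lt_rowLen (i := 0) (j := j)
  have h2 := μ.mem_iff_lt_colLen (i := 0) (j := j)
  rw [h1] at h2
  omega

theorem paddedMult_add_one {n : ℕ} {μ : YoungDiagram} (hn : μ.colLen 0 ≤ n) (i : ℕ) :
    paddedMult n μ (i + 1) = μ.colLen i - μ.colLen (i + 1) := by
  have h1 : ∀ x j, j < μ.rowLen x ↔ x < μ.colLen j := fun x j => by
    rw [← μ.mem_iff_lt_colLen, ← μ.mem_iff_lt_rowLen]
  have h2 : μ.colLen i ≤ n := (μ.colLen_anti 0 i (Nat.zero_le i)).trans hn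
  have h3 : μ.colLen (i + 1) ≤ μ.colLen i := μ.colLen_anti i (i + 1) (Nat.le_succ i)
  have h4 : (Finset.univ.filter fun k : Fin n => μ.rowLen k = i + 1) =
      (Finset.univ.filter fun k : Fin n => (k : ℕ) < μ.colLen i) \
        (Finset.univ.filter fun k : Fin n => (k : ℕ) < μ.colLen (i + 1)) := by
    ext x
    have := h1 x i
    have := h1 x (i + 1)
    simp only [Finset.mem_filter, Finset.mem_sdiff, Finset.mem_univ, true_and]
    omega
  rw [paddedMult, h4, Finset.card_sdiff_of_subset, Fin.card_filter_val_lt, Fin.card_filter_val_lt,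
    min_eq_right h2, min_eq_right (h3.trans h2)]
  intro x
  simp only [Finset.mem_filter, Finset.mem_univ, true_and]
  omega

/-- The multiplicities, zero parts included, add up to n, so the denominators 1 - t number exactly
n. -/
theorem vFactor_mul_pow {t : K} (ht : ∀ k : ℕ, 0 < k → t ^ k ≠ 1) {n k : ℕ} {μ : YoungDiagram}
    (hn : μ.colLen 0 ≤ n) (hk : μ.rowLen 0 ≤ k) :
    vFactor t n μ * (1 - t) ^ n = colNorm t n k μ.colLen := by
  have h1 : 1 - t ≠ 0 := sub_ne_zero.mpr (by simpa using (ht 1 one_pos).symm)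
  have h2 : vFactor t n μ = ∏ i ∈ Finset.range (k + 1),
      ∏ j ∈ Finset.Icc 1 (paddedMult n μ i), (1 - t ^ j) / (1 - t) := by
    refine Finset.prod_subset (Finset.range_mono (by omega)) fun i _ hi => ?_
    obtain ⟨i, rfl⟩ : ∃ i', i = i' + 1 := ⟨i - 1, by rw [Finset.mem_range] at hi; omega⟩
    rw [Finset.mem_range] at hi
    rw [paddedMult_add_one hn, colLen_eq_zero (show μ.rowLen 0 ≤ i by omega)]
    simp
  have h3 : ∀ m : ℕ, ∏ j ∈ Finset.Icc 1 m, (1 - t ^ j) / (1 - t) = tfact t m / (1 - t) ^ m := by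
    intro m
    rw [Finset.prod_div_distrib, Finset.prod_const, Nat.card_Icc, Nat.add_sub_cancel]
    rfl
  have h4 : ∑ i ∈ Finset.range k, (μ.colLen i - μ.colLen (i + 1)) = μ.colLen 0 := by
    have : ∀ m, ∑ i ∈ Finset.range m, (μ.colLen i - μ.colLen (i + 1)) + μ.colLen m =
        μ.colLen 0 := by
      intro m
      induction m with
      | zero => simp
      | succ m ih =>
        rw [Finset.sum_range_succ]
        have := μ.colLen_anti m (m + 1) (Nat.le_succ m)
        omega
    simpa [colLen_eq_zero hk] using this k
  rw [h2, Finset.prod_range_succ']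
  simp only [h3, paddedMult_add_one hn, paddedMult_zero]
  rw [Finset.prod_div_distrib, Finset.prod_pow_eq_pow_sum, h4, colNorm]
  have h5 : (1 - t) ^ n = (1 - t) ^ μ.colLen 0 * (1 - t) ^ (n - μ.colLen 0) := by
    rw [← pow_add]; congr 1; omega
  rw [h5]
  field_simp

theorem hlPoly_eq_hlCol {t : K} (ht : ∀ k : ℕ, 0 < k → t ^ k ≠ 1) {n k : ℕ} {μ : YoungDiagram}
    (hn : μ.colLen 0 ≤ n) (hk : μ.rowLen 0 ≤ k) : hlPoly t μ n = hlCol t n k μ.colLen := by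
  have h0 : MvPolynomial.C (vFactor t n μ) * pairProd 1 MvPolynomial.X ≠
      (0 : MvPolynomial (Fin n) K) :=
    mul_ne_zero (by rw [Ne, MvPolynomial.C_eq_zero]; exact vFactor_ne_zero t ht _ μ)
      (pairProd_one_ne_zero n)
  refine mul_right_cancel₀ h0 ?_
  rw [hlPoly_mul t ht, hlCol_of_pos t (fun i j h => μ.colLen_anti i j h) hn, rowFn_colLen μ hk,
    ← vFactor_mul_pow ht hn hk, ← pairProd_mul_hlSym]
  have h1 : 1 - t ≠ 0 := sub_ne_zero.mpr (by simpa using (ht 1 one_pos).symm)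
  have h2 : (1 - t) ^ n * (vFactor t n μ * (1 - t) ^ n)⁻¹ * vFactor t n μ = 1 := by
    have := vFactor_ne_zero t ht n μ
    field_simp
  have h3 := congrArg (MvPolynomial.C (σ := Fin n)) h2
  rw [map_mul, map_one] at h3
  linear_combination (-(pairProd 1 MvPolynomial.X * hlSym t μ.rowLen n)) * h3

/-- By homogeneity it is a constant, and setting the last variable to zero reduces that constant to
the case of no variables. No separate evaluation of the symmetrized sum is needed. -/
theorem hlPoly_bot {t : K} (ht : ∀ k : ℕ, 0 < k → t ^ k ≠ 1) (n : ℕ) : hlPoly t ⊥ n = 1 := by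
  have hc : ∀ j, (⊥ : YoungDiagram).colLen j = 0 := fun j => by
    have := (⊥ : YoungDiagram).mem_iff_lt_colLen (i := 0) (j := j)
    simp only [YoungDiagram.notMem_bot, false_iff] at this
    omega
  have hr : (⊥ : YoungDiagram).rowLen 0 = 0 := by
    rw [rowLen_eq_zero_iff, hc]
  have hh : ∀ n, ∃ c : K, hlPoly t ⊥ n = MvPolynomial.C c := fun n => by
    have := isHomogeneous_hlCol t n 0 (⊥ : YoungDiagram).colLen
    rw [← hlPoly_eq_hlCol ht (by rw [hc]; exact Nat.zero_le n) hr.le, Finset.range_zero,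
      Finset.sum_empty] at this
    exact ⟨_, MvPolynomial.totalDegree_eq_zero_iff_eq_C.mp (Nat.le_zero.mp this.totalDegree_le)⟩
  induction n with
  | zero =>
    have := hlPoly_mul t ht ⊥ 0
    simpa [hlNum, pairProd, vFactor, hr, paddedMult] using this
  | succ n ih =>
    obtain ⟨c, hc'⟩ := hh (n + 1)
    have := killLast_hlPoly t ht ⊥ n (by rw [hc]; exact Nat.zero_le n)
    rw [ih, hc'] at this
    rw [hc']
    have h2 : killLast K n (MvPolynomial.C c) = MvPolynomial.C c := by
      simp [killLast, MvPolynomial.algebraMap_eq]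
    rw [h2, ← MvPolynomial.C_1] at this
    rw [MvPolynomial.C_injective _ _ this, MvPolynomial.C_1]

theorem hlCol_zero {t : K} (ht : ∀ k : ℕ, 0 < k → t ^ k ≠ 1) (n k : ℕ) {c : ℕ → ℕ}
    (hc : ∀ j, c j = 0) : hlCol t n k c = 1 := by
  have h : ∀ j, (⊥ : YoungDiagram).colLen j = 0 := fun j => by
    have := (⊥ : YoungDiagram).mem_iff_lt_colLen (i := 0) (j := j)
    simp only [YoungDiagram.notMem_bot, false_iff] at this
    omega
  have hr : (⊥ : YoungDiagram).rowLen 0 = 0 := (rowLen_eq_zero_iff _ _).mpr (by rw [h])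
  have e : c = (⊥ : YoungDiagram).colLen := funext fun j => by rw [hc, h]
  rw [e, ← hlPoly_eq_hlCol ht (by rw [h]; exact Nat.zero_le n) (by rw [hr]; exact Nat.zero_le k),
    hlPoly_bot ht]

end Diagrams

/-! ### The branching rule -/

section Branching

variable {K : Type*} [Field K]

/-- The expansion of a Hall-Littlewood polynomial in powers of the last variable. -/
noncomputable def branchSum (t : K) (n N k : ℕ) (l : ℕ → ℕ) : MvPolynomial (Fin (n + 1)) K :=
  ∑ m : Fin k → Fin N, (∏ i ∈ Finset.range k,
    (algebraMap K (MvPolynomial (Fin (n + 1)) K)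
      (psiW t (l i) (l (i + 1)) (ext m i) (ext m (i + 1))) *
        MvPolynomial.X (Fin.last n) ^ (l i - ext m i))) *
    MvPolynomial.rename Fin.castSucc (hlCol t n k (ext m))

/-- Given branching for μ, E(a) P_μ(x, y) has two expansions: Pieri in n + 1 variables, or branching
followed by Pieri in n variables and the factor 1 + a y. `sum_upWeight` turns the second into Pieri
coefficients times branching sums. The indeterminate X in place of a separates the vertical strips
by size. -/
theorem sum_pieri_branch {t : K} (ht0 : t ≠ 0) (ht : ∀ k : ℕ, 0 < k → t ^ k ≠ 1) {n N k : ℕ}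
    (hN : n + 1 < N) (μ : ℕ → ℕ) (hμ : Antitone μ) (hμk : ∀ j, k ≤ j → μ j = 0) (hμN : μ 0 < N)
    (hb : hlCol t (n + 1) k μ = branchSum t n N k μ) :
    ∑ l : Fin (k + 1) → Fin N,
      (Polynomial.X : Polynomial (MvPolynomial (Fin (n + 1)) K)) ^
        (∑ j ∈ Finset.range (k + 1), (ext l j - μ j)) *
        Polynomial.C (MvPolynomial.C (∏ j ∈ Finset.range (k + 1),
          tbinom t (ext l j) (μ j) (ext l (j + 1))) *
          (hlCol t (n + 1) (k + 1) (ext l) - branchSum t n N (k + 1) (ext l))) = 0 := by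
  set y : MvPolynomial (Fin (n + 1)) K := MvPolynomial.X (Fin.last n) with hy
  set ι : MvPolynomial (Fin n) K →+* Polynomial (MvPolynomial (Fin (n + 1)) K) :=
    Polynomial.C.comp (MvPolynomial.rename Fin.castSucc).toRingHom with hι
  have hιa : ∀ p, ι p = Polynomial.C (MvPolynomial.rename Fin.castSucc p) := fun p => rfl
  have halg : ∀ c : K, algebraMap K (Polynomial (MvPolynomial (Fin (n + 1)) K)) c =
    Polynomial.C (MvPolynomial.C c) := fun c => rfl
  have halg' : ∀ c : K, algebraMap K (MvPolynomial (Fin (n + 1)) K) c = MvPolynomial.C c :=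
    fun c => rfl
  have hιC : ∀ c : K, ι (MvPolynomial.C c) = Polynomial.C (MvPolynomial.C c) := fun c => by
    rw [hιa, MvPolynomial.rename_C]
  have e1 := prod_one_add_mul_hlCol ht hN μ hμk
    (Polynomial.C : MvPolynomial (Fin (n + 1)) K →+* _) Polynomial.X
  have e2 : ∏ i : Fin (n + 1), (1 + Polynomial.X * Polynomial.C (MvPolynomial.X i)) =
      (1 + Polynomial.X * Polynomial.C y) *
      ∏ i : Fin n, (1 + Polynomial.X * ι (MvPolynomial.X i)) := by
    rw [Fin.prod_univ_castSucc, mul_comm]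
    simp only [hιa, MvPolynomial.rename_X, hy]
  have e3 : ∀ ν : Fin (k + 1) → Fin N,
      (∑ l : Fin (k + 1) → Fin N, ∏ i ∈ Finset.range (k + 1),
        upWeight t (Polynomial.X : Polynomial (MvPolynomial (Fin (n + 1)) K)) (Polynomial.C y) μ
          (ext ν) i (ext l i) (ext l (i + 1))) * ι (hlCol t n (k + 1) (ext ν)) =
      (1 + Polynomial.X * Polynomial.C y) * ((∑ r : Fin k → Fin N, ∏ i ∈ Finset.range k,
        downWeight t Polynomial.X (Polynomial.C y) μ (ext ν) i (ext r i) (ext r (i + 1))) *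
          Polynomial.X ^ ext ν k) * ι (hlCol t n (k + 1) (ext ν)) := by
    intro ν
    by_cases hν : Antitone (ext ν) ∧ ext ν 0 ≤ n
    · rw [sum_upWeight ht0 ht _ _ k μ (ext ν) hμ hν.1 hμk (fun j hj => ext_of_le ν hj) hμN
        (by omega)]
    · rw [hlCol_of_neg t hν, map_zero, mul_zero, mul_zero]
  have e4 : ∑ ν : Fin (k + 1) → Fin N, (1 + Polynomial.X * Polynomial.C y) *
      ((∑ r : Fin k → Fin N, ∏ i ∈ Finset.range k,
        downWeight t Polynomial.X (Polynomial.C y) μ (ext ν) i (ext r i) (ext r (i + 1))) *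
          Polynomial.X ^ ext ν k) * ι (hlCol t n (k + 1) (ext ν)) =
      (∏ i : Fin (n + 1), (1 + Polynomial.X * Polynomial.C (MvPolynomial.X i))) *
        Polynomial.C (hlCol t (n + 1) k μ) := by
    rw [hb, e2, branchSum, ← hy, map_sum, mul_assoc, Finset.mul_sum]
    have : ∀ r : Fin k → Fin N, (∏ i : Fin n, (1 + Polynomial.X * ι (MvPolynomial.X i))) *
        Polynomial.C ((∏ i ∈ Finset.range k,
          (algebraMap K (MvPolynomial (Fin (n + 1)) K)
            (psiW t (μ i) (μ (i + 1)) (ext r i) (ext r (i + 1))) * y ^ (μ i - ext r i))) *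
          MvPolynomial.rename Fin.castSucc (hlCol t n k (ext r))) =
        ∑ ν : Fin (k + 1) → Fin N, (∏ i ∈ Finset.range k,
          downWeight t Polynomial.X (Polynomial.C y) μ (ext ν) i (ext r i) (ext r (i + 1))) *
          Polynomial.X ^ ext ν k * ι (hlCol t n (k + 1) (ext ν)) := by
      intro r
      rw [map_mul, ← hιa, mul_left_comm, prod_one_add_mul_hlCol ht (Nat.lt_of_succ_lt hN) (ext r)
        (fun j hj => ext_of_le r hj) ι Polynomial.X, Finset.mul_sum]
      refine Finset.sum_congr rfl fun ν _ => ?_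
      rw [hιC, Finset.prod_range_succ _ k, Finset.prod_range_succ _ k, ext_of_le r (le_refl k),
        ext_of_le ν (le_refl (k + 1)), tbinom_right ht (Nat.zero_le _), Nat.sub_zero, mul_one]
      simp only [downWeight, halg, halg', Finset.prod_mul_distrib, map_mul, map_prod, map_pow]
      ring
    rw [Finset.sum_congr rfl fun r _ => this r, Finset.sum_comm, Finset.mul_sum]
    refine Finset.sum_congr rfl fun ν _ => ?_
    rw [mul_assoc, ← Finset.sum_mul, ← Finset.sum_mul]
  rw [← Finset.sum_congr rfl fun ν _ => e3 ν] at e4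
  rw [e1] at e4
  simp only [mul_sub, map_sub, Finset.sum_sub_distrib]
  rw [sub_eq_zero]
  have e5 : ∀ l : Fin (k + 1) → Fin N,
      (Polynomial.X : Polynomial (MvPolynomial (Fin (n + 1)) K)) ^
        (∑ j ∈ Finset.range (k + 1), (ext l j - μ j)) *
        Polynomial.C (MvPolynomial.C (∏ j ∈ Finset.range (k + 1),
          tbinom t (ext l j) (μ j) (ext l (j + 1))) * branchSum t n N (k + 1) (ext l)) =
      ∑ ν : Fin (k + 1) → Fin N, (∏ i ∈ Finset.range (k + 1),
        upWeight t (Polynomial.X : Polynomial (MvPolynomial (Fin (n + 1)) K)) (Polynomial.C y) μ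
          (ext ν) i (ext l i) (ext l (i + 1))) * ι (hlCol t n (k + 1) (ext ν)) := by
    intro l
    rw [branchSum, Finset.mul_sum, map_sum, Finset.mul_sum]
    refine Finset.sum_congr rfl fun ν _ => ?_
    simp only [upWeight, halg, halg', Finset.prod_mul_distrib, map_mul, map_prod, map_pow, hιa,
      Finset.prod_pow_eq_pow_sum]
    ring
  rw [Finset.sum_congr rfl fun l _ => e5 l, Finset.sum_comm]
  simp only [Finset.sum_mul] at e4
  rw [e4]
  refine Finset.sum_congr rfl fun l _ => ?_
  rw [Finset.prod_pow_eq_pow_sum, map_mul, mul_assoc]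

/-- Induction on the number of columns, then on the length r of the last one. Let μ be l without its
last column. In degree r of `sum_pieri_branch`, l occurs with coefficient 1, and every other
contributing diagram has a shorter last column, so its term vanishes by induction. -/
theorem hlCol_eq_branchSum {t : K} (ht0 : t ≠ 0) (ht : ∀ k : ℕ, 0 < k → t ^ k ≠ 1) {n N : ℕ}
    (hN : n + 1 < N) (k : ℕ) (l : Fin k → Fin N) :
    hlCol t (n + 1) k (ext l) = branchSum t n N k (ext l) := by
  induction k with
  | zero =>
    rw [hlCol_zero ht _ _ fun j => ext_of_le l (Nat.zero_le j), branchSum]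
    simp only [Finset.univ_unique, Finset.sum_singleton, Finset.range_zero, Finset.prod_empty,
      one_mul]
    rw [hlCol_zero ht _ _ fun j => ext_of_le _ (Nat.zero_le j), map_one]
  | succ k ih =>
    obtain ⟨r, hr⟩ : ∃ r, ext l k = r := ⟨_, rfl⟩
    induction r using Nat.strong_induction_on generalizing l with
    | _ r ihr =>
    by_cases hl : Antitone (ext l)
    swap
    · rw [hlCol_of_neg t fun h => hl h.1, branchSum, Finset.sum_eq_zero]
      intro m _
      by_cases hm : Antitone (ext m)
      swap
      · rw [hlCol_of_neg t fun h => hm h.1, map_zero, mul_zero]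
      obtain ⟨i, hi⟩ : ∃ i, ext l i < ext l (i + 1) := by
        by_contra! h
        exact hl (antitone_nat_of_succ_le h)
      have hik : i + 1 < k + 1 := by
        by_contra h
        rw [ext_of_le l (show k + 1 ≤ i + 1 by omega)] at hi
        omega
      have hmi : ext m (i + 1) ≤ ext m i := hm (Nat.le_succ i)
      -- An ascent of l over a diagram m is possible within the strip condition only if m_i =
      -- m_{i+1}, l_i = m_i and l_{i+1} = m_{i+1} + 1; then the coefficient contains 1 - t^0.
      have h0 : psiW t (ext l i) (ext l (i + 1)) (ext m i) (ext m (i + 1)) = 0 ∨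
          psiW t (ext l (i + 1)) (ext l (i + 1 + 1)) (ext m (i + 1)) (ext m (i + 1 + 1)) = 0 := by
        by_cases h1 : ext l i = ext m i ∨ ext l i = ext m i + 1
        swap
        · exact Or.inl (if_neg h1)
        by_cases h2 : ext l (i + 1) = ext m (i + 1) ∨ ext l (i + 1) = ext m (i + 1) + 1
        swap
        · exact Or.inr (if_neg h2)
        left
        have h3 : ext l i = ext m i ∧ ext l (i + 1) = ext m (i + 1) + 1 := by omega
        rw [psiW, if_pos h1, if_pos h3, show ext m i - ext m (i + 1) = 0 by omega, pow_zero,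
          sub_self]
      rcases h0 with h0 | h0
      · rw [Finset.prod_eq_zero (Finset.mem_range.mpr (Nat.lt_of_succ_lt hik)), zero_mul]
        rw [h0, map_zero, zero_mul]
      · rw [Finset.prod_eq_zero (Finset.mem_range.mpr hik), zero_mul]
        rw [h0, map_zero, zero_mul]
    have hμe : ∀ j, ext (Fin.init l : Fin k → Fin N) j = if j < k then ext l j else 0 := fun j => by
      split_ifs with h
      · rw [ext_of_lt _ h, ext_of_lt _ (by omega)]
        rfl
      · rw [ext_of_le _ (by omega)]
    set μ := ext (Fin.init l : Fin k → Fin N) with hμ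
    have hμa : Antitone μ := antitone_nat_of_succ_le fun j => by
      rw [hμe, hμe]
      have := hl (Nat.le_succ j)
      split_ifs <;> omega
    have key := sum_pieri_branch ht0 ht hN μ hμa (fun j hj => ext_of_le _ hj)
      (ext_lt _ (by omega) 0) (ih (Fin.init l))
    have key' := congrArg (fun p => Polynomial.coeff p r) key
    simp only [Polynomial.finsetSum_coeff, Polynomial.coeff_X_pow_mul', Polynomial.coeff_C,
      Polynomial.coeff_zero] at key'
    have hlr : ∑ j ∈ Finset.range (k + 1), (ext l j - μ j) = r := by
      rw [Finset.sum_range_succ, Finset.sum_eq_zero, hμe k, if_neg (lt_irrefl k), hr]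
      · omega
      · intro j hj
        rw [hμe, if_pos (Finset.mem_range.mp hj), Nat.sub_self]
    rw [Finset.sum_eq_single_of_mem l (Finset.mem_univ l)] at key'
    · rw [hlr, if_pos le_rfl, if_pos (Nat.sub_self r)] at key'
      have h1 : ∏ j ∈ Finset.range (k + 1), tbinom t (ext l j) (μ j) (ext l (j + 1)) = 1 := by
        refine Finset.prod_eq_one fun j hj => ?_
        rw [hμe]
        split_ifs with h
        · exact tbinom_self ht (hl (Nat.le_succ j))
        · rw [ext_of_le l (show k + 1 ≤ j + 1 by rw [Finset.mem_range] at hj; omega)]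
          exact tbinom_right ht (Nat.zero_le _)
      rw [h1, map_one, one_mul, sub_eq_zero] at key'
      exact key'
    · intro l' _ hne
      split_ifs with h1 h2
      · by_cases h3 : ∀ j, j < k + 1 → (ext l' (j + 1) ≤ μ j ∧ μ j ≤ ext l' j)
        swap
        · push Not at h3
          obtain ⟨j, hj, h3⟩ := h3
          rw [prod_tbinom_eq_zero t hj (fun h => (h3 h.1).not_ge h.2), map_zero, zero_mul]
        have h4 : ∑ j ∈ Finset.range (k + 1), (ext l' j - μ j) = r := by omega
        -- The strip has r cells. If the last column took all of them, the others would agree with μ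
        -- and l' would be l.
        have h5 : ext l' k < r := by
          rw [Finset.sum_range_succ, hμe k, if_neg (lt_irrefl k), Nat.sub_zero] at h4
          by_contra h
          have h6 : ∑ j ∈ Finset.range k, (ext l' j - μ j) = 0 := by omega
          rw [Finset.sum_eq_zero_iff] at h6
          refine hne (funext fun ⟨j, hj⟩ => Fin.ext ?_)
          rw [← ext_of_lt l' hj, ← ext_of_lt l hj]
          rcases Nat.lt_succ_iff_lt_or_eq.mp hj with h7 | h7
          · have h8 := h6 j (Finset.mem_range.mpr h7)
            have h9 := h3 j hj
            have h10 := hμe j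
            rw [if_pos h7] at h10
            omega
          · rw [h7]; omega
        rw [ihr _ h5 l' rfl, sub_self, mul_zero]
      · rfl
      · rfl

end Branching

/-! ### The Pieri formula for horizontal strips -/

section Pieri

variable {K : Type*} [Field K]

theorem map_mem_pow_of_isHomogeneous {σ B : Type*} [CommRing B] [Algebra K B]
    (φ : MvPolynomial σ K →ₐ[K] B) (J : Ideal B) (hJ : ∀ i, φ (MvPolynomial.X i) ∈ J)
    {p : MvPolynomial σ K} {d : ℕ} (hp : p.IsHomogeneous d) : φ p ∈ J ^ d := by
  rw [p.as_sum, map_sum]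
  refine Ideal.sum_mem _ fun m hm => ?_
  have hd : ∑ i ∈ m.support, m i = d := by
    have := hp (MvPolynomial.mem_support_iff.mp hm)
    rw [Finsupp.weight_apply] at this
    simpa [Finsupp.sum] using this
  rw [MvPolynomial.monomial_eq, map_mul, Finsupp.prod, map_prod]
  refine Ideal.mul_mem_left _ _ ?_
  rw [← hd, ← Finset.prod_pow_eq_pow_sum]
  refine Ideal.prod_mem_prod fun i _ => ?_
  rw [map_pow]
  exact Ideal.pow_mem_pow (hJ i) _

variable {B : Type*} [CommRing B] [Algebra K B]

/-- The horizontal strips on top of `r`, weighted by the Pieri coefficients and by powers of `b`. -/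
noncomputable def pieriSum (t : K) {n : ℕ} (φ : MvPolynomial (Fin n) K →ₐ[K] B) (b : B) (N k : ℕ)
    (r : ℕ → ℕ) : B :=
  ∑ m : Fin k → Fin N, (∏ i ∈ Finset.range k,
    (algebraMap K B (phiW t (ext m i) (ext m (i + 1)) (r i) (r (i + 1))) * b ^ (ext m i - r i))) *
    φ (hlCol t n k (ext m))

theorem pieriSum_eq_zero (t : K) {n : ℕ} (φ : MvPolynomial (Fin n) K →ₐ[K] B) (b : B) (N : ℕ)
    {k : ℕ} {r : ℕ → ℕ} (hrk : ∀ j, k ≤ j → r j = 0) (hr : ¬ (Antitone r ∧ r 0 ≤ n)) :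
    pieriSum t φ b N k r = 0 := by
  refine Finset.sum_eq_zero fun m _ => ?_
  by_cases hm : Antitone (ext m) ∧ ext m 0 ≤ n
  swap
  · rw [hlCol_of_neg t hm, map_zero, mul_zero]
  suffices h : ∃ i, i < k ∧ phiW t (ext m i) (ext m (i + 1)) (r i) (r (i + 1)) = 0 by
    obtain ⟨i, hi, h⟩ := h
    rw [Finset.prod_eq_zero (Finset.mem_range.mpr hi), zero_mul]
    rw [h, map_zero, zero_mul]
  by_contra! h
  have h1 : ∀ i, i < k → ext m i = r i ∨ ext m i = r i + 1 := fun i hi => by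
    by_contra h1
    exact h i hi (if_neg h1)
  refine hr ⟨antitone_nat_of_succ_le fun i => ?_, ?_⟩
  · by_contra! h2
    have hik : i + 1 < k := by
      by_contra h3
      rw [hrk (i + 1) (by omega)] at h2
      omega
    have h3 : ext m (i + 1) ≤ ext m i := hm.1 (Nat.le_succ i)
    have h4 := h1 i (by omega)
    have h5 := h1 (i + 1) hik
    refine h i (by omega) ?_
    rw [phiW, if_pos h4, if_pos (by omega), show ext m i - ext m (i + 1) = 0 by omega, pow_zero,
      sub_self]
  · rcases Nat.eq_zero_or_pos k with h2 | h2
    · rw [hrk 0 (by omega)]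
      exact Nat.zero_le n
    · have := h1 0 h2
      omega

/-- The Pieri formula for the Hall-Littlewood analogue of the complete symmetric polynomials,
up to large degree. -/
theorem prod_mul_pieriSum {t : K} (ht0 : t ≠ 0) (ht : ∀ k : ℕ, 0 < k → t ^ k ≠ 1) {n N k : ℕ}
    (hN : n + 1 < N) (φ : MvPolynomial (Fin n) K →ₐ[K] B) (b : B) (J : Ideal B)
    (hJ : ∀ i, φ (MvPolynomial.X i) ∈ J) (r : ℕ → ℕ) (hrk : ∀ j, k ≤ j → r j = 0) :
    (∏ i, (1 + (-b) * φ (MvPolynomial.X i))) * pieriSum t φ b N k r -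
      (∏ i, (1 + (-(algebraMap K B t * b)) * φ (MvPolynomial.X i))) * φ (hlCol t n k r) ∈
      J ^ k := by
  by_cases hr : Antitone r ∧ r 0 ≤ n
  swap
  · rw [pieriSum_eq_zero t φ b N hrk hr, hlCol_of_neg t hr]
    simp
  have hφC : ∀ c : K, φ (MvPolynomial.C c) = algebraMap K B c := fun c => φ.commutes c
  have e1 : (∏ i, (1 + (-b) * φ (MvPolynomial.X i))) * pieriSum t φ b N k r =
      ∑ κ : Fin (k + 1) → Fin N, ((∑ m : Fin k → Fin N, ∏ i ∈ Finset.range k,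
        pieriWeight t b (-b) r (ext κ) i (ext m i) (ext m (i + 1))) * (-b) ^ ext κ k) *
        φ (hlCol t n (k + 1) (ext κ)) := by
    rw [pieriSum, Finset.mul_sum]
    simp only [Finset.sum_mul]
    rw [Finset.sum_comm]
    refine Finset.sum_congr rfl fun m _ => ?_
    have := prod_one_add_mul_hlCol ht (Nat.lt_of_succ_lt hN) (ext m) (fun j hj => ext_of_le m hj)
      (φ : MvPolynomial (Fin n) K →+* B) (-b)
    simp only [RingHom.coe_coe] at this
    rw [mul_left_comm, this, Finset.mul_sum]
    refine Finset.sum_congr rfl fun κ _ => ?_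
    rw [hφC, Finset.prod_range_succ _ k, Finset.prod_range_succ _ k, ext_of_le m (le_refl k),
      ext_of_le κ (le_refl (k + 1)), tbinom_right ht (Nat.zero_le _), Nat.sub_zero, mul_one]
    simp only [pieriWeight, Finset.prod_mul_distrib, map_prod]
    ring
  have e2 := prod_one_add_mul_hlCol ht (Nat.lt_of_succ_lt hN) r hrk
      (φ : MvPolynomial (Fin n) K →+* B) (-(algebraMap K B t * b))
  simp only [RingHom.coe_coe] at e2
  rw [e1, e2, ← Finset.sum_sub_distrib]
  refine Ideal.sum_mem _ fun κ _ => ?_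
  rw [← sub_mul]
  by_cases hκ : Antitone (ext κ) ∧ ext κ 0 ≤ n
  swap
  · rw [hlCol_of_neg t hκ, map_zero, mul_zero]
    exact Ideal.zero_mem _
  -- If κ has at most k columns, the inversion `sum_pieriWeight` gives equality. If column k is
  -- nonempty, so are the k columns before it, and the degree of P_κ exceeds k.
  rcases Nat.eq_zero_or_pos (ext κ k) with h | h
  · rw [sum_pieriWeight ht0 ht b k r (ext κ) hr.1 hκ.1 hrk
      (fun j hj => Nat.eq_zero_of_le_zero ((hκ.1 hj).trans h.le)) (by omega), hφC,
      Finset.prod_range_succ _ k, Finset.prod_range_succ _ k, h, ext_of_le κ (le_refl (k + 1)),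
      hrk k le_rfl, tbinom_right ht le_rfl, Finset.prod_mul_distrib, map_mul, map_prod, map_one]
    simp
  · refine Ideal.mul_mem_left _ _ ?_
    refine Ideal.pow_le_pow_right ?_ (map_mem_pow_of_isHomogeneous φ J hJ
      (isHomogeneous_hlCol t n (k + 1) (ext κ)))
    have : ∑ _j ∈ Finset.range (k + 1), 1 ≤ ∑ j ∈ Finset.range (k + 1), ext κ j :=
      Finset.sum_le_sum fun j hj => h.trans_le (hκ.1 (by rw [Finset.mem_range] at hj; omega))
    simp only [Finset.sum_const, Finset.card_range, smul_eq_mul, mul_one] at this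
    omega

end Pieri

/-! ### Kawanaka's identity in finitely many variables -/

section FiniteIdentity

variable {K : Type*} [Field K]

/-- The left side of Kawanaka's identity in `n` variables, restricted to diagrams with at most `k`
columns. -/
noncomputable def kawanakaSum (t : K) (n N k : ℕ) : MvPolynomial (Fin n) K :=
  ∑ l : Fin k → Fin N, MvPolynomial.C (∏ i ∈ Finset.range k,
    rowWeight t i (ext l i) (ext l (i + 1))) * hlCol t n k (ext l)

/-- The product of `1 - s x_i x_j` over `i ≤ j < n`. -/
noncomputable def pairsProd (s : K) (n : ℕ) : MvPolynomial (Fin n) K :=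
  ∏ i, ∏ j ∈ Finset.Ici i, (1 - MvPolynomial.C s * (MvPolynomial.X i * MvPolynomial.X j))

theorem pairsProd_succ (s : K) (n : ℕ) : pairsProd s (n + 1) =
    MvPolynomial.rename Fin.castSucc (pairsProd s n) *
      (∏ i : Fin n, (1 + (-(MvPolynomial.C s * MvPolynomial.X (Fin.last n))) *
        MvPolynomial.rename Fin.castSucc (MvPolynomial.X i))) *
      (1 - MvPolynomial.C s * MvPolynomial.X (Fin.last n) ^ 2) := by
  have h : ∀ i : Fin n, Finset.Ici i.castSucc =
      insert (Fin.last n) ((Finset.Ici i).map Fin.castSuccEmb) := fun i => by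
    ext j
    refine Fin.lastCases ?_ (fun j => ?_) j
    · simp [Fin.le_last]
    · simp [Fin.castSucc_ne_last]
  have h' : Finset.Ici (Fin.last n) = {Fin.last n} := by
    ext j
    simp [Fin.last_le_iff]
  rw [pairsProd, Fin.prod_univ_castSucc, h', Finset.prod_singleton, pairsProd, map_prod,
    ← Finset.prod_mul_distrib, sq]
  congr 1
  refine Finset.prod_congr rfl fun i _ => ?_
  rw [h, Finset.prod_insert (by simp), Finset.prod_map, map_prod, mul_comm]
  congr 1
  · refine Finset.prod_congr rfl fun j _ => ?_
    simp
  · rw [MvPolynomial.rename_X]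
    ring

/-- In the step, Q is the common middle term: branching and exchange relate it to the sum in n + 1
variables (h1), Pieri at b = y/t relates it to the sum in n variables (h2). The denominators are
cleared, so the claim is a congruence of polynomials. -/
theorem kawanakaSum_mul_sub_mem {t : K} (ht0 : t ≠ 0) (ht : ∀ k : ℕ, 0 < k → t ^ k ≠ 1) {n N : ℕ}
    (hN : n < N) (k : ℕ) :
    kawanakaSum t n N k * pairsProd t⁻¹ n - pairsProd 1 n ∈
      MvPolynomial.idealOfVars (Fin n) K ^ k := by
  induction n with
  | zero =>
    have h1 : kawanakaSum t 0 N k = 1 := by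
      have h0 : ext (fun _ => ⟨0, hN⟩ : Fin k → Fin N) = fun _ => 0 := by
        funext i
        unfold ext
        split_ifs <;> rfl
      rw [kawanakaSum, Finset.sum_eq_single_of_mem (fun _ => ⟨0, hN⟩) (Finset.mem_univ _), h0,
        hlCol_zero ht _ _ fun _ => rfl]
      · simp [rowWeight, oddFact_zero]
      · intro l _ hl
        rw [hlCol_of_neg, mul_zero]
        rintro ⟨h2, h3⟩
        refine hl (funext fun i => Fin.ext ?_)
        have := h2 (Nat.zero_le i)
        rw [ext_of_lt l i.is_lt] at this
        change (l i : ℕ) = 0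
        simp only [Fin.eta] at this
        omega
    simp [h1, pairsProd]
  | succ n ih =>
    set J := MvPolynomial.idealOfVars (Fin (n + 1)) K with hJ
    set y : MvPolynomial (Fin (n + 1)) K := MvPolynomial.X (Fin.last n) with hy
    set ι : MvPolynomial (Fin n) K →ₐ[K] MvPolynomial (Fin (n + 1)) K :=
      MvPolynomial.rename Fin.castSucc with hι
    have hX : ∀ i, (MvPolynomial.X i : MvPolynomial (Fin (n + 1)) K) ∈ J := fun i =>
      Ideal.subset_span ⟨i, rfl⟩
    have hιX : ∀ i, ι (MvPolynomial.X i) ∈ J := fun i => by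
      rw [hι, MvPolynomial.rename_X]
      exact hX _
    have halg : ∀ c : K, algebraMap K (MvPolynomial (Fin (n + 1)) K) c = MvPolynomial.C c :=
      fun c => rfl
    have hιC : ∀ c : K, ι (MvPolynomial.C c) = MvPolynomial.C c := fun c => by
      rw [hι, MvPolynomial.rename_C]
    set b := MvPolynomial.C t⁻¹ * y with hb
    have htb : algebraMap K _ t * b = y := by
      rw [hb, ← mul_assoc, halg, ← map_mul, mul_inv_cancel₀ ht0, map_one, one_mul]
    set Q := ∑ r : Fin k → Fin N, MvPolynomial.C (∏ i ∈ Finset.range k,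
      rowWeight t i (ext r i) (ext r (i + 1))) * pieriSum t ι b N k (ext r) with hQ
    have h1 : (1 - MvPolynomial.C t⁻¹ * y ^ 2) * kawanakaSum t (n + 1) N k - (1 - y ^ 2) * Q ∈
        J ^ k := by
      have e1 : kawanakaSum t (n + 1) N k = ∑ m : Fin k → Fin N,
          (∑ l : Fin k → Fin N, ∏ i ∈ Finset.range k,
            outerWeight t y 0 (ext m) i (ext l i) (ext l (i + 1))) * ι (hlCol t n k (ext m)) := by
        simp only [Finset.sum_mul]
        rw [Finset.sum_comm]
        refine Finset.sum_congr rfl fun l _ => ?_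
        rw [hlCol_eq_branchSum ht0 ht hN k l, branchSum, Finset.mul_sum]
        refine Finset.sum_congr rfl fun m _ => ?_
        simp only [outerWeight, halg, Finset.prod_mul_distrib, map_prod, add_zero]
        ring
      have e2 : Q = ∑ m : Fin k → Fin N,
          (∑ l : Fin k → Fin N, ∏ i ∈ Finset.range k,
            innerWeight t y 0 (ext m) i (ext l i) (ext l (i + 1))) * ι (hlCol t n k (ext m)) := by
        simp only [Finset.sum_mul]
        rw [Finset.sum_comm]
        refine Finset.sum_congr rfl fun l _ => ?_
        rw [pieriSum, Finset.mul_sum]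
        refine Finset.sum_congr rfl fun m _ => ?_
        simp only [innerWeight, halg, Finset.prod_mul_distrib, map_prod, add_zero, hb]
        ring
      rw [e1, e2, Finset.mul_sum, Finset.mul_sum, ← Finset.sum_sub_distrib]
      refine Ideal.sum_mem _ fun m _ => ?_
      by_cases hm : Antitone (ext m) ∧ ext m 0 ≤ n
      swap
      · rw [hlCol_of_neg t hm, map_zero, mul_zero, mul_zero, mul_zero, mul_zero, sub_zero]
        exact Ideal.zero_mem _
      rw [← mul_assoc, ← mul_assoc, ← sub_mul]
      have h2 := sum_outer_inner ht0 y J (hX _) k (ext m) hm.1 (fun j hj => ext_of_le m hj)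
        (show ext m 0 + 1 < N by omega)
      -- The exchange error is only in J^(k - |m|), but it multiplies P_m, which is homogeneous of
      -- degree |m|.
      have h3 := Ideal.mul_mem_mul h2 (map_mem_pow_of_isHomogeneous ι J hιX
        (isHomogeneous_hlCol t n k (ext m)))
      rw [← pow_add] at h3
      exact Ideal.pow_le_pow_right (by omega) h3
    have h2 : (∏ i, (1 + (-b) * ι (MvPolynomial.X i))) * Q -
        (∏ i, (1 + (-y) * ι (MvPolynomial.X i))) * ι (kawanakaSum t n N k) ∈ J ^ k := by
      rw [kawanakaSum, map_sum, hQ, Finset.mul_sum, Finset.mul_sum, ← Finset.sum_sub_distrib]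
      refine Ideal.sum_mem _ fun r _ => ?_
      rw [map_mul, hιC, mul_left_comm, mul_left_comm (∏ i, (1 + (-y) * ι (MvPolynomial.X i))),
        ← mul_sub]
      refine Ideal.mul_mem_left _ _ ?_
      have := prod_mul_pieriSum ht0 ht hN ι b J hιX (ext r) (fun j hj => ext_of_le r hj)
      rwa [htb] at this
    have h3 : ι (kawanakaSum t n N k * pairsProd t⁻¹ n - pairsProd 1 n) ∈ J ^ k := by
      have h4 : MvPolynomial.idealOfVars (Fin n) K ≤ J.comap ι := by
        rw [MvPolynomial.idealOfVars, Ideal.span_le]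
        rintro _ ⟨i, rfl⟩
        exact hιX i
      exact (Ideal.pow_right_mono h4 k).trans (Ideal.le_comap_pow ι k) (ih (by omega))
    rw [pairsProd_succ, pairsProd_succ, ← hι, ← hy, ← hb, MvPolynomial.C_1, one_mul, one_mul]
    rw [map_sub, map_mul] at h3
    have h4 := Ideal.add_mem _ (Ideal.add_mem _
      (Ideal.mul_mem_left _ (ι (pairsProd t⁻¹ n) * ∏ i, (1 + (-b) * ι (MvPolynomial.X i))) h1)
      (Ideal.mul_mem_left _ (ι (pairsProd t⁻¹ n) * (1 - y ^ 2)) h2))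
      (Ideal.mul_mem_left _ ((1 - y ^ 2) * ∏ i, (1 + (-y) * ι (MvPolynomial.X i))) h3)
    convert h4 using 1
    ring

end FiniteIdentity

/-! ### Column sequences, Young diagrams and the coefficients of the identity -/

section ColumnDiagrams

theorem lt_rowLen_iff (μ : YoungDiagram) (i j : ℕ) : j < μ.rowLen i ↔ i < μ.colLen j := by
  rw [← μ.mem_iff_lt_colLen, ← μ.mem_iff_lt_rowLen]

theorem colLen_injective {μ ν : YoungDiagram} (h : ∀ j, μ.colLen j = ν.colLen j) : μ = ν := by
  ext ⟨i, j⟩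
  rw [YoungDiagram.mem_cells, YoungDiagram.mem_cells, μ.mem_iff_lt_colLen, ν.mem_iff_lt_colLen, h]

/-- The Young diagram whose columns are the first `k` entries of a nonincreasing sequence `c`,
each at most `N`. -/
def ofCols (N k : ℕ) (c : ℕ → ℕ) : YoungDiagram where
  cells := (Finset.range N ×ˢ Finset.range k).filter fun p => ∀ j ≤ p.2, p.1 < c j
  isLowerSet := by
    rintro ⟨a1, a2⟩ ⟨b1, b2⟩ ⟨h1, h2⟩ ha
    simp only [Finset.coe_filter, Finset.mem_product, Finset.mem_range, Set.mem_ofPred_eq] at *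
    exact ⟨by omega, fun j hj => lt_of_le_of_lt h1 (ha.2 j (hj.trans h2))⟩

theorem colLen_ofCols {N k : ℕ} {c : ℕ → ℕ} (hc : Antitone c) (hck : ∀ j, k ≤ j → c j = 0)
    (hN : c 0 ≤ N) (j : ℕ) : (ofCols N k c).colLen j = c j := by
  have h : ∀ i, i < (ofCols N k c).colLen j ↔ i < c j := fun i => by
    rw [← YoungDiagram.mem_iff_lt_colLen, ← YoungDiagram.mem_cells]
    simp only [ofCols, Finset.mem_filter, Finset.mem_product, Finset.mem_range]
    constructor
    · exact fun h => h.2 j le_rfl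
    · intro h
      refine ⟨⟨h.trans_le ((hc (Nat.zero_le j)).trans hN), ?_⟩, fun j' hj' => h.trans_le (hc hj')⟩
      by_contra hj
      rw [hck j (by omega)] at h
      omega
  exact eq_of_forall_lt_iff h

theorem card_eq_sum_colLen {μ : YoungDiagram} {k : ℕ} (hk : μ.rowLen 0 ≤ k) :
    μ.card = ∑ j ∈ Finset.range k, μ.colLen j := by
  have h : ∀ p ∈ μ.cells, p.2 ∈ Finset.range k := by
    rintro ⟨i, j⟩ hp
    have h1 : (0, j) ∈ μ := μ.up_left_mem (Nat.zero_le i) le_rfl (YoungDiagram.mem_cells _ |>.mp hp)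
    rw [YoungDiagram.mem_iff_lt_rowLen] at h1
    exact Finset.mem_range.mpr (h1.trans_le hk)
  rw [YoungDiagram.card, Finset.card_eq_sum_card_fiberwise h]
  exact Finset.sum_congr rfl fun j _ => (μ.colLen_eq_card).symm

theorem rowLen_zero_le_card (μ : YoungDiagram) : μ.rowLen 0 ≤ μ.card := by
  rw [μ.rowLen_eq_card]
  exact Finset.card_le_card (Finset.filter_subset _ _)

theorem colLen_zero_le_card (μ : YoungDiagram) : μ.colLen 0 ≤ μ.card := by
  rw [μ.colLen_eq_card]
  exact Finset.card_le_card (Finset.filter_subset _ _)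

theorem countP_rowLens (μ : YoungDiagram) (p : ℕ → Prop) [DecidablePred p] :
    μ.rowLens.countP (fun i => decide (p i)) =
      ((Finset.range (μ.colLen 0)).filter fun x => p (μ.rowLen x)).card := by
  rw [YoungDiagram.rowLens, List.countP_map, List.countP_eq_length_filter]
  rfl

theorem partMult_add_one (μ : YoungDiagram) (i : ℕ) :
    partMult μ (i + 1) = μ.colLen i - μ.colLen (i + 1) := by
  have h3 : μ.colLen (i + 1) ≤ μ.colLen i := μ.colLen_anti i (i + 1) (Nat.le_succ i)
  have h0 : μ.colLen i ≤ μ.colLen 0 := μ.colLen_anti 0 i (Nat.zero_le i)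
  have h1 := countP_rowLens μ (fun x => x = i + 1)
  have h4 : ((Finset.range (μ.colLen 0)).filter fun x => μ.rowLen x = i + 1) =
      Finset.range (μ.colLen i) \ Finset.range (μ.colLen (i + 1)) := by
    ext x
    have := lt_rowLen_iff μ x i
    have := lt_rowLen_iff μ x (i + 1)
    simp only [Finset.mem_filter, Finset.mem_sdiff, Finset.mem_range]
    omega
  rw [h4, Finset.card_sdiff_of_subset (Finset.range_mono h3), Finset.card_range,
    Finset.card_range] at h1
  rw [← h1, partMult, List.count]
  congr 1

theorem card_filter_odd_lt (k L : ℕ) :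
    (∑ j ∈ Finset.range k, if j % 2 = 1 ∧ j < L then 1 else 0) = min L k / 2 := by
  induction k with
  | zero => simp
  | succ k ih =>
    rw [Finset.sum_range_succ, ih]
    split_ifs <;> omega

/-- A row of length L has ⌊L/2⌋ cells in columns of odd index, counted from 0, so (|μ| - o(μ))/2 is
the total length of these columns. In particular the halving in the exponent of t is exact. -/
theorem card_eq_oddParts_add {μ : YoungDiagram} {k : ℕ} (hk : μ.rowLen 0 ≤ k) :
    μ.card = oddParts μ + 2 * ∑ j ∈ Finset.range k with j % 2 = 1, μ.colLen j := by
  have hcol : ∀ j, ∑ x ∈ Finset.range (μ.colLen 0), (if j < μ.rowLen x then 1 else 0) =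
      μ.colLen j := fun j => by
    have h0 : μ.colLen j ≤ μ.colLen 0 := μ.colLen_anti 0 j (Nat.zero_le j)
    rw [← Finset.card_filter]
    have : (Finset.range (μ.colLen 0)).filter (fun x => j < μ.rowLen x) =
        Finset.range (μ.colLen j) := by
      ext x
      have := lt_rowLen_iff μ x j
      simp only [Finset.mem_filter, Finset.mem_range]
      omega
    rw [this, Finset.card_range]
  have hrow : ∀ x, ∑ j ∈ Finset.range k, (if j < μ.rowLen x then 1 else 0) = μ.rowLen x :=
    fun x => by
    have h0 : μ.rowLen x ≤ k := (μ.rowLen_anti 0 x (Nat.zero_le x)).trans hk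
    rw [← Finset.card_filter]
    have : (Finset.range k).filter (fun j => j < μ.rowLen x) = Finset.range (μ.rowLen x) := by
      ext j
      simp only [Finset.mem_filter, Finset.mem_range]
      omega
    rw [this, Finset.card_range]
  have h1 : ∑ j ∈ Finset.range k with j % 2 = 1, μ.colLen j =
      ∑ x ∈ Finset.range (μ.colLen 0), μ.rowLen x / 2 := by
    rw [Finset.sum_congr rfl fun j _ => (hcol j).symm, Finset.sum_comm]
    refine Finset.sum_congr rfl fun x _ => ?_
    have h0 : μ.rowLen x ≤ k := (μ.rowLen_anti 0 x (Nat.zero_le x)).trans hk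
    rw [Finset.sum_filter]
    have h2 := card_filter_odd_lt k (μ.rowLen x)
    rw [min_eq_left h0] at h2
    rw [← h2]
    refine Finset.sum_congr rfl fun j _ => ?_
    split_ifs <;> tauto
  have h2 : oddParts μ = ∑ x ∈ Finset.range (μ.colLen 0), μ.rowLen x % 2 := by
    rw [oddParts, countP_rowLens μ (fun x => x % 2 = 1), Finset.card_filter]
    refine Finset.sum_congr rfl fun x _ => ?_
    split_ifs <;> omega
  rw [h1, h2, Finset.mul_sum, ← Finset.sum_add_distrib, card_eq_sum_colLen hk,
    Finset.sum_congr rfl fun j _ => (hcol j).symm, Finset.sum_comm]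
  refine Finset.sum_congr rfl fun x _ => ?_
  rw [hrow, Nat.mod_add_div]

theorem arm_eq_zero_iff {μ : YoungDiagram} {x j : ℕ} : arm μ (x, j) = 0 ↔ μ.colLen (j + 1) ≤ x := by
  rw [arm, Finset.card_eq_zero, Finset.filter_eq_empty_iff]
  constructor
  · intro h
    by_contra! hx
    rw [← YoungDiagram.mem_iff_lt_colLen] at hx
    exact h ((YoungDiagram.mem_cells _).mpr hx) ⟨rfl, Nat.lt_succ_self j⟩
  · rintro h ⟨x', j'⟩ hp ⟨h1, h2⟩
    simp only at h1 h2
    subst h1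
    rw [YoungDiagram.mem_cells, YoungDiagram.mem_iff_lt_colLen] at hp
    have := μ.colLen_anti (j + 1) j' h2
    omega

theorem leg_eq {μ : YoungDiagram} {x j : ℕ} : leg μ (x, j) = μ.colLen j - (x + 1) := by
  have : (μ.cells.filter fun b => b.2 = j ∧ x < b.1) =
      (Finset.Ico (x + 1) (μ.colLen j)) ×ˢ {j} := by
    ext ⟨x', j'⟩
    simp only [Finset.mem_filter, YoungDiagram.mem_cells, YoungDiagram.mem_iff_lt_colLen,
      Finset.mem_product, Finset.mem_Ico, Finset.mem_singleton]
    constructor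
    · rintro ⟨h1, rfl, h2⟩
      exact ⟨⟨h2, h1⟩, rfl⟩
    · rintro ⟨⟨h2, h1⟩, rfl⟩
      exact ⟨h1, rfl, h2⟩
  rw [leg, this, Finset.card_product, Finset.card_singleton, mul_one, Nat.card_Ico]

variable {K : Type*} [Field K]

/-- The cells of column j with arm 0 are the ends of the rows of length j + 1; along them leg + 1
takes each value from 1 to the multiplicity once. -/
theorem cCoeff_eq_prod (t : K) {μ : YoungDiagram} {k : ℕ} (hk : μ.rowLen 0 ≤ k) :
    cCoeff t μ = ∏ j ∈ Finset.range k, oddFact t (μ.colLen j - μ.colLen (j + 1)) := by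
  unfold cCoeff oddFact
  rw [Finset.prod_sigma']
  refine Finset.prod_bij' (fun p _ => (⟨p.2, μ.colLen p.2 - p.1⟩ : Σ _ : ℕ, ℕ))
    (fun q _ => (μ.colLen q.1 - q.2, q.1)) ?_ ?_ ?_ ?_ ?_
  · rintro ⟨x, j⟩ hp
    rw [Finset.mem_filter, arm_eq_zero_iff, leg_eq, YoungDiagram.mem_cells] at hp
    have h1 : (0, j) ∈ μ := μ.up_left_mem (Nat.zero_le x) le_rfl hp.1
    rw [YoungDiagram.mem_iff_lt_rowLen] at h1
    rw [YoungDiagram.mem_iff_lt_colLen] at hp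
    simp only [Finset.mem_sigma, Finset.mem_range, Finset.mem_filter, Finset.mem_Icc]
    omega
  · rintro ⟨j, i⟩ hq
    simp only [Finset.mem_sigma, Finset.mem_range, Finset.mem_filter, Finset.mem_Icc] at hq
    simp only [Finset.mem_filter, arm_eq_zero_iff, leg_eq, YoungDiagram.mem_cells,
      YoungDiagram.mem_iff_lt_colLen]
    omega
  · rintro ⟨x, j⟩ hp
    rw [Finset.mem_filter, YoungDiagram.mem_cells, YoungDiagram.mem_iff_lt_colLen] at hp
    simp only [Prod.mk.injEq, and_true]
    omega
  · rintro ⟨j, i⟩ hq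
    simp only [Finset.mem_sigma, Finset.mem_range, Finset.mem_filter, Finset.mem_Icc] at hq
    have : μ.colLen j - (μ.colLen j - i) = i := by omega
    simp only [this]
  · rintro ⟨x, j⟩ hp
    rw [Finset.mem_filter, YoungDiagram.mem_cells, YoungDiagram.mem_iff_lt_colLen] at hp
    rw [leg_eq]
    have : μ.colLen j - (x + 1) + 1 = μ.colLen j - x := by omega
    rw [this]

/-- The coefficient of `P_μ` in Kawanaka's identity is a product over the columns of `μ`. -/
theorem prod_rowWeight (t : K) {μ : YoungDiagram} {k : ℕ} (hk : μ.rowLen 0 ≤ k)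
    (hμ : OddPartsEvenMult μ) :
    ∏ j ∈ Finset.range k, rowWeight t j (μ.colLen j) (μ.colLen (j + 1)) =
      t ^ (((oddParts μ : ℤ) - (μ.card : ℤ)) / 2) * cCoeff t μ := by
  have h1 : ((oddParts μ : ℤ) - (μ.card : ℤ)) / 2 =
      -((∑ j ∈ Finset.range k with j % 2 = 1, μ.colLen j : ℕ) : ℤ) := by
    have := card_eq_oddParts_add hk
    omega
  rw [h1, zpow_neg, zpow_natCast, ← inv_pow, ← Finset.prod_pow_eq_pow_sum, Finset.prod_filter,
    cCoeff_eq_prod t hk, ← Finset.prod_mul_distrib]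
  refine Finset.prod_congr rfl fun j _ => ?_
  split_ifs with h
  · exact rowWeight_of_odd t h _ _
  · rw [one_mul]
    refine rowWeight_of_even t (by omega) ?_
    have := hμ (j + 1) (Nat.odd_iff.mpr (by omega))
    rwa [partMult_add_one, Nat.even_iff] at this

theorem prod_rowWeight_eq_zero (t : K) {μ : YoungDiagram} {k : ℕ} (hk : μ.rowLen 0 ≤ k)
    (hμ : ¬ OddPartsEvenMult μ) :
    ∏ j ∈ Finset.range k, rowWeight t j (μ.colLen j) (μ.colLen (j + 1)) = 0 := by
  unfold OddPartsEvenMult at hμ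
  push Not at hμ
  obtain ⟨i, hi, h⟩ := hμ
  obtain ⟨j, rfl⟩ : ∃ j, i = j + 1 := ⟨i - 1, by have := hi.pos; omega⟩
  rw [Nat.odd_iff] at hi
  rw [partMult_add_one, Nat.not_even_iff] at h
  refine Finset.prod_eq_zero (i := j) ?_ (rowWeight_of_even_of_odd t (by omega) h)
  rw [Finset.mem_range]
  by_contra hj
  rw [colLen_eq_zero (show μ.rowLen 0 ≤ j by omega)] at h
  omega

end ColumnDiagrams

/-! ### Convergence and passage to infinitely many variables -/

section PowerSeries

/-- In the expansion over finite sets of indices, a set contributes to a given coefficient only if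
all its members have weighted order at most the weight of that monomial, which leaves finitely many
sets. -/
theorem multipliable_one_add_of_finite {σ R ι : Type*} [CommSemiring R] [TopologicalSpace R]
    (w : σ → ℕ) {f : ι → MvPowerSeries σ R}
    (h : ∀ d : ℕ, {i | (f i).weightedOrder w ≤ d}.Finite) : Multipliable (fun i => 1 + f i) := by
  refine multipliable_one_add_of_summable_prod ?_
  refine MvPowerSeries.WithPiTopology.summable_iff_summable_coeff.mpr fun m =>
    summable_of_hasFiniteSupport ?_
  refine (h (Finsupp.weight w m)).toFinset.powerset.finite_toSet.subset fun s hs => ?_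
  rw [Finset.mem_coe, Finset.mem_powerset]
  intro x hx
  rw [Set.Finite.mem_toFinset, Set.mem_ofPred_eq]
  by_contra! hlt
  refine hs (MvPowerSeries.coeff_eq_zero_of_lt_weightedOrder w (hlt.trans_le ?_))
  exact (Finset.single_le_sum (f := fun i => (f i).weightedOrder w) (fun _ _ => zero_le)
    hx).trans (MvPowerSeries.le_weightedOrder_prod w _ _)

variable {K : Type*} [Field K]

theorem constantCoeff_one_sub_ne_zero (s : K) (i j : ℕ) :
    MvPowerSeries.constantCoeff (1 - MvPowerSeries.C s *
      (MvPowerSeries.X i * MvPowerSeries.X j) : MvPowerSeries ℕ K) ≠ 0 := by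
  simp

theorem multipliable_pairs [TopologicalSpace K] (t : K) :
    Multipliable (fun p : {p : ℕ × ℕ // p.1 ≤ p.2} =>
      (1 - MvPowerSeries.X p.1.1 * MvPowerSeries.X p.1.2 : MvPowerSeries ℕ K) *
        (1 - MvPowerSeries.C t⁻¹ * (MvPowerSeries.X p.1.1 * MvPowerSeries.X p.1.2))⁻¹) := by
  have h : ∀ i j : ℕ, (1 - MvPowerSeries.X i * MvPowerSeries.X j : MvPowerSeries ℕ K) *
        (1 - MvPowerSeries.C t⁻¹ * (MvPowerSeries.X i * MvPowerSeries.X j))⁻¹ =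
      1 + MvPowerSeries.X i * (MvPowerSeries.X j * (MvPowerSeries.C (t⁻¹ - 1) *
        (1 - MvPowerSeries.C t⁻¹ * (MvPowerSeries.X i * MvPowerSeries.X j))⁻¹)) := fun i j => by
    have h1 := MvPowerSeries.mul_inv_cancel _ (constantCoeff_one_sub_ne_zero t⁻¹ i j)
    rw [map_sub, map_one]
    linear_combination h1
  simp only [h]
  -- All x_i x_j have ordinary order 2, so x_i is given the weight i + 1, which leaves finitely many
  -- pairs below each bound.
  refine multipliable_one_add_of_finite (fun i => i + 1) fun d => ?_
  have hfin : {p : {p : ℕ × ℕ // p.1 ≤ p.2} | p.1.1 ≤ d ∧ p.1.2 ≤ d}.Finite := by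
    refine Set.Finite.of_finite_image (f := Subtype.val) ?_ Subtype.val_injective.injOn
    refine (Finset.finite_toSet (Finset.range (d + 1) ×ˢ Finset.range (d + 1))).subset ?_
    rintro _ ⟨p, hp, rfl⟩
    simp only [Finset.coe_product, Set.mem_prod, Finset.mem_coe, Finset.mem_range]
    exact ⟨Nat.lt_succ_of_le hp.1, Nat.lt_succ_of_le hp.2⟩
  refine hfin.subset fun p hp => ?_
  rw [Set.mem_ofPred_eq] at hp
  have hX : ∀ i : ℕ, ((i + 1 : ℕ) : ℕ∞) ≤
      (MvPowerSeries.X i : MvPowerSeries ℕ K).weightedOrder (fun i => i + 1) := fun i => by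
    rw [MvPowerSeries.X, MvPowerSeries.weightedOrder_monomial_of_ne_zero _ one_ne_zero,
      Finsupp.weight_single]
    simp
  have h2 := (((add_le_add (hX p.1.1) ((hX p.1.2).trans le_self_add)).trans
    ((add_le_add_right (MvPowerSeries.le_weightedOrder_mul _) _).trans
      (MvPowerSeries.le_weightedOrder_mul _)))).trans hp
  have h3 : p.1.1 + 1 + (p.1.2 + 1) ≤ d := by exact_mod_cast h2
  exact ⟨by omega, by omega⟩

/-- A polynomial in `n` variables as a power series in infinitely many variables. -/
noncomputable def toSeries (n : ℕ) : MvPolynomial (Fin n) K →+* MvPowerSeries ℕ K :=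
  MvPolynomial.coeToMvPowerSeries.ringHom.comp
    (MvPolynomial.rename (Fin.val : Fin n → ℕ) : MvPolynomial (Fin n) K →ₐ[K] _).toRingHom

theorem coeff_toSeries (n : ℕ) (p : MvPolynomial (Fin n) K) (m : ℕ →₀ ℕ) :
    MvPowerSeries.coeff m (toSeries n p) =
      (MvPolynomial.rename (Fin.val : Fin n → ℕ) p).coeff m :=
  MvPolynomial.coeff_coe _ _

theorem hlPolySeries_eq (t : K) (μ : YoungDiagram) (n : ℕ) :
    hlPolySeries t μ n = toSeries n (hlPoly t μ n) := rfl

theorem toSeries_X (n : ℕ) (i : Fin n) :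
    toSeries n (MvPolynomial.X i : MvPolynomial (Fin n) K) = MvPowerSeries.X (i : ℕ) := by
  simp [toSeries]

theorem toSeries_C (n : ℕ) (c : K) :
    toSeries n (MvPolynomial.C c : MvPolynomial (Fin n) K) = MvPowerSeries.C c := by
  simp [toSeries]

theorem le_order_toSeries {n k : ℕ} {p : MvPolynomial (Fin n) K}
    (hp : p ∈ MvPolynomial.idealOfVars (Fin n) K ^ k) : (k : ℕ∞) ≤ (toSeries n p).order := by
  refine MvPowerSeries.le_order fun m hm => ?_
  rw [coeff_toSeries]
  by_contra hne
  obtain ⟨u, rfl, hu⟩ := MvPolynomial.coeff_rename_ne_zero _ _ _ hne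
  refine hu ((MvPolynomial.mem_pow_idealOfVars_iff' _ _).mp hp u ?_)
  rw [Finsupp.degree_mapDomain] at hm
  exact_mod_cast hm

theorem coeff_toSeries_eq_zero {n d : ℕ} {p : MvPolynomial (Fin n) K} (hp : p.IsHomogeneous d)
    {m : ℕ →₀ ℕ} (hm : m.degree ≠ d) : MvPowerSeries.coeff m (toSeries n p) = 0 := by
  rw [coeff_toSeries]
  exact hp.rename_isHomogeneous.coeff_eq_zero hm

/-- The pairs `i ≤ j < n`. -/
def pairsLt (n : ℕ) : Finset {p : ℕ × ℕ // p.1 ≤ p.2} :=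
  (Finset.range n ×ˢ Finset.range n).subtype fun p => p.1 ≤ p.2

theorem tendsto_pairsLt : Filter.Tendsto pairsLt Filter.atTop Filter.atTop := by
  refine Filter.tendsto_atTop_finset_of_monotone (fun a b hab p hp => ?_) fun p => ⟨p.1.2 + 1, ?_⟩
  · simp only [pairsLt, Finset.mem_subtype, Finset.mem_product, Finset.mem_range] at hp ⊢
    omega
  · have := p.2
    simp only [pairsLt, Finset.mem_subtype, Finset.mem_product, Finset.mem_range]
    omega

theorem toSeries_pairsProd (s : K) (n : ℕ) : toSeries n (pairsProd s n) =
    ∏ p ∈ pairsLt n, (1 - MvPowerSeries.C s *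
      (MvPowerSeries.X p.1.1 * MvPowerSeries.X p.1.2) : MvPowerSeries ℕ K) := by
  rw [pairsLt, Finset.prod_subtype_eq_prod_filter (f := fun p : ℕ × ℕ => (1 - MvPowerSeries.C s *
      (MvPowerSeries.X p.1 * MvPowerSeries.X p.2) : MvPowerSeries ℕ K)),
    Finset.prod_filter, Finset.prod_product, pairsProd, map_prod,
    ← Fin.prod_univ_eq_prod_range (fun i => ∏ j ∈ Finset.range n, if i ≤ j then
      (1 - MvPowerSeries.C s * (MvPowerSeries.X i * MvPowerSeries.X j) : MvPowerSeries ℕ K)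
      else 1)]
  refine Finset.prod_congr rfl fun i _ => ?_
  rw [map_prod, ← Fin.prod_univ_eq_prod_range (fun j => if (i : ℕ) ≤ j then
      (1 - MvPowerSeries.C s * (MvPowerSeries.X (i : ℕ) * MvPowerSeries.X j) : MvPowerSeries ℕ K)
      else 1), ← Finset.filter_le_eq_Ici, Finset.prod_filter]
  refine Finset.prod_congr rfl fun j _ => ?_
  simp only [map_sub, map_mul, map_one, toSeries_X, toSeries_C, Fin.le_def]

/-- The denominator has nonzero constant term, so the congruence modulo the k-th power of the ideal
of variables survives division by it as an order estimate. -/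
theorem coeff_prod_pairsLt {t : K} (ht0 : t ≠ 0) (ht : ∀ k : ℕ, 0 < k → t ^ k ≠ 1) {n N k : ℕ}
    (hN : n < N) {m : ℕ →₀ ℕ} (hm : m.degree < k) :
    MvPowerSeries.coeff m (∏ p ∈ pairsLt n,
      (1 - MvPowerSeries.X p.1.1 * MvPowerSeries.X p.1.2 : MvPowerSeries ℕ K) *
        (1 - MvPowerSeries.C t⁻¹ * (MvPowerSeries.X p.1.1 * MvPowerSeries.X p.1.2))⁻¹) =
      MvPowerSeries.coeff m (toSeries n (kawanakaSum t n N k)) := by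
  set F := ∏ p ∈ pairsLt n,
      (1 - MvPowerSeries.X p.1.1 * MvPowerSeries.X p.1.2 : MvPowerSeries ℕ K) *
        (1 - MvPowerSeries.C t⁻¹ * (MvPowerSeries.X p.1.1 * MvPowerSeries.X p.1.2))⁻¹ with hF
  set D := toSeries n (pairsProd t⁻¹ n) with hD
  have h1 : F * D = toSeries n (pairsProd 1 n) := by
    rw [hF, hD, toSeries_pairsProd, toSeries_pairsProd, ← Finset.prod_mul_distrib]
    refine Finset.prod_congr rfl fun p _ => ?_
    rw [mul_assoc, MvPowerSeries.inv_mul_cancel _ (constantCoeff_one_sub_ne_zero t⁻¹ _ _), mul_one,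
      map_one, one_mul]
  have h2 : MvPowerSeries.constantCoeff D ≠ 0 := by
    rw [hD, toSeries_pairsProd, map_prod]
    exact Finset.prod_ne_zero_iff.mpr fun p _ => constantCoeff_one_sub_ne_zero t⁻¹ _ _
  have h3 := le_order_toSeries (kawanakaSum_mul_sub_mem ht0 ht hN k)
  rw [map_sub, map_mul, ← h1, ← sub_mul] at h3
  have h4 : (k : ℕ∞) ≤ (toSeries n (kawanakaSum t n N k) - F).order := by
    have h5 := (h3.trans le_self_add).trans
      (MvPowerSeries.le_order_mul (g := D⁻¹))
    rwa [mul_assoc, MvPowerSeries.mul_inv_cancel _ h2, mul_one] at h5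
  have h5 := MvPowerSeries.coeff_of_lt_order
    (lt_of_lt_of_le (show (m.degree : ℕ∞) < k by exact_mod_cast hm) h4)
  rw [map_sub, sub_eq_zero] at h5
  exact h5.symm

theorem coeff_hl_eq_zero {t : K} (ht : ∀ k : ℕ, 0 < k → t ^ k ≠ 1) {μ : YoungDiagram} {m : ℕ →₀ ℕ}
    (hm : m.degree ≠ μ.card) : MvPowerSeries.coeff m (hl t μ) = 0 := by
  rw [coeff_hl t ht μ m _ le_rfl, hlPolySeries_eq, hlPoly_eq_hlCol ht (le_max_left _ _) le_rfl]
  rw [card_eq_sum_colLen le_rfl] at hm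
  exact coeff_toSeries_eq_zero (isHomogeneous_hlCol t _ _ _) hm

theorem hasSum_coeff_kawanakaSum [TopologicalSpace K] {t : K} (ht : ∀ k : ℕ, 0 < k → t ^ k ≠ 1)
    {n k : ℕ} {m : ℕ →₀ ℕ} (hk : m.degree < k) (hn : m.degree ≤ n)
    (hn' : m.support.sup id + 1 ≤ n) :
    HasSum (fun μ : YoungDiagram =>
      (∏ j ∈ Finset.range k, rowWeight t j (μ.colLen j) (μ.colLen (j + 1))) *
        MvPowerSeries.coeff m (hl t μ))
      (MvPowerSeries.coeff m (toSeries n (kawanakaSum t n (n + 1) k))) := by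
  classical
  set g : YoungDiagram → K := fun μ =>
      (∏ j ∈ Finset.range k, rowWeight t j (μ.colLen j) (μ.colLen (j + 1))) *
        MvPowerSeries.coeff m (hl t μ) with hg
  set T : Finset (Fin k → Fin (n + 1)) := Finset.univ.filter fun l =>
    Antitone (ext l) ∧ ext l 0 ≤ n ∧ ∑ j ∈ Finset.range k, ext l j = m.degree with hT
  have hcol : ∀ l ∈ T, ∀ j, (ofCols n k (ext l)).colLen j = ext l j := fun l hl =>
    colLen_ofCols (Finset.mem_filter.mp hl).2.1 (fun j hj => ext_of_le l hj)
      (Finset.mem_filter.mp hl).2.2.1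
  have h1 : MvPowerSeries.coeff m (toSeries n (kawanakaSum t n (n + 1) k)) =
      ∑ μ ∈ T.image fun l => ofCols n k (ext l), g μ := by
    rw [Finset.sum_image]
    · rw [kawanakaSum, map_sum, map_sum]
      symm
      refine Finset.sum_subset_zero_on_sdiff (Finset.subset_univ T) ?_ ?_
      · intro l hl
        rw [Finset.mem_sdiff, hT, Finset.mem_filter] at hl
        rw [map_mul, toSeries_C, MvPowerSeries.coeff_C_mul]
        by_cases h : Antitone (ext l) ∧ ext l 0 ≤ n
        · rw [coeff_toSeries_eq_zero (isHomogeneous_hlCol t n k (ext l)), mul_zero]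
          intro h'
          exact hl.2 ⟨Finset.mem_univ l, h.1, h.2, h'.symm⟩
        · rw [hlCol_of_neg t h, map_zero, map_zero, mul_zero]
      · intro l hl
        have hc := hcol l hl
        rw [hT, Finset.mem_filter] at hl
        have hr : (ofCols n k (ext l)).rowLen 0 ≤ k := by
          by_contra! h
          rw [lt_rowLen_iff, hc, ext_of_le l le_rfl] at h
          exact lt_irrefl _ h
        have hn0 : (ofCols n k (ext l)).colLen 0 ≤ n := by rw [hc]; exact hl.2.2.1
        rw [map_mul, toSeries_C, MvPowerSeries.coeff_C_mul]
        simp only [hg]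
        rw [coeff_hl t ht _ m n (max_le hn0 hn'), hlPolySeries_eq, hlPoly_eq_hlCol ht hn0 hr,
          funext hc]
    · intro l hl l' hl' h
      simp only at h
      funext i
      refine Fin.ext ?_
      have h2 := hcol l hl i
      rw [h, hcol l' hl' i, ext_of_lt l i.is_lt, ext_of_lt l' i.is_lt] at h2
      exact h2.symm
  rw [h1]
  refine hasSum_sum_of_ne_finset_zero fun μ hμ => ?_
  by_cases hd : m.degree = μ.card
  swap
  · simp only [hg]
    rw [coeff_hl_eq_zero ht hd, mul_zero]
  refine absurd ?_ hμ
  have hr : μ.rowLen 0 ≤ k := by have := rowLen_zero_le_card μ; omega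
  have hc0 : μ.colLen 0 ≤ n := by have := colLen_zero_le_card μ; omega
  have hc : ∀ j, μ.colLen j ≤ n := fun j => (μ.colLen_anti 0 j (Nat.zero_le j)).trans hc0
  have he : ext (fun i : Fin k => (⟨μ.colLen i, Nat.lt_succ_of_le (hc i)⟩ : Fin (n + 1))) =
      μ.colLen := by
    funext j
    by_cases hj : j < k
    · rw [ext_of_lt _ hj]
    · rw [ext_of_le _ (not_lt.mp hj), colLen_eq_zero (hr.trans (not_lt.mp hj))]
  have hmem : (fun i : Fin k => (⟨μ.colLen i, Nat.lt_succ_of_le (hc i)⟩ : Fin (n + 1))) ∈ T := by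
    rw [hT, Finset.mem_filter, he, hd]
    exact ⟨Finset.mem_univ _, fun i j h => μ.colLen_anti i j h, hc0, (card_eq_sum_colLen hr).symm⟩
  refine Finset.mem_image.mpr ⟨_, hmem, colLen_injective fun j => ?_⟩
  rw [hcol _ hmem, he]

theorem hasSum_kawanaka [TopologicalSpace K] [DiscreteTopology K] {t : K} (ht0 : t ≠ 0)
    (ht : ∀ k : ℕ, 0 < k → t ^ k ≠ 1) :
    HasSum (fun μ : {μ : YoungDiagram // OddPartsEvenMult μ} =>
      (t ^ (((oddParts μ.1 : ℤ) - (μ.1.card : ℤ)) / 2) * cCoeff t μ.1) • hl t μ.1)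
      (∏' p : {p : ℕ × ℕ // p.1 ≤ p.2},
        (1 - MvPowerSeries.X p.1.1 * MvPowerSeries.X p.1.2 : MvPowerSeries ℕ K) *
          (1 - MvPowerSeries.C t⁻¹ * (MvPowerSeries.X p.1.1 * MvPowerSeries.X p.1.2))⁻¹) := by
  rw [MvPowerSeries.WithPiTopology.hasSum_iff_hasSum_coeff]
  intro m
  have h1 := ((MvPowerSeries.WithPiTopology.continuous_coeff K m).tendsto _).comp
    ((multipliable_pairs t).hasProd.comp tendsto_pairsLt)
  -- In the discrete topology the coefficient of the partial products over i ≤ j < n is eventually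
  -- equal to that of the infinite product, so one sufficiently large n serves.
  rw [nhds_discrete, Filter.tendsto_pure] at h1
  obtain ⟨n, hn, hn1, hn2⟩ := (h1.and ((Filter.eventually_ge_atTop m.degree).and
    (Filter.eventually_ge_atTop (m.support.sup id + 1)))).exists
  simp only [Function.comp_apply] at hn
  rw [coeff_prod_pairsLt ht0 ht (Nat.lt_succ_self n) (Nat.lt_succ_self m.degree)] at hn
  rw [← hn]
  have h2 := hasSum_coeff_kawanakaSum ht (Nat.lt_succ_self m.degree) hn1 hn2
  refine (hasSum_subtype_iff_indicator (s := {μ : YoungDiagram | OddPartsEvenMult μ})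
    (f := fun μ => MvPowerSeries.coeff m
      ((t ^ (((oddParts μ : ℤ) - (μ.card : ℤ)) / 2) * cCoeff t μ) • hl t μ))).mpr ?_
  convert h2 using 1
  funext μ
  by_cases hd : m.degree = μ.card
  · have hr : μ.rowLen 0 ≤ m.degree + 1 := by have := rowLen_zero_le_card μ; omega
    by_cases hμ : OddPartsEvenMult μ
    · rw [Set.indicator_of_mem (show μ ∈ {μ | OddPartsEvenMult μ} from hμ),
        prod_rowWeight t hr hμ, MvPowerSeries.coeff_smul]
    · rw [Set.indicator_of_notMem (show μ ∉ {μ | OddPartsEvenMult μ} from hμ),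
        prod_rowWeight_eq_zero t hr hμ, zero_mul]
  · rw [coeff_hl_eq_zero ht hd, mul_zero]
    refine Set.indicator_apply_eq_zero.mpr fun _ => ?_
    rw [MvPowerSeries.coeff_smul, coeff_hl_eq_zero ht hd, mul_zero]

end PowerSeries

end HallLittlewood

theorem theorem2p2 {K : Type*} [Field K] [CharZero K] [TopologicalSpace K] [DiscreteTopology K]
    (t : K) (ht0 : t ≠ 0) (ht : ∀ k : ℕ, 0 < k → t ^ k ≠ 1) :
    Multipliable (fun p : {p : ℕ × ℕ // p.1 ≤ p.2} =>
      (1 - MvPowerSeries.X p.1.1 * MvPowerSeries.X p.1.2 : MvPowerSeries ℕ K) *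
        (1 - MvPowerSeries.C t⁻¹ * (MvPowerSeries.X p.1.1 * MvPowerSeries.X p.1.2))⁻¹) ∧
    HasSum (fun μ : {μ : YoungDiagram // HallLittlewood.OddPartsEvenMult μ} =>
      (t ^ (((HallLittlewood.oddParts μ.1 : ℤ) - (μ.1.card : ℤ)) / 2) *
        HallLittlewood.cCoeff t μ.1) • HallLittlewood.hl t μ.1)
      (∏' p : {p : ℕ × ℕ // p.1 ≤ p.2},
        (1 - MvPowerSeries.X p.1.1 * MvPowerSeries.X p.1.2 : MvPowerSeries ℕ K) *
          (1 - MvPowerSeries.C t⁻¹ * (MvPowerSeries.X p.1.1 * MvPowerSeries.X p.1.2))⁻¹) :=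
  ⟨HallLittlewood.multipliable_pairs t, HallLittlewood.hasSum_kawanaka ht0 ht⟩
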